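/- Let $\mathcal L_{SC}=\{\mathbf 0,\mathbf 1,\vee,\wedge,-\}\cup\{C^i : i\in\mathbb N\}$, where $-$ is a binary and the $C^i$ are unary function symbols, and let $d\ge 0$ be an integer. In a co-Heyting algebra, $a-b$ is the least $c$ with $a\le b\vee c$, and $b\ll a$ means that $b\vee c<a$ for every $c<a$. In an $\mathcal L_{SC}$-structure whose reduct to $\{\mathbf 0,\mathbf 1,\vee,\wedge,-\}$ is a co-Heyting algebra, put $\operatorname{scdim}\mathbf 0=-\infty$ and, for $a\ne\mathbf 0$, $\operatorname{scdim} a=\min\{k\in\mathbb N : a=\bigvee_{0\le i\le k}C^i(a)\}$ ($+\infty$ if there is no such $k$). Such a structure is a *$d$-subscaled lattice* if for all elements $a,b$: 1. $\bigvee_{0\le i\le d}C^i(a)=a$, and $C^i(a)=\mathbf 0$ for all $i>d$; 2. for all $I\subseteq\{0,\dots,d\}$ and all $k\in\mathbb N$, $C^k\bigl(\bigvee_{i\in I}C^i(a)\bigr)$ is $C^k(a)$ if $k\in I$ and $\mathbf 0$ if $k\notin I$; 3. $C^k(a\vee b)=C^k(a)\vee C^k(b)$ for all $k\ge\max(\operatorname{scdim}a,\operatorname{scdim}b)$;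 4. $\operatorname{scdim}(C^i(a)\wedge C^j(a))<\min(i,j)$ for all $i\ne j$; 5. $C^k(a)-b=C^k(a)-C^k(b)$ for all $k\ge\operatorname{scdim}b$; 6. if $a\neq\mathbf 0$ and $b\ll a$ then $\operatorname{scdim}b<\operatorname{scdim}a$. An element $a$ is *$k$-sc-pure* if $\operatorname{scdim}(a-b)=k$ for every $b$ with $a-b\ne\mathbf 0$. A *super $d$-scaled lattice* is a structure $L$ which is an $e$-subscaled lattice for some $e\in\mathbb N$, satisfies $\operatorname{scdim}\mathbf 1\le d$, and has the following two properties. - *Catenarity*: for all integers $0\le r\le q\le p$ and all elements $c\le a\ne\mathbf 0$, if $c$ is $r$-sc-pure and $a$ is $p$-sc-pure, then there is a non-zero $q$-sc-pure $b$ with $c\le b\le a$. - *Splitting*: for all $b_1,b_2,a$ with $b_1\vee b_2\ll a\neq\mathbf 0$ there are non-zero $a_1\ge b_1$ and $a_2\ge b_2$ with $a_1=a-a_2$, $a_2=a-a_1$ and $a_1\wedge a_2=b_1\wedge b_2$. A $d$-subscaled lattice is *prime* if no proper $\mathcal L_{SC}$-substructure of it is a $d$-subscaled lattice. Let $\bar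 T_d$ be the theory of super $d$-scaled lattices and, for a prime $d$-subscaled lattice $P$, let $\bar T_{d,P}$ be the theory of those super $d$-scaled lattices into which $P$ embeds. A theory is decidable (a set of sentences is recursive) if the set of Gödel numbers of its consequences (of its elements) is recursive. Then: 1. For every prime $d$-subscaled lattice $P$, the theory $\bar T_{d,P}$ is $\aleph_0$-categorical (any two models of cardinality $\aleph_0$ are isomorphic) and complete; the class of super $d$-scaled lattices into which $P$ embeds is the class of models of a recursive set of sentences; and $\bar T_{d,P}$ is decidable. 2. There are only finitely many prime $d$-subscaled lattices up to isomorphism. 3. A theory $T$ is a completion of $\bar T_d$ (a complete consistent theory of which all sentences of $\bar T_d$ are consequences) if and only if, for some prime $d$-subscaled lattice $P$, $T$ has the same consequences as $\bar T_{d,P}$. 4. There is a finite set $F$ of $\mathcal L_{SC}$-sentences such that an $\mathcal L_{SC}$-structure is a super $d$-scaled lattice if and only if it is a model of $F$ and of the sentences $\forall x\; C^i(x)=\mathbf 0$ for $i>d$. In particular, the class of super $d$-scaled lattices is the class of models of a recursive set of sentences; and $\bar T_d$ is decidable. -/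

import Mathlib

open FirstOrder FirstOrder.Language

/-! ## The language of subscaled lattices -/

/-- Function symbols: `0`, `1`, join, meet, the difference `a - b`, and the unary symbols `C^i`. -/
inductive ScFunc : ℕ → Type
  | bot : ScFunc 0
  | top : ScFunc 0
  | sup : ScFunc 2
  | inf : ScFunc 2
  | sdiff : ScFunc 2
  | pc (i : ℕ) : ScFunc 1

/-- The language `{0, 1, ∨, ∧, -} ∪ {C^i : i ∈ ℕ}`, without relation symbols. -/
abbrev LSC : FirstOrder.Language.{0, 0} where
  Functions := ScFunc
  Relations := fun _ => Empty

/-! ## Co-Heyting algebras with pure components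

Here `L` is a co-Heyting algebra (`a \ b` is the least `c` with `a ≤ b ⊔ c`) and `C i` stands for
the interpretation of the symbol `C^i`. -/

section Algebra

variable {L : Type*} [CoheytingAlgebra L]

/-- The relation `b ≪ a`. -/
def Negligible (b a : L) : Prop := ∀ c : L, c < a → b ⊔ c < a

open Classical in
/-- The sc-dimension: `-∞` at `0`, and otherwise the least `k` such that `a` is the join of
the `C^i(a)`, `i ≤ k` (`+∞` if there is none). -/
noncomputable def scdim (C : ℕ → L → L) (a : L) : WithBot ℕ∞ :=
  if a = ⊥ then ⊥
  else ((⨅ k ∈ {k : ℕ | a = (Finset.range (k + 1)).sup (fun i => C i a)}, (k : ℕ∞) : ℕ∞) :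
    WithBot ℕ∞)

/-- The axioms of `d`-subscaled lattices. -/
structure IsSubscaled (d : ℕ) (C : ℕ → L → L) : Prop where
  join_pc : ∀ a : L, (Finset.range (d + 1)).sup (fun i => C i a) = a
  pc_eq_bot : ∀ (a : L) (i : ℕ), d < i → C i a = ⊥
  pc_join_of_notMem : ∀ (a : L) (I : Finset ℕ), I ⊆ Finset.range (d + 1) → ∀ k : ℕ, k ∉ I →
    C k (I.sup fun i => C i a) = ⊥
  pc_join_of_mem : ∀ (a : L) (I : Finset ℕ), I ⊆ Finset.range (d + 1) → ∀ k : ℕ, k ∈ I →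
    C k (I.sup fun i => C i a) = C k a
  pc_sup : ∀ (a b : L) (k : ℕ), max (scdim C a) (scdim C b) ≤ (k : WithBot ℕ∞) →
    C k (a ⊔ b) = C k a ⊔ C k b
  scdim_inf_lt : ∀ (a : L) (i j : ℕ), i ≠ j →
    scdim C (C i a ⊓ C j a) < ((min i j : ℕ) : WithBot ℕ∞)
  pc_sdiff : ∀ (a b : L) (k : ℕ), scdim C b ≤ (k : WithBot ℕ∞) →
    C k a \ b = C k a \ C k b
  scdim_lt : ∀ a b : L, a ≠ ⊥ → Negligible b a → scdim C b < scdim C a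

/-- `a` is `k`-sc-pure. -/
def IsScPure (C : ℕ → L → L) (k : ℕ) (a : L) : Prop :=
  ∀ b : L, a \ b ≠ ⊥ → scdim C (a \ b) = (k : WithBot ℕ∞)

/-- The Catenarity property. -/
def IsCatenary (C : ℕ → L → L) : Prop :=
  ∀ r q p : ℕ, r ≤ q → q ≤ p → ∀ c a : L, c ≤ a → a ≠ ⊥ → IsScPure C r c → IsScPure C p a →
    ∃ b : L, b ≠ ⊥ ∧ IsScPure C q b ∧ c ≤ b ∧ b ≤ a

variable (L) in
/-- The Splitting property. -/
def HasSplitting : Prop :=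
  ∀ b₁ b₂ a : L, Negligible (b₁ ⊔ b₂) a → a ≠ ⊥ →
    ∃ a₁ a₂ : L, a₁ ≠ ⊥ ∧ a₂ ≠ ⊥ ∧ b₁ ≤ a₁ ∧ b₂ ≤ a₂ ∧
      a₁ = a \ a₂ ∧ a₂ = a \ a₁ ∧ a₁ ⊓ a₂ = b₁ ⊓ b₂

/-- Super `d`-scaled lattices: subscaled lattices of sc-dimension at most `d` having the
Catenarity and the Splitting properties. -/
structure IsSuperScaled (d : ℕ) (C : ℕ → L → L) : Prop where
  subscaled : ∃ e : ℕ, IsSubscaled e C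
  scdim_le : scdim C (⊤ : L) ≤ (d : WithBot ℕ∞)
  catenary : IsCatenary C
  splitting : HasSplitting L

end Algebra

/-! ## The corresponding classes of first-order structures -/

/-- The interpretation of `C^i` in a structure. -/
def pcMap (M : Type*) [LSC.Structure M] (i : ℕ) (a : M) : M :=
  Structure.funMap (L := LSC) (ScFunc.pc i) ![a]

/-- The symbols `0, 1, ∨, ∧, -` are interpreted in `M` by the operations of the given
co-Heyting algebra. -/
structure IsTCReduct (M : Type*) [LSC.Structure M] [CoheytingAlgebra M] : Prop where
  bot_eq : Structure.funMap (L := LSC) ScFunc.bot ![] = (⊥ : M)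
  top_eq : Structure.funMap (L := LSC) ScFunc.top ![] = (⊤ : M)
  sup_eq : ∀ a b : M, Structure.funMap (L := LSC) ScFunc.sup ![a, b] = a ⊔ b
  inf_eq : ∀ a b : M, Structure.funMap (L := LSC) ScFunc.inf ![a, b] = a ⊓ b
  sdiff_eq : ∀ a b : M, Structure.funMap (L := LSC) ScFunc.sdiff ![a, b] = a \ b

/-- The structure `M` is a `d`-subscaled lattice. -/
def SubscaledLattice (d : ℕ) (M : Type*) [LSC.Structure M] : Prop :=
  ∃ _ : CoheytingAlgebra M, IsTCReduct M ∧ IsSubscaled d (pcMap M)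

/-- The structure `M` is a super `d`-scaled lattice. -/
def SuperScaledLattice (d : ℕ) (M : Type*) [LSC.Structure M] : Prop :=
  ∃ _ : CoheytingAlgebra M, IsTCReduct M ∧ IsSuperScaled d (pcMap M)

/-- The structure `P` is a prime `d`-subscaled lattice: a `d`-subscaled lattice no proper
substructure of which is a `d`-subscaled lattice. -/
def PrimeSubscaledLattice (d : ℕ) (P : Type*) [LSC.Structure P] : Prop :=
  SubscaledLattice d P ∧ ∀ S : LSC.Substructure P, SubscaledLattice d S → S = ⊤

/-- The theory of super `d`-scaled lattices. -/
def superTheory (d : ℕ) : LSC.Theory :=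
  {φ | ∀ (M : Type) [LSC.Structure M], SuperScaledLattice d M → M ⊨ φ}

/-- The theory of super `d`-scaled lattices containing a copy of `P`. -/
def superTheoryOver (d : ℕ) (P : Type) [LSC.Structure P] : LSC.Theory :=
  {φ | ∀ (M : Type) [LSC.Structure M],
    SuperScaledLattice d M → Nonempty (P ↪[LSC] M) → M ⊨ φ}

/-! ## Completions, Gödel numbers and decidability -/

/-- `T'` has the same consequences as `T`. -/
def SameConsequences (T T' : LSC.Theory) : Prop :=
  ∀ φ : LSC.Sentence, T ⊨ᵇ φ ↔ T' ⊨ᵇ φ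

/-- `T'` is a completion of `T`: a complete (in particular satisfiable) theory of which every
sentence of `T` is a consequence. -/
def IsCompletion (T T' : LSC.Theory) : Prop :=
  T'.IsComplete ∧ ∀ φ ∈ T, T' ⊨ᵇ φ

/-- Gödel numbers of terms in the variables `0, …, n - 1`. -/
def termCode {n : ℕ} : LSC.Term (Empty ⊕ Fin n) → ℕ
  | .var (.inl e) => e.elim
  | .var (.inr i) => Nat.pair 0 i
  | .func ScFunc.bot _ => Nat.pair 1 0
  | .func ScFunc.top _ => Nat.pair 2 0
  | .func ScFunc.sup ts => Nat.pair 3 (Nat.pair (termCode (ts 0)) (termCode (ts 1)))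
  | .func ScFunc.inf ts => Nat.pair 4 (Nat.pair (termCode (ts 0)) (termCode (ts 1)))
  | .func ScFunc.sdiff ts => Nat.pair 5 (Nat.pair (termCode (ts 0)) (termCode (ts 1)))
  | .func (ScFunc.pc i) ts => Nat.pair 6 (Nat.pair i (termCode (ts 0)))

/-- Gödel numbers of formulas in the free variables `0, …, n - 1` (the quantifier of
`BoundedFormula.all` binds the variable `n`). -/
def formulaCode : {n : ℕ} → LSC.BoundedFormula Empty n → ℕ
  | _, .falsum => Nat.pair 0 0
  | _, .equal t u => Nat.pair 1 (Nat.pair (termCode t) (termCode u))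
  | _, .rel R _ => Empty.elim R
  | _, .imp φ ψ => Nat.pair 2 (Nat.pair (formulaCode φ) (formulaCode ψ))
  | _, .all φ => Nat.pair 3 (formulaCode φ)

theorem termCode_injective {n : ℕ} :
    Function.Injective (termCode : LSC.Term (Empty ⊕ Fin n) → ℕ) := by
  intro t
  induction t with
  | var x =>
    intro u h
    rcases x with e | i
    · exact e.elim
    rcases u with (e | j) | ⟨g, us⟩
    · exact e.elim
    · simp only [termCode, Nat.pair_eq_pair, true_and] at h
      rw [Fin.ext h]
    · cases g <;> simp [termCode, Nat.pair_eq_pair] at h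
  | @func l f ts ih =>
    intro u h
    rcases u with (e | j) | ⟨g, us⟩
    · exact e.elim
    · cases f <;> simp [termCode, Nat.pair_eq_pair] at h
    · cases f <;> cases g <;> simp [termCode, Nat.pair_eq_pair] at h <;>
        first
        | exact congrArg _ (funext fun x => x.elim0)
        | (obtain ⟨h0, h1⟩ := h
           exact congrArg _ (funext (Fin.forall_fin_two.2 ⟨ih 0 h0, ih 1 h1⟩)))
        | (obtain ⟨rfl, h1⟩ := h
           exact congrArg _ (funext (Fin.forall_fin_one.2 (ih 0 h1))))

theorem formulaCode_injective {n : ℕ} :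
    Function.Injective (formulaCode : LSC.BoundedFormula Empty n → ℕ) := by
  intro φ
  induction φ with
  | falsum =>
    intro ψ h
    cases ψ with
    | rel R _ => exact Empty.elim R
    | _ => simp_all [formulaCode, Nat.pair_eq_pair]
  | equal t u =>
    intro ψ h
    cases ψ with
    | rel R _ => exact Empty.elim R
    | equal t' u' =>
      simp only [formulaCode, Nat.pair_eq_pair, true_and] at h
      rw [termCode_injective h.1, termCode_injective h.2]
    | _ => simp [formulaCode, Nat.pair_eq_pair] at h
  | rel R _ => exact Empty.elim R
  | imp φ₁ φ₂ ih₁ ih₂ =>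
    intro ψ h
    cases ψ with
    | rel R _ => exact Empty.elim R
    | imp ψ₁ ψ₂ =>
      simp only [formulaCode, Nat.pair_eq_pair, true_and] at h
      rw [ih₁ h.1, ih₂ h.2]
    | _ => simp [formulaCode, Nat.pair_eq_pair] at h
  | all φ ih =>
    intro ψ h
    cases ψ with
    | rel R _ => exact Empty.elim R
    | all ψ =>
      simp only [formulaCode, Nat.pair_eq_pair, true_and] at h
      rw [ih h]
    | _ => simp [formulaCode, Nat.pair_eq_pair] at h

/-- A set of sentences is recursive if the set of their Gödel numbers is. -/
def IsRecursiveSet (A : Set LSC.Sentence) : Prop :=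
  ComputablePred fun m : ℕ => ∃ φ ∈ A, formulaCode φ = m

/-- A theory is decidable if the set of its consequences is recursive. -/
def IsDecidableTheory (T : LSC.Theory) : Prop :=
  IsRecursiveSet {φ : LSC.Sentence | T ⊨ᵇ φ}

/-! The proof combines a duality for finite subscaled lattices with an extension property of super
scaled ones.

Duality. For a `k`-pure `a`, the equation `a \ b = a` means that `a ⊓ b` has dimension less than
`k`; so `k`-pure elements behave like a Boolean algebra modulo elements of smaller dimension.
Decomposing generators into disjoint pure pieces, from the top dimension downwards, shows that a
finitely generated subscaled lattice is finite, with a bound depending only on `d` and the number of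
generators (`IsSubscaled.exists_isRep`). It is the lattice of downsets of the poset of its
join-irreducible elements, labelled by dimension, and inclusions of such lattices are dual to the
maps `IsScMap` (`IsRep.exists_isScMap`, `DimPoset.comap`).

Extension. With Catenarity and Splitting, a copy of the downsets of `J₀` extends along every
`IsScMap` from a finite `J` to `J₀` (`IsRep.exists_extension`). The representation is pulled back to
`J`, and the points of its fibres are separated one at a time: Splitting separates the points of an
antichain, and Catenarity inserts pieces of smaller dimension below a given one.

Consequences. Finite sublattices of two super scaled lattices can be matched back and forth, so a
common copy of `P` extends to an isomorphism of countable models. A prime lattice is generated by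
the constants, hence has bounded size, and there are finitely many. Models over `P` exist: from a
poset one builds a cover that contains witnesses for Catenarity and Splitting, and takes the limit
of the iterated covers (`DimPoset.superScaledLattice_limit`).

Decidability. Choosing an element of a model amounts to choosing a one-step extension of a finite
poset, of bounded size, together with a downset. Truth of a sentence is therefore computed by a
primitive recursive search over coded finite posets (`eval_iff`). The result does not depend on the
model, which also gives completeness. Every super scaled lattice contains a prime one, so the whole
theory is decided by finitely many such searches, and the completions are the theories over the
prime lattices. -/

/-! ## Calculus of the sc-dimension -/

/-- The sc-dimension of `a` is less than `k`. -/
def DimLt {L : Type*} [CoheytingAlgebra L] (C : ℕ → L → L) (k : ℕ) (a : L) : Prop :=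
  (Finset.range k).sup (fun i => C i a) = a

theorem dimLt_zero {L : Type*} [CoheytingAlgebra L] {C : ℕ → L → L} {a : L} :
    DimLt C 0 a ↔ a = ⊥ := by
  simp [DimLt, eq_comm]

/-- Only `C i a ≤ a` is assumed, because the equivalence is also needed while the subscaled axioms
are still being verified. -/
theorem scdim_lt_iff_of_pc_le {L : Type*} [CoheytingAlgebra L] {C : ℕ → L → L}
    (hC : ∀ i a, C i a ≤ a) {k : ℕ} {a : L} :
    scdim C a < (k : WithBot ℕ∞) ↔ DimLt C k a := by
  unfold scdim
  by_cases ha : a = ⊥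
  · subst ha
    exact iff_of_true (by rw [if_pos rfl]; exact WithBot.bot_lt_coe (k : ℕ∞))
      (le_bot_iff.1 (Finset.sup_le fun i _ => hC i ⊥))
  · rw [if_neg ha]
    have e : ((k : ℕ) : WithBot ℕ∞) = (((k : ℕ) : ℕ∞) : WithBot ℕ∞) := rfl
    rw [e, WithBot.coe_lt_coe, iInf_lt_iff]
    constructor
    · rintro ⟨i, hi⟩
      rw [iInf_lt_iff] at hi
      obtain ⟨h1, h2⟩ := hi
      have h2 : i < k := by exact_mod_cast h2
      refine le_antisymm (Finset.sup_le fun i _ => hC i a) ?_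
      conv_lhs => rw [show a = _ from h1]
      exact Finset.sup_mono (Finset.range_subset_range.2 h2)
    · intro h1
      rcases k with _ | k
      · exact absurd (dimLt_zero.1 h1) ha
      · exact ⟨k, by
          rw [iInf_lt_iff]
          exact ⟨Eq.symm h1, by exact_mod_cast Nat.lt_succ_self k⟩⟩

theorem scdim_le_iff_of_pc_le {L : Type*} [CoheytingAlgebra L] {C : ℕ → L → L}
    (hC : ∀ i a, C i a ≤ a) {k : ℕ} {a : L} :
    scdim C a ≤ (k : WithBot ℕ∞) ↔ DimLt C (k + 1) a := by
  rw [← scdim_lt_iff_of_pc_le hC]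
  have e : ((k : ℕ) : WithBot ℕ∞) = (((k : ℕ) : ℕ∞) : WithBot ℕ∞) := rfl
  have e' : ((k + 1 : ℕ) : WithBot ℕ∞) = (((k + 1 : ℕ) : ℕ∞) : WithBot ℕ∞) := rfl
  rw [e, e']
  cases scdim C a with
  | bot => simp
  | coe x =>
    rw [WithBot.coe_lt_coe, WithBot.coe_le_coe]
    push_cast
    rw [ENat.lt_add_one_iff (ENat.natCast_ne_top k)]

/-- Replaces the quantifier in `≪` by equations, so that the axioms become universal. The main point
is to test the definition on `c = a \ b`, whose join with `b` lies above `a`. -/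
theorem negligible_iff {L : Type*} [CoheytingAlgebra L] {a b : L} (ha : a ≠ ⊥) :
    Negligible b a ↔ b ≤ a ∧ a \ b = a := by
  constructor
  · intro h
    refine ⟨?_, ?_⟩
    · have := h ⊥ (bot_lt_iff_ne_bot.2 ha)
      simpa using this.le
    · by_contra hne
      have h1 := h (a \ b) (lt_of_le_of_ne sdiff_le hne)
      exact absurd (le_sup_sdiff (a := b) (b := a)) (by
        intro h2; exact lt_irrefl _ (lt_of_le_of_lt h2 h1))
  · rintro ⟨h1, h2⟩ c hc
    refine lt_of_le_of_ne (sup_le h1 hc.le) fun h => ?_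
    have : a \ b ≤ c := sdiff_le_iff.2 h.ge
    exact lt_irrefl _ (lt_of_le_of_lt (h2 ▸ this) hc)

namespace IsSubscaled

variable {L : Type*} [CoheytingAlgebra L] {C : ℕ → L → L} {d : ℕ}

theorem pc_le (h : IsSubscaled d C) (k : ℕ) (a : L) : C k a ≤ a := by
  by_cases hk : k < d + 1
  · calc C k a ≤ (Finset.range (d + 1)).sup (fun i => C i a) :=
        Finset.le_sup (f := fun i => C i a) (Finset.mem_range.2 hk)
      _ = a := h.join_pc a
  · rw [h.pc_eq_bot a k (by omega)]; exact bot_le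

theorem pc_bot (h : IsSubscaled d C) (k : ℕ) : C k ⊥ = ⊥ := le_bot_iff.1 (h.pc_le k ⊥)

theorem pc_pc (h : IsSubscaled d C) (k : ℕ) (a : L) : C k (C k a) = C k a := by
  by_cases hk : k < d + 1
  · simpa using h.pc_join_of_mem a {k} (by simpa using hk) k (by simp)
  · rw [h.pc_eq_bot _ k (by omega), h.pc_eq_bot _ k (by omega)]

theorem sup_range_inter (h : IsSubscaled d C) (k : ℕ) (a : L) :
    (Finset.range k).sup (fun i => C i a) =
      (Finset.range k ∩ Finset.range (d + 1)).sup (fun i => C i a) := by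
  apply le_antisymm
  · refine Finset.sup_le fun i hi => ?_
    by_cases hk : i < d + 1
    · exact Finset.le_sup (f := fun i => C i a) (by simpa [hk] using hi)
    · rw [h.pc_eq_bot a i (by omega)]; exact bot_le
  · exact Finset.sup_mono Finset.inter_subset_left

theorem dimLt_iff (h : IsSubscaled d C) {k : ℕ} {a : L} :
    DimLt C k a ↔ ∀ i, k ≤ i → C i a = ⊥ := by
  constructor
  · intro h1 i hi
    have := h.pc_join_of_notMem a (Finset.range k ∩ Finset.range (d + 1)) Finset.inter_subset_right
      i (by simp; omega)
    rwa [← h.sup_range_inter, h1] at this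
  · intro h1
    refine le_antisymm (Finset.sup_le fun i _ => h.pc_le i a) ?_
    calc a = (Finset.range (d + 1)).sup (fun i => C i a) := (h.join_pc a).symm
      _ ≤ _ := Finset.sup_le fun i _ => by
        by_cases hk : i < k
        · exact Finset.le_sup (f := fun i => C i a) (by simpa using hk)
        · rw [h1 i (by omega)]; exact bot_le

theorem dimLt_mono (h : IsSubscaled d C) {k l : ℕ} {a : L} (hkl : k ≤ l) (ha : DimLt C k a) :
    DimLt C l a :=
  h.dimLt_iff.2 fun i hi => h.dimLt_iff.1 ha i (hkl.trans hi)

theorem dimLt_top (h : IsSubscaled d C) (a : L) : DimLt C (d + 1) a := h.join_pc a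

theorem dimLt_bot (h : IsSubscaled d C) (k : ℕ) : DimLt C k ⊥ :=
  h.dimLt_iff.2 fun i _ => h.pc_bot i

theorem scdim_lt_iff (h : IsSubscaled d C) {k : ℕ} {a : L} :
    scdim C a < (k : WithBot ℕ∞) ↔ DimLt C k a := scdim_lt_iff_of_pc_le h.pc_le

theorem scdim_le_iff (h : IsSubscaled d C) {k : ℕ} {a : L} :
    scdim C a ≤ (k : WithBot ℕ∞) ↔ DimLt C (k + 1) a := scdim_le_iff_of_pc_le h.pc_le

/-- The bounded witness makes the comparison of two dimensions a finite disjunction of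
quantifier-free conditions. The witness is the least natural number bounding the dimension of `a`.
-/
theorem scdim_lt_scdim_iff (h : IsSubscaled d C) {a b : L} :
    scdim C b < scdim C a ↔ ∃ k ≤ d, DimLt C k b ∧ ¬ DimLt C k a := by
  constructor
  · intro h1
    have h2 : ∃ k : ℕ, scdim C a ≤ (k : WithBot ℕ∞) := ⟨d, h.scdim_le_iff.2 (h.dimLt_top a)⟩
    classical
    have h3 := Nat.find_spec h2
    set k := Nat.find h2 with hk
    refine ⟨k, Nat.find_min' h2 (h.scdim_le_iff.2 (h.dimLt_top a)),
      h.scdim_lt_iff.1 (h1.trans_le h3), fun h4 => ?_⟩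
    rcases Nat.eq_zero_or_pos k with h5 | h5
    · rw [h5] at h4
      have h6 : a = ⊥ := dimLt_zero.1 h4
      rw [h6] at h1
      simp [scdim] at h1
    · have h6 : k - 1 + 1 = k := by omega
      exact Nat.find_min h2 (m := k - 1) (by omega) (h.scdim_le_iff.2 (by rwa [h6]))
  · rintro ⟨k, -, h1, h2⟩
    rw [← h.scdim_lt_iff] at h1 h2
    exact h1.trans_le (not_lt.1 h2)

theorem pc_sup_of_dimLt (h : IsSubscaled d C) {k : ℕ} {a b : L} (ha : DimLt C (k + 1) a)
    (hb : DimLt C (k + 1) b) : C k (a ⊔ b) = C k a ⊔ C k b :=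
  h.pc_sup a b k (max_le (h.scdim_le_iff.2 ha) (h.scdim_le_iff.2 hb))

theorem dimLt_sup (h : IsSubscaled d C) {k : ℕ} {a b : L} (ha : DimLt C k a) (hb : DimLt C k b) :
    DimLt C k (a ⊔ b) :=
  h.dimLt_iff.2 fun i hi => by
    rw [h.pc_sup_of_dimLt (h.dimLt_mono (by omega) ha) (h.dimLt_mono (by omega) hb),
      h.dimLt_iff.1 ha i hi, h.dimLt_iff.1 hb i hi, sup_bot_eq]

theorem dimLt_finsetSup (h : IsSubscaled d C) {k : ℕ} {ι : Type*} {s : Finset ι} {f : ι → L}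
    (hf : ∀ i ∈ s, DimLt C k (f i)) : DimLt C k (s.sup f) := by
  classical
  induction s using Finset.induction_on with
  | empty => exact h.dimLt_bot k
  | insert i s _ ih =>
    rw [Finset.sup_insert]
    exact h.dimLt_sup (hf i (by simp)) (ih fun j hj => hf j (by simp [hj]))

/-- If `dim a ≤ n` with `n ≥ k`, additivity of `C n` on `a ⊔ b = b` gives `C n a ≤ C n b = ⊥`, so
the bound on `dim a` drops by one. A failure at `k` would therefore propagate to all larger bounds,
contradicting `dim a ≤ d`. -/
theorem dimLt_of_le (h : IsSubscaled d C) {k : ℕ} {a b : L} (hab : a ≤ b) (hb : DimLt C k b) :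
    DimLt C k a := by
  by_contra hk
  have key : ∀ n, k ≤ n → ¬ DimLt C n a := by
    intro n hn
    induction n, hn using Nat.le_induction with
    | base => exact hk
    | succ n hn ih =>
      intro h1
      have h2 := h.pc_sup_of_dimLt h1 (h.dimLt_mono (by omega) hb)
      rw [sup_eq_right.2 hab, h.dimLt_iff.1 hb n hn] at h2
      apply ih
      refine h.dimLt_iff.2 fun i hi => ?_
      rcases hi.eq_or_lt with rfl | hi
      · simpa [eq_comm] using h2
      · exact h.dimLt_iff.1 h1 i hi
  exact key (max k (d + 1)) (le_max_left _ _) (h.dimLt_mono (le_max_right _ _) (h.dimLt_top a))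

theorem pc_sdiff_of_dimLt (h : IsSubscaled d C) {k : ℕ} (a : L) {b : L} (hb : DimLt C (k + 1) b) :
    C k a \ b = C k a \ C k b :=
  h.pc_sdiff a b k (h.scdim_le_iff.2 hb)

/-- In `C k a \ b = C k a \ C k b` the component `C k b` vanishes. This is the basic principle that
small elements can be removed from pure ones without loss; `dimLt_inf` is its converse. -/
theorem sdiff_eq_self_of_dimLt (h : IsSubscaled d C) {k : ℕ} {a b : L} (ha : C k a = a)
    (hb : DimLt C k b) : a \ b = a := by
  have := h.pc_sdiff_of_dimLt a (h.dimLt_mono (Nat.le_succ k) hb)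
  rwa [h.dimLt_iff.1 hb k le_rfl, ha, sdiff_bot] at this

theorem dimLt_of_pure (h : IsSubscaled d C) {k : ℕ} {a : L} (ha : C k a = a) :
    DimLt C (k + 1) a := by
  refine le_antisymm (Finset.sup_le fun i _ => h.pc_le i a) ?_
  calc a = C k a := ha.symm
    _ ≤ _ := Finset.le_sup (f := fun i => C i a) (by simp)

theorem le_of_pure (h : IsSubscaled d C) {k : ℕ} {a : L} (ha : C k a = a) (h0 : a ≠ ⊥) : k ≤ d := by
  by_contra hk
  exact h0 (by rw [← ha, h.pc_eq_bot a k (by omega)])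

theorem not_dimLt_of_pure (h : IsSubscaled d C) {k : ℕ} {a : L} (ha : C k a = a) (h0 : a ≠ ⊥) :
    ¬ DimLt C k a := fun h1 => h0 (by rw [← ha, h.dimLt_iff.1 h1 k le_rfl])

theorem pure_le_pure (h : IsSubscaled d C) {k l : ℕ} {a b : L} (ha : C k a = a) (h0 : a ≠ ⊥)
    (hb : C l b = b) (hab : a ≤ b) : k ≤ l := by
  by_contra hk
  exact h.not_dimLt_of_pure ha h0
    (h.dimLt_mono (by omega) (h.dimLt_of_le hab (h.dimLt_of_pure hb)))

theorem le_pc_sup_low (_h : IsSubscaled d C) {k : ℕ} {a : L} (ha : DimLt C (k + 1) a) :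
    a = C k a ⊔ (Finset.range k).sup (fun i => C i a) := by
  conv_lhs => rw [← ha]
  rw [Finset.range_add_one, Finset.sup_insert]

theorem dimLt_low (h : IsSubscaled d C) (k : ℕ) (a : L) :
    DimLt C k ((Finset.range k).sup (fun i => C i a)) :=
  h.dimLt_finsetSup fun i hi =>
    h.dimLt_mono (Finset.mem_range.1 hi) (h.dimLt_of_pure (h.pc_pc i a))

/-- The components of `a \ b` of index below `k` have a join `c` of dimension less than `k`.
Removing `c` from `a`, hence from `a \ b`, changes nothing, so the `k`-th component is everything.
-/
theorem pure_sdiff (h : IsSubscaled d C) {k : ℕ} {a : L} (ha : C k a = a) (b : L) :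
    C k (a \ b) = a \ b := by
  refine le_antisymm (h.pc_le _ _) ?_
  have h1 := h.le_pc_sup_low (h.dimLt_of_le sdiff_le (h.dimLt_of_pure ha) : DimLt C (k + 1) (a \ b))
  set c := (Finset.range k).sup (fun i => C i (a \ b)) with hc
  have h2 : (a \ b) \ c = a \ b := by
    rw [sdiff_sdiff_comm, h.sdiff_eq_self_of_dimLt ha (h.dimLt_low k _)]
  rw [← h2, sdiff_le_iff, h2, sup_comm]
  exact h1.le

theorem pure_sup (h : IsSubscaled d C) {k : ℕ} {a b : L} (ha : C k a = a) (hb : C k b = b) :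
    C k (a ⊔ b) = a ⊔ b := by
  rw [h.pc_sup_of_dimLt (h.dimLt_of_pure ha) (h.dimLt_of_pure hb), ha, hb]

theorem pure_finsetSup (h : IsSubscaled d C) {k : ℕ} {ι : Type*} {s : Finset ι} {f : ι → L}
    (hf : ∀ i ∈ s, C k (f i) = f i) : C k (s.sup f) = s.sup f := by
  classical
  induction s using Finset.induction_on with
  | empty => exact h.pc_bot k
  | insert i s _ ih =>
    rw [Finset.sup_insert]
    exact h.pure_sup (hf i (by simp)) (ih fun j hj => hf j (by simp [hj]))

/-- Turns purity into an equation. If `a` is sc-pure, then `a \ C k a` lies below the components of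
index less than `k`; were it nonzero, its dimension would have to be `k`. -/
theorem isScPure_iff (h : IsSubscaled d C) {k : ℕ} {a : L} : IsScPure C k a ↔ C k a = a := by
  constructor
  · intro h1
    by_cases h0 : a = ⊥
    · rw [h0, h.pc_bot]
    have h2 : DimLt C (k + 1) a := by
      have := h1 ⊥ (by simpa using h0)
      rw [sdiff_bot] at this
      exact h.scdim_le_iff.1 this.le
    refine le_antisymm (h.pc_le _ _) ?_
    rw [← sdiff_eq_bot_iff]
    by_contra h3
    have h4 := h1 _ h3
    have h5 : a \ C k a ≤ (Finset.range k).sup (fun i => C i a) :=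
      sdiff_le_iff.2 (h.le_pc_sup_low h2).le
    exact absurd (h.scdim_lt_iff.2 (h.dimLt_of_le h5 (h.dimLt_low k a))) (by rw [h4]; simp)
  · intro h1 b hb
    have h2 := h.pure_sdiff h1 b
    exact le_antisymm (h.scdim_le_iff.2 (h.dimLt_of_pure h2))
      (not_lt.1 fun h3 => h.not_dimLt_of_pure h2 hb (h.scdim_lt_iff.1 h3))

theorem dimLt_of_negligible (h : IsSubscaled d C) {k : ℕ} {a b : L} (ha : C k a = a)
    (hb : b ≤ a) (hab : a \ b = a) : DimLt C k b := by
  by_cases h0 : a = ⊥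
  · rw [h0, le_bot_iff] at hb
    rw [hb]; exact h.dimLt_bot k
  have h1 := h.scdim_lt a b h0 ((negligible_iff h0).2 ⟨hb, hab⟩)
  rw [← h.scdim_lt_iff]
  exact h1.trans_le (h.scdim_le_iff.2 (h.dimLt_of_pure ha))

/-- Since `a \ (a ⊓ b) = a \ b = a`, the meet is negligible in `a`, and the last axiom lowers its
dimension. -/
theorem dimLt_inf (h : IsSubscaled d C) {k : ℕ} {a b : L} (ha : C k a = a)
    (hab : a \ b = a) : DimLt C k (a ⊓ b) :=
  h.dimLt_of_negligible ha inf_le_left (by rw [sdiff_inf_self_left, hab])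

/-- The pure components of a join of pure elements. -/
theorem pc_eq_of_decomposition (h : IsSubscaled d C) (n : ℕ) (c : ℕ → L)
    (hc : ∀ i, C i (c i) = c i) (hd : ∀ i j, i < j → c i \ c j = c i) (k : ℕ) (hk : k < n) :
    C k ((Finset.range n).sup c) = c k := by
  induction n with
  | zero => omega
  | succ n ih =>
    have hlow : DimLt C n ((Finset.range n).sup c) :=
      h.dimLt_finsetSup fun i hi =>
        h.dimLt_mono (Finset.mem_range.1 hi) (h.dimLt_of_pure (hc i))
    have hn : C n ((Finset.range (n + 1)).sup c) = c n := by
      rw [Finset.range_add_one, Finset.sup_insert,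
        h.pc_sup_of_dimLt (h.dimLt_of_pure (hc n)) (h.dimLt_mono (Nat.le_succ n) hlow), hc,
        h.dimLt_iff.1 hlow n le_rfl, sup_bot_eq]
    rcases (Nat.lt_succ_iff.1 hk).eq_or_lt with rfl | hk'
    · exact hn
    have sdiff_sup : ∀ (s : Finset ℕ) (f : ℕ → L) (b : L), (∀ i ∈ s, f i \ b = f i) →
        s.sup f \ b = s.sup f := by
      intro s f b hs
      induction s using Finset.induction_on with
      | empty => simp
      | insert i s _ ihs =>
        rw [Finset.sup_insert, sup_sdiff, hs i (by simp), ihs fun j hj => hs j (by simp [hj])]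
    set a := (Finset.range (n + 1)).sup c with ha
    -- The difference `a \ c n` is computed twice: as the join of the given pieces below `n`, and as
    -- the join of the components of `a` below `n`. The second axiom then reads off the lower
    -- components from the induction hypothesis.
    have e1 : a \ c n = (Finset.range n).sup c := by
      rw [ha, Finset.range_add_one, Finset.sup_insert, sup_sdiff, sdiff_self, bot_sup_eq]
      exact sdiff_sup _ _ _ fun i hi => hd i n (Finset.mem_range.1 hi)
    have hadim : DimLt C (n + 1) a := by
      rw [ha, Finset.range_add_one, Finset.sup_insert]
      exact h.dimLt_sup (h.dimLt_of_pure (hc n)) (h.dimLt_mono (Nat.le_succ n) hlow)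
    have e2 : a \ c n = (Finset.range n).sup (fun i => C i a) := by
      conv_lhs => rw [h.le_pc_sup_low hadim]
      rw [hn, sup_sdiff, sdiff_self, bot_sup_eq]
      refine sdiff_sup _ _ _ fun i hi => ?_
      have hi := Finset.mem_range.1 hi
      have h1 := h.scdim_inf_lt a i n (by omega)
      rw [min_eq_left hi.le, h.scdim_lt_iff, hn] at h1
      rw [← sdiff_inf_self_left]
      exact h.sdiff_eq_self_of_dimLt (h.pc_pc i a) h1
    rw [← ih hk', ← e1, e2]
    by_cases hkd : k ≤ d
    · rw [h.sup_range_inter, h.pc_join_of_mem a _ Finset.inter_subset_right k (by simp; omega)]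
    · rw [h.pc_eq_bot _ k (by omega), h.pc_eq_bot _ k (by omega)]

end IsSubscaled

/-! ## Representations of finite posets in subscaled lattices -/

section Joins

variable {L : Type*} [CoheytingAlgebra L] {J : Type*} [Fintype J]

open Classical in
/-- The join of the values of `e` on `A`. -/
noncomputable def joinOf (e : J → L) (A : Set J) : L := (Finset.univ.filter (· ∈ A)).sup e

theorem joinOf_le_iff {e : J → L} {A : Set J} {b : L} : joinOf e A ≤ b ↔ ∀ x ∈ A, e x ≤ b := by
  simp [joinOf, Finset.sup_le_iff]

theorem le_joinOf (e : J → L) {A : Set J} {x : J} (hx : x ∈ A) : e x ≤ joinOf e A :=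
  joinOf_le_iff.1 le_rfl x hx

theorem joinOf_mono (e : J → L) {A B : Set J} (h : A ⊆ B) : joinOf e A ≤ joinOf e B :=
  joinOf_le_iff.2 fun _ hx => le_joinOf e (h hx)

theorem joinOf_union (e : J → L) (A B : Set J) : joinOf e (A ∪ B) = joinOf e A ⊔ joinOf e B := by
  apply le_antisymm
  · refine joinOf_le_iff.2 fun x hx => ?_
    rcases hx with hx | hx
    · exact (le_joinOf e hx).trans le_sup_left
    · exact (le_joinOf e hx).trans le_sup_right
  · exact sup_le (joinOf_mono e Set.subset_union_left) (joinOf_mono e Set.subset_union_right)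

@[simp]
theorem joinOf_empty (e : J → L) : joinOf e ∅ = ⊥ :=
  le_bot_iff.1 (joinOf_le_iff.2 fun _ hx => hx.elim)

theorem joinOf_inf_le_iff {e : J → L} {A : Set J} {a b : L} :
    joinOf e A ⊓ a ≤ b ↔ ∀ x ∈ A, e x ⊓ a ≤ b := by
  rw [joinOf, Finset.sup_inf_distrib_right]
  simp [Finset.sup_le_iff]

theorem joinOf_sdiff_le_iff {e : J → L} {A : Set J} {a b : L} :
    joinOf e A \ a ≤ b ↔ ∀ x ∈ A, e x \ a ≤ b := by
  simp only [sdiff_le_iff]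
  exact joinOf_le_iff

theorem sdiff_finsetSup_eq_self {ι : Type*} {s : Finset ι} {f : ι → L} {a : L}
    (h : ∀ i ∈ s, a \ f i = a) : a \ s.sup f = a := by
  classical
  induction s using Finset.induction_on with
  | empty => simp
  | insert i s _ ih =>
    rw [Finset.sup_insert, ← sdiff_sdiff_left, h i (by simp), ih fun j hj => h j (by simp [hj])]

theorem sdiff_joinOf_eq_self {e : J → L} {A : Set J} {a : L} (h : ∀ x ∈ A, a \ e x = a) :
    a \ joinOf e A = a :=
  sdiff_finsetSup_eq_self fun i hi => h i (by simpa using hi)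

theorem sdiff_eq_self_of_le {a b c : L} (h : a \ b = a) (hc : c ≤ b) : a \ c = a :=
  le_antisymm sdiff_le (by conv_lhs => rw [← h]
                           exact sdiff_le_sdiff_left hc)

theorem IsSubscaled.dimLt_joinOf {C : ℕ → L → L} {d k : ℕ} (h : IsSubscaled d C) {e : J → L}
    {A : Set J} (hA : ∀ x ∈ A, DimLt C k (e x)) : DimLt C k (joinOf e A) :=
  h.dimLt_finsetSup fun i hi => hA i (by simpa using hi)

theorem IsSubscaled.pure_joinOf {C : ℕ → L → L} {d k : ℕ} (h : IsSubscaled d C) {e : J → L}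
    {A : Set J} (hA : ∀ x ∈ A, C k (e x) = e x) : C k (joinOf e A) = joinOf e A :=
  h.pure_finsetSup fun i hi => hA i (by simpa using hi)

end Joins

/-- The family `e` represents the finite poset `J`, whose elements have dimensions `δ`, by the
join-irreducible elements of a finite substructure of `L`. -/
structure IsRep {L : Type*} [CoheytingAlgebra L] (C : ℕ → L → L) {J : Type*} [Fintype J]
    [PartialOrder J] (δ : J → ℕ) (e : J → L) : Prop where
  ne_bot : ∀ x, e x ≠ ⊥
  pure : ∀ x, C (δ x) (e x) = e x
  mono : ∀ x y, x ≤ y → e x ≤ e y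
  disj : ∀ x y, ¬ x ≤ y → e x \ e y = e x
  inf_le : ∀ x y, e x ⊓ e y ≤ joinOf e {z | z ≤ x ∧ z ≤ y}
  top : joinOf e Set.univ = ⊤

/-- In a poset with dimensions, the downset generated by the `k`-dimensional maximal elements. -/
def pcSet {J : Type*} [PartialOrder J] (δ : J → ℕ) (k : ℕ) (A : Set J) : Set J :=
  {j | ∃ i, j ≤ i ∧ i ∈ A ∧ δ i = k ∧ ∀ i' ∈ A, i ≤ i' → i' = i}

/-- The downset generated by the elements of `A` outside `B`. -/
def sdiffSet {J : Type*} [PartialOrder J] (A B : Set J) : Set J :=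
  {j | ∃ i, j ≤ i ∧ i ∈ A ∧ i ∉ B}

namespace IsRep

variable {L : Type*} [CoheytingAlgebra L] {C : ℕ → L → L} {d : ℕ} {J : Type*} [Fintype J]
  [PartialOrder J] {δ : J → ℕ} {e : J → L}

theorem le_iff (r : IsRep C δ e) {x y : J} : e x ≤ e y ↔ x ≤ y := by
  refine ⟨fun h => ?_, r.mono x y⟩
  by_contra h1
  have := r.disj x y h1
  rw [sdiff_eq_bot_iff.2 h] at this
  exact r.ne_bot x this.symm

theorem injective (r : IsRep C δ e) : Function.Injective e := fun _ _ h =>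
  le_antisymm (r.le_iff.1 h.le) (r.le_iff.1 h.ge)

theorem sdiff_joinOf (r : IsRep C δ e) {A : Set J} (hA : IsLowerSet A) {x : J} (hx : x ∉ A) :
    e x \ joinOf e A = e x :=
  sdiff_joinOf_eq_self fun _ hy => r.disj _ _ fun hxy => hx (hA hxy hy)

theorem le_joinOf_iff (r : IsRep C δ e) {A : Set J} (hA : IsLowerSet A) {x : J} :
    e x ≤ joinOf e A ↔ x ∈ A := by
  refine ⟨fun h => ?_, fun h => le_joinOf e h⟩
  by_contra hx
  have := r.sdiff_joinOf hA hx
  rw [sdiff_eq_bot_iff.2 h] at this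
  exact r.ne_bot x this.symm

theorem joinOf_le_joinOf_iff (r : IsRep C δ e) {A B : Set J} (hB : IsLowerSet B) :
    joinOf e A ≤ joinOf e B ↔ A ⊆ B := by
  rw [joinOf_le_iff]
  exact forall₂_congr fun x _ => r.le_joinOf_iff hB

theorem joinOf_injective (r : IsRep C δ e) {A B : Set J} (hA : IsLowerSet A) (hB : IsLowerSet B)
    (h : joinOf e A = joinOf e B) : A = B :=
  Set.Subset.antisymm ((r.joinOf_le_joinOf_iff hB).1 h.le) ((r.joinOf_le_joinOf_iff hA).1 h.ge)

theorem joinOf_inter (r : IsRep C δ e) {A B : Set J} (hA : IsLowerSet A) (hB : IsLowerSet B) :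
    joinOf e (A ∩ B) = joinOf e A ⊓ joinOf e B := by
  apply le_antisymm
  · exact le_inf (joinOf_mono e Set.inter_subset_left) (joinOf_mono e Set.inter_subset_right)
  · refine joinOf_inf_le_iff.2 fun x hx => ?_
    rw [inf_comm]
    refine joinOf_inf_le_iff.2 fun y hy => ?_
    exact (r.inf_le y x).trans (joinOf_mono e fun z hz => ⟨hA hz.2 hx, hB hz.1 hy⟩)

theorem joinOf_sdiff (r : IsRep C δ e) {A B : Set J} (hB : IsLowerSet B) :
    joinOf e (sdiffSet A B) = joinOf e A \ joinOf e B := by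
  apply le_antisymm
  · refine joinOf_le_iff.2 fun x hx => ?_
    obtain ⟨i, hxi, hiA, hiB⟩ := hx
    refine (r.mono _ _ hxi).trans ?_
    rw [← r.sdiff_joinOf hB hiB]
    exact sdiff_le_sdiff_right (le_joinOf e hiA)
  · refine joinOf_sdiff_le_iff.2 fun x hx => ?_
    by_cases hxB : x ∈ B
    · rw [sdiff_eq_bot_iff.2 (le_joinOf e hxB)]; exact bot_le
    · exact sdiff_le.trans (le_joinOf e ⟨x, le_rfl, hx, hxB⟩)

/-- The join over `A` is already the join over its maximal elements. Grouped by dimension these give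
pure elements, and distinct maximal elements are incomparable, so the groups are essentially
disjoint. `IsSubscaled.pc_eq_of_decomposition` then identifies the groups with the pure components.
-/
theorem joinOf_pc (h : IsSubscaled d C) (r : IsRep C δ e) (k : ℕ) (A : Set J) :
    joinOf e (pcSet δ k A) = C k (joinOf e A) := by
  set M : ℕ → Set J := fun k => {i | i ∈ A ∧ δ i = k ∧ ∀ i' ∈ A, i ≤ i' → i' = i} with hM
  have e1 : joinOf e (pcSet δ k A) = joinOf e (M k) := by
    apply le_antisymm
    · exact joinOf_le_iff.2 fun x ⟨i, hxi, hi⟩ => (r.mono _ _ hxi).trans (le_joinOf e (A := M k) hi)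
    · exact joinOf_mono e fun i hi => ⟨i, le_rfl, hi⟩
  rw [e1]
  by_cases hk : k < d + 1
  · have e2 : joinOf e A = (Finset.range (d + 1)).sup fun k => joinOf e (M k) := by
      apply le_antisymm
      · refine joinOf_le_iff.2 fun x hx => ?_
        obtain ⟨m, hxm, hm⟩ := (Set.toFinite A).exists_le_maximal hx
        refine (r.mono _ _ hxm).trans ?_
        have : m ∈ M (δ m) := ⟨hm.prop, rfl, fun i' hi' hle => le_antisymm (hm.le_of_ge hi' hle) hle⟩
        refine (le_joinOf e this).trans
          (Finset.le_sup (f := fun k => joinOf e (M k)) (Finset.mem_range.2 ?_))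
        exact Nat.lt_succ_of_le (h.le_of_pure (r.pure m) (r.ne_bot m))
      · exact Finset.sup_le fun i _ => joinOf_mono e fun x hx => hx.1
    rw [e2, h.pc_eq_of_decomposition (d + 1) _ _ _ k hk]
    · exact fun i => h.pure_joinOf fun x hx => by rw [← hx.2.1]; exact r.pure x
    · intro i j hij
      apply le_antisymm sdiff_le
      refine joinOf_le_iff.2 fun x hx => ?_
      have : e x \ joinOf e (M j) = e x := sdiff_joinOf_eq_self fun y hy => r.disj _ _ fun hxy => by
        have := hx.2.2 y hy.1 hxy
        subst this
        exact absurd (hx.2.1.symm.trans hy.2.1) hij.ne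
      rw [← this]
      exact sdiff_le_sdiff_right (le_joinOf e hx)
  · rw [h.pc_eq_bot _ k (by omega)]
    refine le_bot_iff.1 (joinOf_le_iff.2 fun x hx => ?_)
    exact absurd (h.le_of_pure (r.pure x) (r.ne_bot x)) (by rw [hx.2.1]; omega)

/-- For `x < y` the element `e x` is negligible in `e y`, so its dimension is smaller. -/
theorem strictMono (h : IsSubscaled d C) (r : IsRep C δ e) : StrictMono δ := by
  intro x y hxy
  by_contra hlt
  have h1 := h.dimLt_of_negligible (r.pure y) (r.mono _ _ hxy.le) (r.disj y x hxy.not_ge)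
  exact h.not_dimLt_of_pure (r.pure x) (r.ne_bot x) (h.dimLt_mono (not_lt.1 hlt) h1)

theorem le_dim (h : IsSubscaled d C) (r : IsRep C δ e) (x : J) : δ x ≤ d :=
  h.le_of_pure (r.pure x) (r.ne_bot x)

end IsRep

theorem isLowerSet_pcSet {J : Type*} [PartialOrder J] (δ : J → ℕ) (k : ℕ) (A : Set J) :
    IsLowerSet (pcSet δ k A) := fun _ _ hab ⟨i, hi, h⟩ => ⟨i, hab.trans hi, h⟩

theorem isLowerSet_sdiffSet {J : Type*} [PartialOrder J] (A B : Set J) :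
    IsLowerSet (sdiffSet A B) := fun _ _ hab ⟨i, hi, h⟩ => ⟨i, hab.trans hi, h⟩

/-! ## Local finiteness -/

/-- A bound on the number of join-irreducible elements of generated substructures. -/
def genBound : ℕ → ℕ → ℕ → ℕ
  | 0, _, _ => 0
  | k + 1, z, y => 2 ^ (z + y) +
      genBound k (z + 2 ^ (z + y) * 2 ^ (z + y) + 2 ^ (z + y) * y) (y + 2 ^ (z + y))

theorem genBound_mono (k : ℕ) {z z' y y' : ℕ} (hz : z ≤ z') (hy : y ≤ y') :
    genBound k z y ≤ genBound k z' y' := by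
  induction k generalizing z z' y y' with
  | zero => simp [genBound]
  | succ k ih =>
    have h1 : 2 ^ (z + y) ≤ 2 ^ (z' + y') := Nat.pow_le_pow_right (by norm_num) (by omega)
    simp only [genBound]
    exact Nat.add_le_add h1 (ih (by gcongr) (by gcongr))

section LocalFiniteness

variable {L : Type*} [CoheytingAlgebra L] {C : ℕ → L → L} {d : ℕ}

/-- `z` is a join of elements of `A`. -/
def IsJoin (A : Finset L) (z : L) : Prop := ∃ s ⊆ A, s.sup id = z

theorem IsJoin.mono {A B : Finset L} {z : L} (hAB : A ⊆ B) (h : IsJoin A z) : IsJoin B z := by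
  obtain ⟨s, hs, hz⟩ := h
  exact ⟨s, hs.trans hAB, hz⟩

theorem isJoin_of_mem {A : Finset L} {z : L} (h : z ∈ A) : IsJoin A z :=
  ⟨{z}, by simpa using h, by simp⟩

theorem isJoin_bot (A : Finset L) : IsJoin A ⊥ := ⟨∅, by simp, by simp⟩

open Classical in
theorem IsJoin.sup {A : Finset L} {y z : L} (hy : IsJoin A y) (hz : IsJoin A z) :
    IsJoin A (y ⊔ z) := by
  obtain ⟨s, hs, rfl⟩ := hy
  obtain ⟨t, ht, rfl⟩ := hz
  exact ⟨s ∪ t, Finset.union_subset hs ht, by rw [Finset.sup_union]⟩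

open Classical in
theorem IsJoin.finsetSup {A : Finset L} {ι : Type*} {s : Finset ι} {f : ι → L}
    (h : ∀ i ∈ s, IsJoin A (f i)) : IsJoin A (s.sup f) := by
  induction s using Finset.induction_on with
  | empty => exact isJoin_bot A
  | insert i s _ ih =>
    rw [Finset.sup_insert]
    exact (h i (by simp)).sup (ih fun j hj => h j (by simp [hj]))

theorem IsJoin.trans {A B : Finset L} {z : L} (h : IsJoin A z) (hB : ∀ a ∈ A, IsJoin B a) :
    IsJoin B z := by
  obtain ⟨s, hs, rfl⟩ := h
  exact IsJoin.finsetSup fun i hi => hB i (hs hi)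

/-- For pure elements of the same dimension `k`, both equations say that the meet has dimension less
than `k`. -/
theorem IsSubscaled.sdiff_comm_of_pure (h : IsSubscaled d C) {k : ℕ} {a b : L} (ha : C k a = a)
    (hb : C k b = b) (hab : a \ b = a) : b \ a = b := by
  rw [← sdiff_inf_self_left, inf_comm]
  exact h.sdiff_eq_self_of_dimLt hb (h.dimLt_inf ha hab)

theorem sdiff_triple (a c : L) : a \ (a \ (a \ c)) = a \ c := by
  apply le_antisymm
  · exact sdiff_le_comm.1 le_rfl
  · refine sdiff_le_sdiff_left (sdiff_le_comm.1 le_rfl)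

/-- Pairwise essentially disjoint nonzero `k`-pure elements. -/
structure IsPureFamily (C : ℕ → L → L) (k : ℕ) (A : Finset L) : Prop where
  ne_bot : ∀ a ∈ A, a ≠ ⊥
  pure : ∀ a ∈ A, C k a = a
  disj : ∀ a ∈ A, ∀ b ∈ A, a ≠ b → a \ b = a

-- Each `a` is cut into `a \ c` and `a \ (a \ c)`. These have join `a`, and removing either from the
-- other changes nothing, by `sdiff_triple` and idempotence. Zero pieces are discarded.
open Classical in
theorem IsPureFamily.refine (h : IsSubscaled d C) {k : ℕ} {A : Finset L}
    (hA : IsPureFamily C k A) (c : L) :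
    ∃ B : Finset L, IsPureFamily C k B ∧ B.card ≤ 2 * A.card ∧ (∀ a ∈ A, IsJoin B a) ∧
      (∀ b ∈ B, b ≤ c ∨ b \ c = b) ∧ ∀ b ∈ B, ∃ a ∈ A, ∃ x, b = a \ x := by
  set B := ((A.image fun a => a \ c) ∪ (A.image fun a => a \ (a \ c))).filter (· ≠ ⊥) with hB
  have hmem : ∀ b ∈ B, b ≠ ⊥ ∧ ∃ a ∈ A, b = a \ c ∨ b = a \ (a \ c) := by
    intro b hb
    simp only [hB, Finset.mem_filter, Finset.mem_union, Finset.mem_image] at hb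
    refine ⟨hb.2, ?_⟩
    rcases hb.1 with ⟨a, ha, rfl⟩ | ⟨a, ha, rfl⟩
    exacts [⟨a, ha, Or.inl rfl⟩, ⟨a, ha, Or.inr rfl⟩]
  have hsub : ∀ b ∈ B, ∃ a ∈ A, ∃ x, b = a \ x := by
    intro b hb
    obtain ⟨-, a, ha, h1 | h1⟩ := hmem b hb
    exacts [⟨a, ha, _, h1⟩, ⟨a, ha, _, h1⟩]
  refine ⟨B, ⟨fun b hb => (hmem b hb).1, ?_, ?_⟩, ?_, ?_, ?_, hsub⟩
  · intro b hb
    obtain ⟨a, ha, x, rfl⟩ := hsub b hb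
    exact h.pure_sdiff (hA.pure a ha) x
  · intro b hb b' hb' hne
    obtain ⟨-, a, ha, h1⟩ := hmem b hb
    obtain ⟨-, a', ha', h2⟩ := hmem b' hb'
    by_cases haa : a = a'
    · subst haa
      rcases h1 with rfl | rfl <;> rcases h2 with rfl | rfl
      · exact absurd rfl hne
      · calc (a \ c) \ (a \ (a \ c)) = (a \ (a \ (a \ c))) \ (a \ (a \ c)) := by
              rw [sdiff_triple]
          _ = a \ c := by rw [sdiff_idem, sdiff_triple]
      · exact sdiff_idem
      · exact absurd rfl hne
    · have h3 := hA.disj a ha a' ha' haa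
      have h4 : b' ≤ a' := by rcases h2 with rfl | rfl <;> exact sdiff_le
      have h5 := sdiff_eq_self_of_le h3 h4
      rcases h1 with rfl | rfl <;> rw [sdiff_sdiff_comm, h5]
  · calc B.card ≤ _ := Finset.card_filter_le _ _
      _ ≤ _ := Finset.card_union_le _ _
      _ ≤ A.card + A.card := Nat.add_le_add Finset.card_image_le Finset.card_image_le
      _ = 2 * A.card := by ring
  · intro a ha
    have : a = a \ c ⊔ a \ (a \ c) := by
      apply le_antisymm le_sup_sdiff (sup_le sdiff_le sdiff_le)
    rw [this]
    have hB' : ∀ x, (x = a \ c ∨ x = a \ (a \ c)) → IsJoin B x := by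
      intro x hx
      by_cases h0 : x = ⊥
      · rw [h0]; exact isJoin_bot B
      · apply isJoin_of_mem
        simp only [hB, Finset.mem_filter, Finset.mem_union, Finset.mem_image]
        refine ⟨?_, h0⟩
        rcases hx with rfl | rfl
        exacts [Or.inl ⟨a, ha, rfl⟩, Or.inr ⟨a, ha, rfl⟩]
    exact (hB' _ (Or.inl rfl)).sup (hB' _ (Or.inr rfl))
  · intro b hb
    obtain ⟨-, a, ha, rfl | rfl⟩ := hmem b hb
    · exact Or.inr sdiff_idem
    · exact Or.inl (sdiff_le_comm.1 le_rfl)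

-- The family plays the role of the atoms of the Boolean algebra generated by `Z` modulo dimension
-- less than `k`. The `+ 1` accounts for the atom outside all generators, which is not used. A new
-- generator halves each old atom and adds the part of itself outside their join.
open Classical in
theorem IsPureFamily.exists_isJoin (h : IsSubscaled d C) {k : ℕ} (Z : Finset L)
    (hZ : ∀ z ∈ Z, C k z = z) :
    ∃ A : Finset L, IsPureFamily C k A ∧ A.card + 1 ≤ 2 ^ Z.card ∧ ∀ z ∈ Z, IsJoin A z := by
  induction Z using Finset.induction_on with
  | empty => exact ⟨∅, ⟨by simp, by simp, by simp⟩, by simp, by simp⟩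
  | insert c Z hc ih =>
    obtain ⟨A, hA, hcard, hjoin⟩ := ih fun z hz => hZ z (by simp [hz])
    have hcp := hZ c (by simp)
    obtain ⟨B, hB, hBcard, hBj, hBc, hBA⟩ := hA.refine h c
    set s := A.sup id with hs
    have hBs : ∀ b ∈ B, b ≤ s := fun b hb => by
      obtain ⟨a, ha, x, rfl⟩ := hBA b hb
      exact sdiff_le.trans (Finset.le_sup (f := id) ha)
    have hsB : s ≤ B.sup id := Finset.sup_le fun a ha => by
      obtain ⟨t, ht, h1⟩ := hBj a ha
      rw [← h1]
      exact Finset.sup_mono ht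
    set D := (insert (c \ s) B).filter (· ≠ ⊥) with hD
    have hDB : ∀ b ∈ B, b ∈ D := fun b hb => by simp [hD, hb, hB.ne_bot b hb]
    have hDmem : ∀ b ∈ D, b ≠ ⊥ ∧ (b = c \ s ∨ b ∈ B) := fun b hb => by
      simp only [hD, Finset.mem_filter, Finset.mem_insert] at hb
      exact ⟨hb.2, hb.1⟩
    have hcs : C k (c \ s) = c \ s := h.pure_sdiff hcp s
    have hdis : ∀ b ∈ B, (c \ s) \ b = c \ s := fun b hb =>
      sdiff_eq_self_of_le sdiff_idem (hBs b hb)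
    refine ⟨D, ⟨fun b hb => (hDmem b hb).1, ?_, ?_⟩, ?_, ?_⟩
    · intro b hb
      rcases (hDmem b hb).2 with rfl | hb
      exacts [hcs, hB.pure b hb]
    · intro a ha b hb hne
      rcases (hDmem a ha).2 with rfl | ha <;> rcases (hDmem b hb).2 with rfl | hb
      · exact absurd rfl hne
      · exact hdis b hb
      · exact h.sdiff_comm_of_pure hcs (hB.pure a ha) (hdis a ha)
      · exact hB.disj a ha b hb hne
    · rw [Finset.card_insert_of_notMem hc, pow_succ]
      have h1 : D.card ≤ B.card + 1 :=
        (Finset.card_filter_le _ _).trans (Finset.card_insert_le _ _)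
      omega
    · intro z hz
      rcases Finset.mem_insert.1 hz with rfl | hz
      · have key : z = z \ s ⊔ (B.filter (· ≤ z)).sup id := by
          apply le_antisymm
          · set t := (B.filter (· ≤ z)).sup id with ht
            rw [← sdiff_le_iff]
            -- The part `w` of `z` inside `s` that the pieces below `z` miss is covered by the other
            -- pieces, each of which meets `z` in dimension less than `k`. So `w` has dimension less
            -- than `k`; being `k`-pure, it is zero.
            have h1 : C k ((z \ (z \ s)) \ t) = (z \ (z \ s)) \ t :=
              h.pure_sdiff (h.pure_sdiff hcp _) _
            set w := (z \ (z \ s)) \ t with hw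
            have hws : w ≤ s := sdiff_le.trans (sdiff_le_comm.1 le_rfl)
            have hwz : w ≤ z := sdiff_le.trans sdiff_le
            have h2 : DimLt C k w := by
              have h3 : w = w ⊓ B.sup id := (inf_eq_left.2 (hws.trans hsB)).symm
              have h4 : w \ t = w := sdiff_idem
              have h5 : w ≤ (B.filter (fun b => ¬ b ≤ z)).sup id ⊔ t := by
                rw [ht, ← Finset.sup_union, Finset.union_comm, Finset.filter_union_filter_not_eq]
                exact hws.trans hsB
              have h6 : w ≤ (B.filter (fun b => ¬ b ≤ z)).sup id := by
                rw [← h4, sdiff_le_iff, sup_comm]; exact h5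
              have h7 : w = (B.filter (fun b => ¬ b ≤ z)).sup fun b => w ⊓ b := by
                conv_lhs => rw [← inf_eq_left.2 h6, Finset.sup_inf_distrib_left]
                simp
              rw [h7]
              refine h.dimLt_finsetSup fun b hb => ?_
              rw [Finset.mem_filter] at hb
              have h8 := (hBc b hb.1).resolve_left hb.2
              refine h.dimLt_of_le ?_ (h.dimLt_inf (hB.pure b hb.1) h8)
              exact le_inf inf_le_right (inf_le_left.trans hwz)
            have h3 : w = ⊥ := by rw [← h1, h.dimLt_iff.1 h2 k le_rfl]
            exact sdiff_eq_bot_iff.1 h3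
          · exact sup_le sdiff_le (Finset.sup_le fun b hb => (Finset.mem_filter.1 hb).2)
        rw [key]
        refine IsJoin.sup ?_ (IsJoin.finsetSup fun b hb =>
          isJoin_of_mem (hDB b (Finset.mem_filter.1 hb).1))
        by_cases h0 : z \ s = ⊥
        · rw [h0]; exact isJoin_bot D
        · exact isJoin_of_mem (Finset.mem_filter.2 ⟨Finset.mem_insert_self _ _, h0⟩)
      · exact (hjoin z hz).trans fun a ha => (hBj a ha).mono hDB

open Classical in
theorem IsPureFamily.exists_split (h : IsSubscaled d C) {k : ℕ} {A : Finset L}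
    (hA : IsPureFamily C k A) (Y : Finset L) :
    ∃ B : Finset L, IsPureFamily C k B ∧ B.card ≤ A.card * 2 ^ Y.card ∧ (∀ a ∈ A, IsJoin B a) ∧
      ∀ b ∈ B, ∀ y ∈ Y, b ≤ y ∨ b \ y = b := by
  induction Y using Finset.induction_on with
  | empty => exact ⟨A, hA, by simp, fun a ha => isJoin_of_mem ha, by simp⟩
  | insert c Y hc ih =>
    obtain ⟨B, hB, hcard, hj, hY⟩ := ih
    obtain ⟨D, hD, hDcard, hDj, hDc, hDB⟩ := hB.refine h c
    refine ⟨D, hD, ?_, fun a ha => (hj a ha).trans hDj, ?_⟩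
    · rw [Finset.card_insert_of_notMem hc, pow_succ]
      calc D.card ≤ 2 * B.card := hDcard
        _ ≤ 2 * (A.card * 2 ^ Y.card) := by gcongr
        _ = _ := by ring
    · intro b hb y hy
      rcases Finset.mem_insert.1 hy with rfl | hy
      · exact hDc b hb
      · obtain ⟨a, ha, x, rfl⟩ := hDB b hb
        rcases hY a ha y hy with h1 | h1
        · exact Or.inl (sdiff_le.trans h1)
        · exact Or.inr (by rw [sdiff_sdiff_comm, h1])

-- Descending recursion on the dimension. The top components of `Z` are decomposed into `k`-pure
-- pieces `A`, each essentially inside or outside every element of `Y`. What remains has smaller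
-- dimension: the lower parts of `Z`, the meets of distinct pieces, and the meets of pieces with
-- `Y`. These form the next `Z`, and `A` joins `Y`, so that later pieces are compatible with it. The
-- terms of `genBound` count exactly these elements.
open Classical in
theorem IsSubscaled.exists_family (h : IsSubscaled d C) (k : ℕ) (Z Y : Finset L)
    (hZ : ∀ z ∈ Z, DimLt C k z) :
    ∃ J : Finset L, J.card ≤ genBound k Z.card Y.card ∧ (∀ x ∈ J, x ≠ ⊥ ∧ ∃ i < k, C i x = x) ∧
      (∀ x ∈ J, ∀ y ∈ J ∪ Y, (x ≤ y ∨ x \ y = x) ∧ IsJoin J (x ⊓ y)) ∧ ∀ z ∈ Z, IsJoin J z := by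
  induction k generalizing Z Y with
  | zero =>
    refine ⟨∅, by simp, by simp, by simp, fun z hz => ?_⟩
    rw [dimLt_zero.1 (hZ z hz)]
    exact isJoin_bot _
  | succ k ih =>
    obtain ⟨A₀, hA₀, hcard₀, hj₀⟩ := IsPureFamily.exists_isJoin h (k := k) (Z.image (C k)) (by
      simp only [Finset.mem_image, forall_exists_index, and_imp, forall_apply_eq_imp_iff₂]
      exact fun a _ => h.pc_pc k a)
    obtain ⟨A, hA, hcard, hj, hAY⟩ := hA₀.exists_split h Y
    have hAcard : A.card ≤ 2 ^ (Z.card + Y.card) := by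
      calc A.card ≤ A₀.card * 2 ^ Y.card := hcard
        _ ≤ 2 ^ Z.card * 2 ^ Y.card := by
          gcongr
          calc A₀.card ≤ 2 ^ (Z.image (C k)).card := by omega
            _ ≤ _ := Nat.pow_le_pow_right (by norm_num) Finset.card_image_le
        _ = _ := (pow_add _ _ _).symm
    set low : L → L := fun z => (Finset.range k).sup fun i => C i z with hlow
    set Z' : Finset L := Z.image low ∪ (A ×ˢ A).image (fun p => if p.1 = p.2 then ⊥ else p.1 ⊓ p.2)
      ∪ (A ×ˢ Y).image (fun p => if p.1 ≤ p.2 then ⊥ else p.1 ⊓ p.2) with hZ'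
    have hdim : ∀ z ∈ Z', DimLt C k z := by
      intro z hz
      simp only [hZ', Finset.mem_union, Finset.mem_image, Finset.mem_product, Prod.exists] at hz
      rcases hz with (⟨a, -, rfl⟩ | ⟨a, b, ⟨ha, hb⟩, rfl⟩) | ⟨a, y, ⟨ha, hy⟩, rfl⟩
      · exact h.dimLt_low k a
      · split_ifs with hab
        · exact h.dimLt_bot k
        · exact h.dimLt_inf (hA.pure a ha) (hA.disj a ha b hb hab)
      · split_ifs with hay
        · exact h.dimLt_bot k
        · exact h.dimLt_inf (hA.pure a ha) ((hAY a ha y hy).resolve_left hay)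
    obtain ⟨J, hJcard, hJ, hJJ, hJZ⟩ := ih Z' (Y ∪ A) hdim
    have hZ'card : Z'.card ≤ Z.card + 2 ^ (Z.card + Y.card) * 2 ^ (Z.card + Y.card) +
        2 ^ (Z.card + Y.card) * Y.card := by
      refine (Finset.card_union_le _ _).trans (Nat.add_le_add ((Finset.card_union_le _ _).trans
        (Nat.add_le_add Finset.card_image_le ?_)) ?_)
      · refine Finset.card_image_le.trans ?_
        rw [Finset.card_product]
        gcongr
      · refine Finset.card_image_le.trans ?_
        rw [Finset.card_product]
        gcongr
    have hinf : ∀ a ∈ A, ∀ y ∈ A ∪ Y, IsJoin (A ∪ J) (a ⊓ y) := by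
      intro a ha y hy
      by_cases hay : a ≤ y
      · rw [inf_eq_left.2 hay]
        exact isJoin_of_mem (Finset.mem_union_left _ ha)
      refine (hJZ _ ?_).mono Finset.subset_union_right
      simp only [hZ', Finset.mem_union, Finset.mem_image, Finset.mem_product, Prod.exists]
      rcases Finset.mem_union.1 hy with hy | hy
      · exact Or.inl (Or.inr ⟨a, y, ⟨ha, hy⟩, if_neg fun e => hay e.le⟩)
      · exact Or.inr ⟨a, y, ⟨ha, hy⟩, if_neg hay⟩
    refine ⟨A ∪ J, ?_, ?_, ?_, ?_⟩
    · refine (Finset.card_union_le _ _).trans (Nat.add_le_add hAcard (hJcard.trans ?_))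
      exact genBound_mono k hZ'card ((Finset.card_union_le _ _).trans (by gcongr))
    · intro x hx
      rcases Finset.mem_union.1 hx with hx | hx
      · exact ⟨hA.ne_bot x hx, k, Nat.lt_succ_self k, hA.pure x hx⟩
      · obtain ⟨h1, i, hi, h2⟩ := hJ x hx
        exact ⟨h1, i, by omega, h2⟩
    · intro x hx y hy
      rcases Finset.mem_union.1 hx with hx | hx
      · have hy' : y ∈ A ∨ y ∈ Y ∨ y ∈ J := by
          simp only [Finset.mem_union] at hy; tauto
        rcases hy' with hy | hy | hy
        · refine ⟨?_, hinf x hx y (Finset.mem_union_left _ hy)⟩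
          by_cases hxy : x = y
          · exact Or.inl hxy.le
          · exact Or.inr (hA.disj x hx y hy hxy)
        · exact ⟨hAY x hx y hy, hinf x hx y (Finset.mem_union_right _ hy)⟩
        · obtain ⟨-, i, hi, h2⟩ := hJ y hy
          refine ⟨Or.inr (h.sdiff_eq_self_of_dimLt (hA.pure x hx)
            (h.dimLt_mono hi (h.dimLt_of_pure h2))), ?_⟩
          rw [inf_comm]
          exact (hJJ y hy x (by simp [hx])).2.mono Finset.subset_union_right
      · have := hJJ x hx y (by simp only [Finset.mem_union] at hy ⊢; tauto)
        exact ⟨this.1, this.2.mono Finset.subset_union_right⟩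
    · intro z hz
      rw [h.le_pc_sup_low (hZ z hz)]
      refine IsJoin.sup ?_ ?_
      · exact ((hj₀ _ (Finset.mem_image_of_mem _ hz)).trans hj).mono Finset.subset_union_left
      · refine (hJZ _ ?_).mono Finset.subset_union_right
        simp only [hZ', Finset.mem_union, Finset.mem_image]
        exact Or.inl (Or.inl ⟨z, hz, rfl⟩)

end LocalFiniteness

/-! ## Morphisms of finite posets with dimensions, and the extension property -/

/-- The maps of posets with dimensions that are dual to embeddings of subscaled lattices. -/
structure IsScMap {J₁ J₀ : Type*} [PartialOrder J₁] [PartialOrder J₀] (δ₁ : J₁ → ℕ) (δ₀ : J₀ → ℕ)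
    (f : J₁ → J₀) : Prop where
  surj : Function.Surjective f
  mono : Monotone f
  lift : ∀ y x, f y ≤ x → ∃ y', y ≤ y' ∧ f y' = x
  dim : ∀ y, ∃ y', y ≤ y' ∧ f y' = f y ∧ δ₁ y' = δ₀ (f y)

/-! ### Finite generation, and comparison of two representations -/

section Refinement

variable {L : Type*} [CoheytingAlgebra L] {C : ℕ → L → L} {d : ℕ}

theorem IsJoin.eq_joinOf {J : Finset L} {z : L} (hz : IsJoin J z) :
    joinOf (Subtype.val : J → L) {y | (y : L) ≤ z} = z := by
  apply le_antisymm
  · exact joinOf_le_iff.2 fun y hy => hy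
  · obtain ⟨s, hs, rfl⟩ := hz
    exact Finset.sup_le fun i hi => le_joinOf (Subtype.val : J → L) (x := ⟨i, hs hi⟩)
      (Finset.le_sup (f := id) hi)

/-- The element `⊤` is added to the generators so that the family covers the lattice; this is the `+
1`. The bound is uniform in `L`, which is what later makes quantifiers range over finite sets. -/
theorem IsSubscaled.exists_isRep (h : IsSubscaled d C) (Z : Finset L) :
    ∃ (J : Finset L) (δ : J → ℕ), J.card ≤ genBound (d + 1) (Z.card + 1) 0 ∧
      IsRep C δ (Subtype.val : J → L) ∧ ∀ z ∈ Z, IsJoin J z := by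
  classical
  obtain ⟨J, hcard, hJ, hJJ, hZ⟩ := h.exists_family (d + 1) (insert ⊤ Z) ∅
    fun z _ => h.dimLt_top z
  choose hne δ hδ hδp using hJ
  refine ⟨J, fun x => δ x.1 x.2, hcard.trans (genBound_mono _ (Finset.card_insert_le _ _) (by simp)),
    ⟨fun x => hne x.1 x.2, fun x => hδp x.1 x.2, fun x y hxy => hxy, fun x y hxy => ?_,
      fun x y => ?_, ?_⟩, fun z hz => hZ z (by simp [hz])⟩
  · exact (hJJ x.1 x.2 y.1 (by simp)).1.resolve_left hxy
  · have := (hJJ x.1 x.2 y.1 (by simp)).2.eq_joinOf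
    conv_lhs => rw [← this]
    exact joinOf_mono _ fun z hz => ⟨(le_inf_iff.1 hz).1, (le_inf_iff.1 hz).2⟩
  · have := (hZ ⊤ (by simp)).eq_joinOf
    exact top_le_iff.1 (this.ge.trans (joinOf_mono _ (Set.subset_univ _)))

/-- The map sends `y` to the least `x` with `e y ≤ e₀ x`. Such `x` exist because the `e₀ x` cover
the lattice and each `e y` is prime with respect to joins over downsets; a minimal one is least
because `e₀ x ⊓ e₀ x'` is covered by the `e₀ z` with `z ≤ x` and `z ≤ x'`. -/
theorem IsRep.exists_isScMap (h : IsSubscaled d C) {J₀ : Type*} [Fintype J₀] [PartialOrder J₀]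
    {δ₀ : J₀ → ℕ} {e₀ : J₀ → L} (r₀ : IsRep C δ₀ e₀) {J : Type*} [Fintype J] [PartialOrder J]
    {δ : J → ℕ} {e : J → L} (r : IsRep C δ e) (hj : ∀ x, joinOf e {y | e y ≤ e₀ x} = e₀ x) :
    ∃ f : J → J₀, IsScMap δ δ₀ f ∧ ∀ x y, e y ≤ e₀ x ↔ f y ≤ x := by
  set D : J₀ → Set J := fun x => {y | e y ≤ e₀ x} with hD
  have hDl : ∀ x, IsLowerSet (D x) := fun x a b hab hb => (r.mono _ _ hab).trans hb
  have hU : ∀ T : Set J₀, IsLowerSet (⋃ x ∈ T, D x) := fun T =>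
    isLowerSet_iUnion₂ fun x _ => hDl x
  have hjU : ∀ T : Set J₀, joinOf e₀ T ≤ joinOf e (⋃ x ∈ T, D x) := fun T =>
    joinOf_le_iff.2 fun x hx => by
      rw [← hj x]
      exact joinOf_mono e (Set.subset_biUnion_of_mem (u := D) hx)
  have hmin : ∀ y : J, ∃ x, y ∈ D x ∧ ∀ x', y ∈ D x' → x ≤ x' := by
    intro y
    have hne : {x | y ∈ D x}.Nonempty := by
      have h1 : e y ≤ joinOf e (⋃ x ∈ Set.univ, D x) := by
        refine le_trans ?_ (hjU Set.univ)
        rw [r₀.top]; exact le_top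
      rw [r.le_joinOf_iff (hU _)] at h1
      simp only [Set.mem_iUnion] at h1
      obtain ⟨x, -, hx⟩ := h1
      exact ⟨x, hx⟩
    obtain ⟨x, hx⟩ := (Set.toFinite {x | y ∈ D x}).exists_minimal hne
    refine ⟨x, hx.prop, fun x' hx' => ?_⟩
    have h1 : e y ≤ joinOf e (⋃ z ∈ {z | z ≤ x ∧ z ≤ x'}, D z) :=
      (le_inf hx.prop hx').trans ((r₀.inf_le x x').trans (hjU _))
    rw [r.le_joinOf_iff (hU _)] at h1
    simp only [Set.mem_iUnion] at h1
    obtain ⟨z, ⟨hz1, hz2⟩, hz⟩ := h1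
    exact (hx.le_of_le hz hz1).trans hz2
  choose f hf hfm using hmin
  have hDf : ∀ x y, e y ≤ e₀ x ↔ f y ≤ x := fun x y =>
    ⟨fun h1 => hfm y x h1, fun h1 => (hf y).trans (r₀.mono _ _ h1)⟩
  have key : ∀ x y, f y ≤ x → ∃ y', y ≤ y' ∧ f y' = x ∧ δ y' = δ₀ x := by
    intro x y hy
    set W : Set J := {y | ∃ y', y ≤ y' ∧ f y' = x ∧ δ y' = δ₀ x} with hW
    have hWl : IsLowerSet W := fun a b hab ⟨y', h1, h2⟩ => ⟨y', hab.trans h1, h2⟩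
    set R₁ : Set J := {y | f y < x}
    set R₂ : Set J := {y | f y = x ∧ δ y ≠ δ₀ x}
    -- The element `e₀ x` is covered by the good part `W`, the part `R₁` lying over points strictly
    -- below `x`, and the part `R₂` over `x` of too small dimension. The last two can be removed
    -- from `e₀ x` without loss, so `W` alone covers it.
    have h1 : e₀ x ≤ joinOf e W ⊔ joinOf e R₁ ⊔ joinOf e R₂ := by
      rw [← hj x, ← joinOf_union, ← joinOf_union]
      refine joinOf_mono e fun y hy => ?_
      have hy := (hDf x y).1 hy
      rcases hy.lt_or_eq with h2 | h2
      · exact Or.inl (Or.inr h2)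
      · by_cases h3 : δ y = δ₀ x
        · exact Or.inl (Or.inl ⟨y, le_rfl, h2, h3⟩)
        · exact Or.inr ⟨h2, h3⟩
    have h2 : e₀ x \ joinOf e R₁ = e₀ x := by
      have h3 : e₀ x \ joinOf e₀ {z | z < x} = e₀ x :=
        sdiff_joinOf_eq_self fun z hz => r₀.disj _ _ (not_le_of_gt hz)
      refine sdiff_eq_self_of_le h3 (joinOf_le_iff.2 fun y hy => ?_)
      exact ((hDf _ y).2 le_rfl).trans (le_joinOf e₀ hy)
    have h3 : e₀ x \ joinOf e R₂ = e₀ x := by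
      refine h.sdiff_eq_self_of_dimLt (r₀.pure x) (h.dimLt_joinOf fun y hy => ?_)
      have h4 : δ y ≤ δ₀ x :=
        h.pure_le_pure (r.pure y) (r.ne_bot y) (r₀.pure x) ((hDf x y).2 hy.1.le)
      exact h.dimLt_mono (lt_of_le_of_ne h4 hy.2) (h.dimLt_of_pure (r.pure y))
    have h4 : e₀ x ≤ joinOf e W := by
      rw [← h3, sdiff_le_iff, ← h2, sdiff_le_iff]
      refine h1.trans (le_of_eq ?_)
      ac_rfl
    exact (r.le_joinOf_iff hWl).1 (((hDf x y).2 hy).trans h4)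
  refine ⟨f, ⟨fun x => ?_, fun y y' hyy => hfm y _ ((r.mono _ _ hyy).trans (hf y')),
    fun y x hyx => ?_, fun y => key _ y le_rfl⟩, hDf⟩
  · have : ∃ y, e y ≤ e₀ x := by
      by_contra hno
      push Not at hno
      apply r₀.ne_bot x
      rw [← hj x]
      exact le_bot_iff.1 (joinOf_le_iff.2 fun y hy => absurd hy (hno y))
    obtain ⟨y, hy⟩ := this
    obtain ⟨y', -, h1, -⟩ := key x y ((hDf x y).1 hy)
    exact ⟨y', h1⟩
  · obtain ⟨y', h1, h2, -⟩ := key x y hyx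
    exact ⟨y', h1, h2⟩

end Refinement

/-! ### Quasi-representations and the separation of their fibres -/

/-- The invariant of the inductive construction of representations: the values of `g` form a
representation of a quotient of `J`. -/
structure IsQuasiRep {L : Type*} [CoheytingAlgebra L] (C : ℕ → L → L) {J : Type*} [Fintype J]
    [PartialOrder J] (δ : J → ℕ) (g : J → L) : Prop where
  ne_bot : ∀ y, g y ≠ ⊥
  mono : ∀ y z, y ≤ z → g y ≤ g z
  lift : ∀ y z, g y ≤ g z → ∃ y', y ≤ y' ∧ g y' = g z
  dim : ∀ y, ∃ y', y ≤ y' ∧ g y' = g y ∧ C (δ y') (g y) = g y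
  disj : ∀ y z, ¬ g y ≤ g z → g y \ g z = g y
  inf_le : ∀ y z, g y ⊓ g z ≤ joinOf g {w | g w ≤ g y ∧ g w ≤ g z}
  top : joinOf g Set.univ = ⊤

/-- `g'` refines `g`. -/
structure Refines {L : Type*} [CoheytingAlgebra L] {J : Type*} [Fintype J] (g g' : J → L) :
    Prop where
  le : ∀ y, g' y ≤ g y
  le_join : ∀ z, g z ≤ joinOf g' {y | g y = g z}
  ker : ∀ y z, g' y = g' z → g y = g z

namespace Refines

variable {L : Type*} [CoheytingAlgebra L] {J : Type*} [Fintype J] {g g' g'' : J → L}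

theorem refl (g : J → L) : Refines g g :=
  ⟨fun _ => le_rfl, fun z => le_joinOf g (A := {y | g y = g z}) rfl, fun _ _ h => h⟩

theorem trans (h : Refines g g') (h' : Refines g' g'') : Refines g g'' where
  le y := (h'.le y).trans (h.le y)
  le_join z := (h.le_join z).trans (joinOf_le_iff.2 fun y hy =>
    (h'.le_join y).trans (joinOf_mono g'' fun _ hw => (h.ker _ _ hw).trans hy))
  ker _ _ e := h.ker _ _ (h'.ker _ _ e)

end Refines

namespace IsQuasiRep

variable {L : Type*} [CoheytingAlgebra L] {C : ℕ → L → L} {d : ℕ} {J : Type*} [Fintype J]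
  [PartialOrder J] {δ : J → ℕ} {g : J → L}

theorem exists_le_of_le_joinOf (r : IsQuasiRep C δ g) {A : Set J} {z : J}
    (hz : g z ≤ joinOf g A) : ∃ w ∈ A, g z ≤ g w := by
  by_contra hno
  push Not at hno
  have : g z \ joinOf g A = g z := sdiff_joinOf_eq_self fun w hw => r.disj _ _ (hno w hw)
  rw [sdiff_eq_bot_iff.2 hz] at this
  exact r.ne_bot z this.symm

theorem isRep_of_injective (r : IsQuasiRep C δ g) (hg : Function.Injective g) : IsRep C δ g := by
  have hle : ∀ y z, g y ≤ g z → y ≤ z := fun y z hyz => by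
    obtain ⟨y', h1, h2⟩ := r.lift y z hyz
    exact hg h2 ▸ h1
  refine ⟨r.ne_bot, fun y => ?_, r.mono, fun y z hyz => r.disj y z fun h => hyz (hle _ _ h),
    fun y z => ?_, r.top⟩
  · obtain ⟨y', -, h1, h2⟩ := r.dim y
    rwa [hg h1] at h2
  · exact (r.inf_le y z).trans (joinOf_mono g fun w hw => ⟨hle _ _ hw.1, hle _ _ hw.2⟩)

theorem of_isRep {J₀ : Type*} [Fintype J₀] [PartialOrder J₀] {δ₀ : J₀ → ℕ} {e : J₀ → L}
    (r : IsRep C δ₀ e) {f : J → J₀} (hf : IsScMap δ δ₀ f) : IsQuasiRep C δ (e ∘ f) := by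
  refine ⟨fun y => r.ne_bot _, fun y z h => r.mono _ _ (hf.mono h), fun y z h => ?_, fun y => ?_,
    fun y z h => r.disj _ _ fun h' => h (r.mono _ _ h'), fun y z => ?_, ?_⟩
  · obtain ⟨y', h1, h2⟩ := hf.lift y (f z) (r.le_iff.1 h)
    exact ⟨y', h1, congrArg e h2⟩
  · obtain ⟨y', h1, h2, h3⟩ := hf.dim y
    exact ⟨y', h1, congrArg e h2, by rw [h3]; exact r.pure _⟩
  · refine (r.inf_le _ _).trans (joinOf_le_iff.2 fun x hx => ?_)
    obtain ⟨w, rfl⟩ := hf.surj x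
    exact le_joinOf (e ∘ f) (x := w) ⟨r.mono _ _ hx.1, r.mono _ _ hx.2⟩
  · refine top_le_iff.1 (r.top.ge.trans (joinOf_le_iff.2 fun x _ => ?_))
    obtain ⟨w, rfl⟩ := hf.surj x
    exact le_joinOf (e ∘ f) (x := w) trivial

open Classical in
/-- One step of the construction: one fibre of `g` is divided into `{y₀}` and the rest. -/
theorem exists_refines_of_split (r : IsQuasiRep C δ g) {x u v xm : L} {y₀ y₁ : J}
    (hxm : xm = joinOf g {z | g z < x})
    (hy₀ : g y₀ = x) (hy₁ : g y₁ = x) (hne : y₁ ≠ y₀)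
    (hfib : ∀ y z, g y < x → g z = g y → z = y)
    (hmin : ∀ y ≤ y₀, g y = x → y = y₀)
    (habove : ∀ y, y₀ ≤ y → g y = x → y ≠ y₀ → u ≤ v)
    (hvu : v \ u = v)
    (huv : (u ≤ v ∧ ∃ y, y₀ ≤ y ∧ y ≠ y₀ ∧ g y = x) ∨ u \ v = u)
    (hu1 : joinOf g {z | g z < x ∧ z ≤ y₀} ≤ u)
    (hu2 : u ⊓ xm ≤ joinOf g {z | g z < x ∧ z ≤ y₀})
    (hv1 : joinOf g {z | g z < x ∧ ∃ y, g y = x ∧ y ≠ y₀ ∧ z ≤ y} ≤ v)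
    (hv2 : v ⊓ xm ≤ joinOf g {z | g z < x ∧ ∃ y, g y = x ∧ y ≠ y₀ ∧ z ≤ y})
    (hinf : u ≤ v ∨ u ⊓ v ≤ xm)
    (hsup : u ⊔ v = x) (hud : C (δ y₀) u = u)
    (hvd : ∀ y, g y = x → y ≠ y₀ → ∃ y', y ≤ y' ∧ g y' = x ∧ y' ≠ y₀ ∧ C (δ y') v = v)
    (hu0 : u ≠ ⊥) (hv0 : v ≠ ⊥) (hux : u \ xm = u) (hvx : v \ xm = v) :
    ∃ g' : J → L, IsQuasiRep C δ g' ∧ Refines g g' ∧ g' y₀ ≠ g' y₁ := by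
  have hule : u ≤ x := hsup ▸ le_sup_left
  have hvle : v ≤ x := hsup ▸ le_sup_right
  have lexm : ∀ z, g z < x → g z ≤ xm := fun z hz => by
    rw [hxm]; exact le_joinOf g (A := {z | g z < x}) hz
  -- Points with value strictly below `x` are alone in their fibres, so `lift` turns an inequality
  -- between their values into one in `J`. Thus `u` dominates exactly the values of those below
  -- `y₀`, and likewise `v` for the rest of the fibre over `x`.
  have hpu : ∀ z, g z < x → (z ≤ y₀ ↔ g z ≤ u) := by
    refine fun z hz => ⟨fun h => (le_joinOf g (A := {z | g z < x ∧ z ≤ y₀}) ⟨hz, h⟩).trans hu1,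
      fun h => ?_⟩
    obtain ⟨w, ⟨hw1, hw2⟩, hw⟩ := r.exists_le_of_le_joinOf ((le_inf h (lexm z hz)).trans hu2)
    obtain ⟨z', h1, h2⟩ := r.lift z w hw
    rw [hfib w z' hw1 h2] at h1
    exact h1.trans hw2
  have hpv : ∀ z, g z < x → ((∃ y, g y = x ∧ y ≠ y₀ ∧ z ≤ y) ↔ g z ≤ v) := by
    refine fun z hz => ⟨fun h => (le_joinOf g
      (A := {z | g z < x ∧ ∃ y, g y = x ∧ y ≠ y₀ ∧ z ≤ y}) ⟨hz, h⟩).trans hv1, fun h => ?_⟩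
    obtain ⟨w, ⟨hw1, y, hy1, hy2, hw2⟩, hw⟩ :=
      r.exists_le_of_le_joinOf ((le_inf h (lexm z hz)).trans hv2)
    obtain ⟨z', h1, h2⟩ := r.lift z w hw
    rw [hfib w z' hw1 h2] at h1
    exact ⟨y, hy1, hy2, h1.trans hw2⟩
  -- the common properties of `u` and `v`
  set Good : L → Prop := fun t => t ≤ x ∧ t ≠ ⊥ ∧ t \ xm = t ∧
    t ⊓ xm ≤ joinOf g {z | g z < x ∧ g z ≤ t} with hGood
  have gu : Good u := ⟨hule, hu0, hux, hu2.trans (joinOf_mono g fun z hz =>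
    ⟨hz.1, (hpu z hz.1).1 hz.2⟩)⟩
  have gv : Good v := ⟨hvle, hv0, hvx, hv2.trans (joinOf_mono g fun z hz =>
    ⟨hz.1, (hpv z hz.1).1 hz.2⟩)⟩
  have nle : ∀ t, Good t → ¬ t ≤ xm := fun t ht h => ht.2.1 (by
    rw [← ht.2.2.1, sdiff_eq_bot_iff.2 h])
  have xinf : ∀ z, ¬ x ≤ g z → x ⊓ g z ≤ joinOf g {w | g w < x ∧ g w ≤ g z} := by
    intro z hz
    rw [← hy₀]
    rw [← hy₀] at hz
    refine (r.inf_le y₀ z).trans (joinOf_mono g fun w hw => ⟨lt_of_le_of_ne hw.1 fun h => ?_, hw.2⟩)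
    exact hz (h ▸ hw.2)
  have xinf' : ∀ z, ¬ x ≤ g z → x ⊓ g z ≤ xm := fun z hz => by
    rw [hxm]; exact (xinf z hz).trans (joinOf_mono g fun w hw => hw.1)
  -- Unless `x ≤ g z`, the meet of `x` and `g z` lies below `xm`. A good `t` below `g z` would then
  -- lie below `xm`, although removing `xm` from it changes nothing and it is nonzero.
  have gle : ∀ t, Good t → ∀ z, t ≤ g z → x ≤ g z := by
    intro t ht z h
    by_contra hz
    exact nle t ht ((le_inf ht.1 h).trans (xinf' z hz))
  have gdisj : ∀ t, Good t → ∀ z, ¬ t ≤ g z → t \ g z = t := by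
    intro t ht z h
    have hz : ¬ x ≤ g z := fun h' => h (ht.1.trans h')
    rw [← sdiff_inf_self_left]
    exact sdiff_eq_self_of_le ht.2.2.1 ((inf_le_inf_right _ ht.1).trans (xinf' z hz))
  have gdisj' : ∀ t, Good t → ∀ z, g z ≠ x → ¬ g z ≤ t → g z \ t = g z := by
    intro t ht z hzx h
    by_cases hz : g z ≤ x
    · have hz' := lt_of_le_of_ne hz hzx
      rw [← sdiff_inf_self_left]
      have h1 : g z \ joinOf g {w | g w < x ∧ g w ≤ t} = g z :=
        sdiff_joinOf_eq_self fun w hw => r.disj _ _ fun h' => h (h'.trans hw.2)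
      refine sdiff_eq_self_of_le h1 (le_trans ?_ ht.2.2.2)
      exact le_inf inf_le_right (inf_le_left.trans (lexm z hz'))
    · rw [← hy₀] at hz
      exact sdiff_eq_self_of_le (r.disj _ _ hz) (ht.1.trans hy₀.ge)
  have ginf : ∀ t, Good t → ∀ z, ¬ x ≤ g z →
      t ⊓ g z ≤ joinOf g {w | g w < x ∧ g w ≤ t ∧ g w ≤ g z} := by
    intro t ht z hz
    have h1 : t ⊓ g z ≤ joinOf g {w | g w < x ∧ g w ≤ g z} ⊓ t :=
      le_inf ((inf_le_inf_right _ ht.1).trans (xinf z hz)) inf_le_left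
    refine h1.trans (joinOf_inf_le_iff.2 fun w hw => ?_)
    have h2 : g w ⊓ t ≤ joinOf g {z | g z < x ∧ g z ≤ t} ⊓ g w :=
      le_inf ((le_inf inf_le_right (inf_le_left.trans (lexm w hw.1))).trans ht.2.2.2) inf_le_left
    refine h2.trans (joinOf_inf_le_iff.2 fun w' hw' => ?_)
    exact (r.inf_le w' w).trans (joinOf_mono g fun w'' h'' =>
      ⟨h''.1.trans_lt hw'.1, h''.1.trans hw'.2, h''.2.trans hw.2⟩)
  have hvnu : ¬ v ≤ u := fun h => hv0 (by rw [← hvu, sdiff_eq_bot_iff.2 h])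
  -- the refined map
  set g' : J → L := fun y => if y = y₀ then u else if g y = x then v else g y with hg'
  have g0 : g' y₀ = u := by simp [hg']
  have g1 : ∀ y, y ≠ y₀ → g y = x → g' y = v := fun y h1 h2 => by simp [hg', h1, h2]
  have g2 : ∀ y, g y ≠ x → g' y = g y := fun y h1 => by
    have : y ≠ y₀ := fun h => h1 (h ▸ hy₀)
    simp [hg', h1, this]
  have tri : ∀ y, y = y₀ ∨ (y ≠ y₀ ∧ g y = x) ∨ g y ≠ x := fun y => by tauto
  have ref : Refines g g' := by
    refine ⟨fun y => ?_, fun z => ?_, fun y z h => ?_⟩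
    · rcases tri y with rfl | ⟨h1, h2⟩ | h1
      · rw [g0, hy₀]; exact hule
      · rw [g1 y h1 h2, h2]; exact hvle
      · rw [g2 y h1]
    · by_cases hz : g z = x
      · refine hz.le.trans (hsup.ge.trans (sup_le ?_ ?_))
        · rw [← g0]; exact le_joinOf g' (A := {y | g y = g z}) (hy₀.trans hz.symm)
        · rw [← g1 y₁ hne hy₁]; exact le_joinOf g' (A := {y | g y = g z}) (hy₁.trans hz.symm)
      · conv_lhs => rw [← g2 z hz]
        exact le_joinOf g' (A := {y | g y = g z}) rfl
    · have aux : ∀ t, Good t → ∀ z, g z ≠ x → t ≠ g z := fun t ht z hz h1 => by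
        refine nle t ht ?_
        have h2 : g z < x := lt_of_le_of_ne (h1 ▸ ht.1) hz
        rw [h1]; exact lexm z h2
      rcases tri y with rfl | ⟨h1, h2⟩ | h1 <;> rcases tri z with rfl | ⟨h3, h4⟩ | h3
      · rfl
      · rw [hy₀, h4]
      · rw [g0, g2 z h3] at h; exact absurd h (aux u gu z h3)
      · rw [h2, hy₀]
      · rw [h2, h4]
      · rw [g1 y h1 h2, g2 z h3] at h; exact absurd h (aux v gv z h3)
      · rw [g0, g2 y h1] at h; exact absurd h.symm (aux u gu y h1)
      · rw [g1 z h3 h4, g2 y h1] at h; exact absurd h.symm (aux v gv y h1)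
      · rwa [g2 y h1, g2 z h3] at h
  have gjoin : ∀ (A : Set J) (B : Set J), (∀ w ∈ A, g w < x ∧ w ∈ B) →
      joinOf g A ≤ joinOf g' B := fun A B hAB => joinOf_le_iff.2 fun w hw => by
    rw [← g2 w (hAB w hw).1.ne]; exact le_joinOf g' (hAB w hw).2
  have infg : ∀ t, Good t → ∀ z, g z ≠ x → ∀ s, g' s = t →
      t ⊓ g z ≤ joinOf g' {w | g' w ≤ t ∧ g' w ≤ g z} := by
    intro t ht z hz s hs
    by_cases hxz : x ≤ g z
    · refine inf_le_left.trans ?_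
      rw [← hs]
      exact le_joinOf g' (A := {w | g' w ≤ g' s ∧ g' w ≤ g z}) ⟨le_rfl, hs ▸ ht.1.trans hxz⟩
    · refine (ginf t ht z hxz).trans (gjoin _ _ fun w hw => ⟨hw.1, ?_⟩)
      rw [Set.mem_ofPred_eq, g2 w hw.1.ne]
      exact hw.2
  refine ⟨g', ⟨fun y => ?_, fun y z hyz => ?_, fun y z hyz => ?_, fun y => ?_, fun y z hyz => ?_,
    fun y z => ?_, ?_⟩, ref, ?_⟩
  · rcases tri y with rfl | ⟨h1, h2⟩ | h1
    · rw [g0]; exact hu0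
    · rw [g1 y h1 h2]; exact hv0
    · rw [g2 y h1]; exact r.ne_bot y
  · rcases tri y with rfl | ⟨h1, h2⟩ | h1 <;> rcases tri z with rfl | ⟨h3, h4⟩ | h3
    · exact le_rfl
    · rw [g0, g1 z h3 h4]; exact habove z hyz h4 h3
    · rw [g0, g2 z h3]; exact hule.trans (hy₀ ▸ r.mono _ _ hyz)
    · exact absurd (hmin y hyz h2) h1
    · rw [g1 y h1 h2, g1 z h3 h4]
    · rw [g1 y h1 h2, g2 z h3]; exact hvle.trans (h2 ▸ r.mono _ _ hyz)
    · have : g y < x := lt_of_le_of_ne (hy₀ ▸ r.mono _ _ hyz) h1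
      rw [g0, g2 y h1]; exact (hpu y this).1 hyz
    · have : g y < x := lt_of_le_of_ne (h4 ▸ r.mono _ _ hyz) h1
      rw [g1 z h3 h4, g2 y h1]; exact (hpv y this).1 ⟨z, h4, h3, hyz⟩
    · rw [g2 y h1, g2 z h3]; exact r.mono _ _ hyz
  · have up : ∀ y, g y ≤ g z → g z ≠ x → ∃ y', y ≤ y' ∧ g' y' = g' z := fun y h1 h2 => by
      obtain ⟨y', h3, h4⟩ := r.lift y z h1
      exact ⟨y', h3, by rw [g2 z h2, g2 y' (h4 ▸ h2), h4]⟩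
    rcases tri y with rfl | ⟨h1, h2⟩ | h1 <;> rcases tri z with rfl | ⟨h3, h4⟩ | h3
    · exact ⟨_, le_rfl, rfl⟩
    · rw [g0, g1 z h3 h4] at hyz
      rcases huv with ⟨-, y, h5, h6, h7⟩ | h5
      · exact ⟨y, h5, by rw [g1 y h6 h7, g1 z h3 h4]⟩
      · exact absurd (by rw [← h5, sdiff_eq_bot_iff.2 hyz]) hu0
    · rw [g0, g2 z h3] at hyz
      exact up _ (hy₀ ▸ gle u gu z hyz) h3
    · rw [g0, g1 y h1 h2] at hyz; exact absurd hyz hvnu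
    · exact ⟨y, le_rfl, by rw [g1 y h1 h2, g1 z h3 h4]⟩
    · rw [g1 y h1 h2, g2 z h3] at hyz
      exact up _ (h2 ▸ gle v gv z hyz) h3
    · rw [g0, g2 y h1] at hyz
      exact ⟨_, (hpu y (lt_of_le_of_ne (hyz.trans hule) h1)).2 hyz, rfl⟩
    · rw [g1 z h3 h4, g2 y h1] at hyz
      obtain ⟨y', h5, h6, h7⟩ := (hpv y (lt_of_le_of_ne (hyz.trans hvle) h1)).2 hyz
      exact ⟨y', h7, by rw [g1 y' h6 h5, g1 z h3 h4]⟩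
    · rw [g2 y h1, g2 z h3] at hyz
      exact up y hyz h3
  · rcases tri y with rfl | ⟨h1, h2⟩ | h1
    · exact ⟨_, le_rfl, rfl, by rw [g0, hud]⟩
    · obtain ⟨y', h3, h4, h5, h6⟩ := hvd y h2 h1
      exact ⟨y', h3, by rw [g1 y h1 h2, g1 y' h5 h4], by rw [g1 y h1 h2, h6]⟩
    · obtain ⟨y', h3, h4, h5⟩ := r.dim y
      exact ⟨y', h3, by rw [g2 y h1, g2 y' (h4 ▸ h1), h4], by rw [g2 y h1, h5]⟩
  · rcases tri y with rfl | ⟨h1, h2⟩ | h1 <;> rcases tri z with rfl | ⟨h3, h4⟩ | h3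
    · exact absurd le_rfl hyz
    · rw [g0, g1 z h3 h4] at hyz ⊢
      exact huv.resolve_left fun h => hyz h.1
    · rw [g0, g2 z h3] at hyz ⊢; exact gdisj u gu z hyz
    · rw [g0, g1 y h1 h2]; exact hvu
    · rw [g1 y h1 h2, g1 z h3 h4] at hyz; exact absurd le_rfl hyz
    · rw [g1 y h1 h2, g2 z h3] at hyz ⊢; exact gdisj v gv z hyz
    · rw [g0, g2 y h1] at hyz ⊢; exact gdisj' u gu y h1 hyz
    · rw [g1 z h3 h4, g2 y h1] at hyz ⊢; exact gdisj' v gv y h1 hyz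
    · rw [g2 y h1, g2 z h3] at hyz ⊢; exact r.disj y z hyz
  · have uvinf : u ⊓ v ≤ joinOf g' {w | g' w ≤ u ∧ g' w ≤ v} := by
      rcases hinf with h | h
      · refine inf_le_left.trans ?_
        conv_lhs => rw [← g0]
        exact le_joinOf g' (x := y₀) (by rw [Set.mem_ofPred_eq, g0]; exact ⟨le_rfl, h⟩)
      · have h1 : u ⊓ v ≤ joinOf g {z | g z < x ∧ g z ≤ u} ⊓ joinOf g {z | g z < x ∧ g z ≤ v} :=
          le_inf ((le_inf inf_le_left h).trans gu.2.2.2) ((le_inf inf_le_right h).trans gv.2.2.2)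
        refine h1.trans (joinOf_inf_le_iff.2 fun w hw => ?_)
        rw [inf_comm]
        refine joinOf_inf_le_iff.2 fun w' hw' => (r.inf_le w' w).trans (gjoin _ _ fun s hs => ?_)
        have hsx : g s < x := hs.1.trans_lt hw'.1
        refine ⟨hsx, ?_⟩
        rw [Set.mem_ofPred_eq, g2 s hsx.ne]
        exact ⟨hs.2.trans hw.2, hs.1.trans hw'.2⟩
    have selfinf : ∀ y, g' y ⊓ g' y ≤ joinOf g' {w | g' w ≤ g' y ∧ g' w ≤ g' y} := fun y =>
      inf_le_left.trans (le_joinOf g' (A := {w | g' w ≤ g' y ∧ g' w ≤ g' y}) ⟨le_rfl, le_rfl⟩)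
    have swap : ∀ a b, {w | g' w ≤ a ∧ g' w ≤ b} = {w | g' w ≤ b ∧ g' w ≤ a} := fun a b =>
      Set.ext fun w => and_comm
    rcases tri y with rfl | ⟨h1, h2⟩ | h1 <;> rcases tri z with rfl | ⟨h3, h4⟩ | h3
    · exact selfinf _
    · rw [g0, g1 z h3 h4]; exact uvinf
    · rw [g0, g2 z h3]; exact infg u gu z h3 _ g0
    · rw [g0, g1 y h1 h2, inf_comm, swap]; exact uvinf
    · rw [g1 z h3 h4, ← g1 y h1 h2]; exact selfinf _
    · rw [g1 y h1 h2, g2 z h3]; exact infg v gv z h3 _ (g1 y h1 h2)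
    · rw [g0, g2 y h1, inf_comm, swap]; exact infg u gu y h1 _ g0
    · rw [g1 z h3 h4, g2 y h1, inf_comm, swap]; exact infg v gv y h1 _ (g1 z h3 h4)
    · rw [g2 y h1, g2 z h3]
      refine (r.inf_le y z).trans (joinOf_le_iff.2 fun w hw => (ref.le_join w).trans ?_)
      refine joinOf_mono g' fun w' hw' => ?_
      have : g' w' ≤ g w := (ref.le w').trans (le_of_eq hw')
      exact ⟨this.trans hw.1, this.trans hw.2⟩
  · refine top_le_iff.1 (r.top.ge.trans (joinOf_le_iff.2 fun w _ => (ref.le_join w).trans ?_))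
    exact joinOf_mono g' (Set.subset_univ _)
  · rw [g0, g1 y₁ hne hy₁]
    intro h
    exact hvnu h.ge

end IsQuasiRep

/-! ### Separating fibres by Splitting and Catenarity -/

namespace IsQuasiRep

variable {L : Type*} [CoheytingAlgebra L] {C : ℕ → L → L} {d : ℕ} {J : Type*} [Fintype J]
  [PartialOrder J] {δ : J → ℕ} {g : J → L}

theorem sdiff_lower (r : IsQuasiRep C δ g) (y : J) :
    g y \ joinOf g {z | g z < g y} = g y :=
  sdiff_joinOf_eq_self fun _ hz => r.disj _ _ (not_le_of_gt hz)

theorem joinOf_lower_le (y : J) : joinOf g {z | g z < g y} ≤ g y :=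
  joinOf_le_iff.2 fun _ hz => le_of_lt hz

/-- Splitting is applied to `x` along the joins of the values strictly below `x` of points below
`y₀`, and of points below some other member of the fibre. Together these exhaust the values below
`x`, because every such point lifts into the fibre. As the fibre is an antichain, the point provided
by `dim` is the given one, so `x`, and hence each half, is pure of the dimension of every member. -/
theorem exists_refines_of_antichain (r : IsQuasiRep C δ g) (hs : HasSplitting L)
    (h : IsSubscaled d C) {y₀ y₁ : J} (hy₁ : g y₁ = g y₀) (hne : y₁ ≠ y₀)
    (hfib : ∀ y z, g y < g y₀ → g z = g y → z = y)
    (hanti : ∀ y z, g y = g y₀ → g z = g y₀ → y ≤ z → y = z) :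
    ∃ g' : J → L, IsQuasiRep C δ g' ∧ Refines g g' ∧ g' y₀ ≠ g' y₁ := by
  set x := g y₀ with hx
  set D₁ : Set J := {z | g z < x ∧ z ≤ y₀} with hD₁
  set D₂ : Set J := {z | g z < x ∧ ∃ y, g y = x ∧ y ≠ y₀ ∧ z ≤ y} with hD₂
  set xm := joinOf g {z | g z < x} with hxm
  have hD₁x : joinOf g D₁ ≤ xm := joinOf_mono g fun z hz => hz.1
  have hD₂x : joinOf g D₂ ≤ xm := joinOf_mono g fun z hz => hz.1
  have hxmD : xm ≤ joinOf g D₁ ⊔ joinOf g D₂ := by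
    rw [← joinOf_union]
    refine joinOf_mono g fun z hz => ?_
    obtain ⟨y, h1, h2⟩ := r.lift z y₀ (le_of_lt hz)
    by_cases hy : y = y₀
    · exact Or.inl ⟨hz, hy ▸ h1⟩
    · exact Or.inr ⟨hz, y, h2, hy, h1⟩
  have hx0 : x ≠ ⊥ := r.ne_bot y₀
  have hxx : x \ xm = x := r.sdiff_lower y₀
  have hneg : Negligible (joinOf g D₁ ⊔ joinOf g D₂) x :=
    (negligible_iff hx0).2 ⟨(sup_le hD₁x hD₂x).trans (joinOf_lower_le y₀),
      sdiff_eq_self_of_le hxx (sup_le hD₁x hD₂x)⟩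
  obtain ⟨u, v, hu0, hv0, hu1, hv1, hu, hv, huv⟩ := hs _ _ _ hneg hx0
  have hpure : C (δ y₀) x = x := by
    obtain ⟨y', h1, h2, h3⟩ := r.dim y₀
    rw [← hanti y₀ y' rfl h2 h1] at h3
    exact h3
  have hpure1 : ∀ y, g y = x → C (δ y) x = x := fun y hy => by
    obtain ⟨y', h1, h2, h3⟩ := r.dim y
    rw [← hanti y y' hy (h2.trans hy) h1, hy] at h3
    exact h3
  have hux : u ≤ x := hu ▸ sdiff_le
  have hvx : v ≤ x := hv ▸ sdiff_le
  refine r.exists_refines_of_split (x := x) (u := u) (v := v) hxm rfl hy₁ hne hfib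
    (fun y hy h1 => hanti y y₀ h1 rfl hy)
    (fun y hy h1 h2 => absurd (hanti y₀ y rfl h1 hy).symm h2) ?_ (Or.inr ?_) hu1 ?_ hv1 ?_
    (Or.inr ?_) ?_ ?_ ?_ hu0 hv0 ?_ ?_
  · conv_lhs => rw [hv]
    rw [sdiff_idem, ← hv]
  · conv_lhs => rw [hu]
    rw [sdiff_idem, ← hu]
  · refine (inf_le_inf_left u hxmD).trans ?_
    rw [inf_sup_left]
    refine sup_le inf_le_right ?_
    exact (inf_le_inf_left u hv1).trans (huv.le.trans inf_le_left)
  · refine (inf_le_inf_left v hxmD).trans ?_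
    rw [inf_sup_left]
    refine sup_le ?_ inf_le_right
    refine (inf_le_inf_left v hu1).trans ?_
    rw [inf_comm, huv]
    exact inf_le_right
  · exact huv.le.trans (inf_le_left.trans hD₁x)
  · apply le_antisymm (sup_le hux hvx)
    rw [sup_comm]
    conv_rhs => rw [hu]
    exact le_sup_sdiff
  · rw [hu]; exact h.pure_sdiff hpure v
  · intro y hy hyne
    exact ⟨y, le_rfl, hy, hyne, by rw [hv]; exact h.pure_sdiff (hpure1 y hy) u⟩
  · rw [hu, sdiff_sdiff_comm, hxx]
  · rw [hv, sdiff_sdiff_comm, hxx]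

/-- Here `v = x` is kept for the rest of the fibre, and `y₀` receives a smaller piece `u` of
dimension `δ y₀`. Splitting `x` along `joinOf g D₁` and `xm` provides `a` whose meet with `xm` is no
larger than `joinOf g D₁`; Catenarity inside `a` then finds `u` of the right dimension above `joinOf
g D₁`. -/
theorem exists_refines_of_lt (r : IsQuasiRep C δ g) (hs : HasSplitting L) (hc : IsCatenary C)
    (hδ : StrictMono δ) (h : IsSubscaled d C) {y₀ y₁ : J} (hy₁ : g y₁ = g y₀) (hlt : y₀ < y₁)
    (hfib : ∀ y z, g y < g y₀ → g z = g y → z = y)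
    (hmin : ∀ y ≤ y₀, g y = g y₀ → y = y₀) :
    ∃ g' : J → L, IsQuasiRep C δ g' ∧ Refines g g' ∧ g' y₀ ≠ g' y₁ := by
  set x := g y₀ with hx
  set D₁ : Set J := {z | g z < x ∧ z ≤ y₀} with hD₁
  set xm := joinOf g {z | g z < x} with hxm
  have hD₁x : joinOf g D₁ ≤ xm := joinOf_mono g fun z hz => hz.1
  have hx0 : x ≠ ⊥ := r.ne_bot y₀
  have hxx : x \ xm = x := r.sdiff_lower y₀
  have hxmx : xm ≤ x := joinOf_lower_le y₀
  have hneg : Negligible (joinOf g D₁ ⊔ xm) x :=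
    (negligible_iff hx0).2 ⟨sup_le (hD₁x.trans hxmx) hxmx,
      sdiff_eq_self_of_le hxx (sup_le hD₁x le_rfl)⟩
  obtain ⟨a, b, ha0, -, ha1, hb1, ha, -, hab⟩ := hs _ _ _ hneg hx0
  obtain ⟨y₂, hy₂, hgy₂, hp⟩ := r.dim y₁
  rw [hy₁] at hgy₂ hp
  set p := δ y₂ with hpdef
  set q := δ y₀ with hq
  have hqp : q < p := hδ (lt_of_lt_of_le hlt hy₂)
  have hdim : DimLt C q (joinOf g D₁) := h.dimLt_joinOf fun z hz => by
    obtain ⟨z', h1, h2, h3⟩ := r.dim z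
    rw [hfib z z' hz.1 h2] at h3
    have : z < y₀ := lt_of_le_of_ne hz.2 fun e => hz.1.ne (e ▸ rfl)
    exact h.dimLt_mono (hδ this) (h.dimLt_of_pure h3)
  have hap : C p a = a := by rw [ha]; exact h.pure_sdiff hp b
  have hax : a ≤ x := ha ▸ sdiff_le
  -- Catenarity requires a pure lower element, so it is applied to each pure component of `joinOf g
  -- D₁` separately.
  have hcat : ∀ i : ℕ, i ≤ q → ∃ w : L, w ≠ ⊥ ∧ C q w = w ∧ C i (joinOf g D₁) ≤ w ∧ w ≤ a := by
    intro i hi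
    obtain ⟨w, h1, h2, h3, h4⟩ := hc i q p hi hqp.le (C i (joinOf g D₁)) a
      ((h.pc_le _ _).trans ha1) ha0 (h.isScPure_iff.2 (h.pc_pc _ _)) (h.isScPure_iff.2 hap)
    exact ⟨w, h1, h.isScPure_iff.1 h2, h3, h4⟩
  choose! w hw0 hwp hw1 hw2 using hcat
  -- The components of `joinOf g D₁` have index below `q`. The index `q` is included so that the
  -- join is never over an empty set, and `u` is nonzero even for `q = 0`.
  set u := (Finset.range (q + 1)).sup w with hu
  have hwu : ∀ i ≤ q, w i ≤ u := fun i hi => Finset.le_sup (Finset.mem_range.2 (by omega))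
  have hu0 : u ≠ ⊥ := fun e => hw0 q le_rfl (le_bot_iff.1 (e ▸ hwu q le_rfl))
  have hup : C q u = u := h.pure_finsetSup fun i hi => hwp i (by simpa [Nat.lt_succ_iff] using hi)
  have hua : u ≤ a := Finset.sup_le fun i hi => hw2 i (by simpa [Nat.lt_succ_iff] using hi)
  have hDu : joinOf g D₁ ≤ u := by
    have : joinOf g D₁ = (Finset.range q).sup fun i => C i (joinOf g D₁) := hdim.symm
    rw [this]
    refine Finset.sup_le fun i hi => ?_
    have hi := Finset.mem_range.1 hi
    exact (hw1 i hi.le).trans (hwu i hi.le)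
  have huxm : u ⊓ xm ≤ joinOf g D₁ :=
    (inf_le_inf hua (le_sup_right.trans (sup_le hb1 hb1))).trans (hab.le.trans inf_le_left)
  have hux : u ≤ x := hua.trans hax
  have hne : y₁ ≠ y₀ := hlt.ne'
  refine r.exists_refines_of_split (x := x) (u := u) (v := x) hxm rfl hy₁ hne hfib hmin
    (fun y _ _ _ => hux) ?_ (Or.inl ⟨hux, y₁, hlt.le, hne, hy₁⟩) hDu huxm ?_ ?_
    (Or.inl hux) (sup_eq_right.2 hux) hup ?_ hu0 hx0 ?_ hxx
  · exact h.sdiff_eq_self_of_dimLt hp (h.dimLt_mono hqp (h.dimLt_of_pure hup))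
  · exact joinOf_le_iff.2 fun z hz => hz.1.le
  · refine inf_le_right.trans (joinOf_mono g fun z hz => ⟨hz, ?_⟩)
    obtain ⟨y, h1, h2⟩ := r.lift z y₀ (le_of_lt hz)
    by_cases hy : y = y₀
    · exact ⟨y₁, hy₁, hne, (hy ▸ h1).trans hlt.le⟩
    · exact ⟨y, h2, hy, h1⟩
  · intro y hy hyne
    obtain ⟨y', h1, h2, h3⟩ := r.dim y
    rw [hy] at h2 h3
    exact ⟨y', h1, h2, fun e => hyne (hmin y (e ▸ h1) hy), h3⟩
  · rw [← sdiff_inf_self_left]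
    exact h.sdiff_eq_self_of_dimLt hup (h.dimLt_of_le huxm hdim)

/-- Induction on the number of pairs identified by `g`. A nontrivial fibre with minimal value is
chosen, so that all fibres below it are trivial. If it is an antichain, Splitting alone separates
it; otherwise a minimal member of the fibre lies below another one, and Catenarity is used as well.
-/
theorem exists_injective (hs : HasSplitting L) (hc : IsCatenary C)
    (hδ : StrictMono δ) (h : IsSubscaled d C) (n : ℕ) (g : J → L) (r : IsQuasiRep C δ g)
    (hn : {p : J × J | g p.1 = g p.2}.ncard ≤ n) :
    ∃ g' : J → L, IsQuasiRep C δ g' ∧ Refines g g' ∧ Function.Injective g' := by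
  induction n generalizing g with
  | zero =>
    refine ⟨g, r, Refines.refl g, fun a b hab => ?_⟩
    have := (Set.ncard_eq_zero (Set.toFinite _)).1 (Nat.le_zero.1 hn)
    exact absurd (show (a, b) ∈ {p : J × J | g p.1 = g p.2} from hab) (by rw [this]; simp)
  | succ n ih =>
    by_cases hinj : Function.Injective g
    · exact ⟨g, r, Refines.refl g, hinj⟩
    suffices hstep : ∃ (y₀ y₁ : J) (g' : J → L), g y₁ = g y₀ ∧ IsQuasiRep C δ g' ∧ Refines g g' ∧
        g' y₀ ≠ g' y₁ by
      obtain ⟨y₀, y₁, g', h1, h2, h3, h4⟩ := hstep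
      have hlt : {p : J × J | g' p.1 = g' p.2}.ncard < {p : J × J | g p.1 = g p.2}.ncard := by
        refine Set.ncard_lt_ncard ⟨fun p hp => h3.ker _ _ hp, fun hsub => ?_⟩ (Set.toFinite _)
        exact h4 (hsub (show (y₀, y₁) ∈ {p : J × J | g p.1 = g p.2} from h1.symm))
      obtain ⟨g'', h5, h6, h7⟩ := ih g' h2 (by omega)
      exact ⟨g'', h5, h3.trans h6, h7⟩
    have hne : {y : J | ∃ z, z ≠ y ∧ g z = g y}.Nonempty := by
      simp only [Function.Injective] at hinj
      push Not at hinj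
      obtain ⟨a, b, hab, hne⟩ := hinj
      exact ⟨b, a, hne, hab⟩
    obtain ⟨m, hm⟩ := (Set.toFinite {y : J | ∃ z, z ≠ y ∧ g z = g y}).exists_minimalFor g _ hne
    have hfib : ∀ y z, g y < g m → g z = g y → z = y := by
      intro y z hy hz
      by_contra hzy
      exact absurd (hm.2 ⟨z, hzy, hz⟩ hy.le) (not_le_of_gt hy)
    by_cases hanti : ∀ y z, g y = g m → g z = g m → y ≤ z → y = z
    · obtain ⟨z, hz, hzm⟩ := hm.1
      obtain ⟨g', h1, h2, h3⟩ := r.exists_refines_of_antichain hs h hzm hz hfib hanti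
      exact ⟨m, z, g', hzm, h1, h2, h3⟩
    · push Not at hanti
      obtain ⟨y, z, hy, hz, hyz, hne⟩ := hanti
      obtain ⟨y₀, hy₀y, hy₀⟩ := (Set.toFinite {w | g w = g m}).exists_le_minimal
        (show y ∈ {w | g w = g m} from hy)
      have hy₀m : g y₀ = g m := hy₀.prop
      obtain ⟨g', h1, h2, h3⟩ := r.exists_refines_of_lt hs hc hδ h (y₀ := y₀) (y₁ := z)
        (hz.trans hy₀m.symm) (hy₀y.trans_lt (lt_of_le_of_ne hyz hne)) (by rwa [hy₀m])
        (fun w hw hgw => le_antisymm hw (hy₀.le_of_le (hgw.trans hy₀m) hw))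
      exact ⟨y₀, z, g', hz.trans hy₀m.symm, h1, h2, h3⟩

end IsQuasiRep

/-- The extension property of lattices with the Catenarity and Splitting properties. -/
theorem IsRep.exists_extension {L : Type*} [CoheytingAlgebra L] {C : ℕ → L → L} {d : ℕ}
    (h : IsSubscaled d C) (hs : HasSplitting L) (hc : IsCatenary C)
    {J₀ J : Type*} [Fintype J₀] [PartialOrder J₀] [Fintype J] [PartialOrder J] {δ₀ : J₀ → ℕ}
    {δ : J → ℕ} {e : J₀ → L} (r : IsRep C δ₀ e) {f : J → J₀} (hf : IsScMap δ δ₀ f)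
    (hδ : StrictMono δ) :
    ∃ e' : J → L, IsRep C δ e' ∧ ∀ x, e x = joinOf e' {y | f y ≤ x} := by
  obtain ⟨g', h1, h2, h3⟩ := IsQuasiRep.exists_injective hs hc hδ h _ (e ∘ f)
    (IsQuasiRep.of_isRep r hf) le_rfl
  refine ⟨g', h1.isRep_of_injective h3, fun x => le_antisymm ?_ ?_⟩
  · obtain ⟨y, rfl⟩ := hf.surj x
    exact (h2.le_join y).trans (joinOf_mono g' fun z hz => (r.injective hz).le)
  · exact joinOf_le_iff.2 fun y hy => (h2.le y).trans (r.mono _ _ hy)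

/-! ## First-order definability -/

section Operations

variable {M : Type} [LSC.Structure M]

/-- These operations are read off the structure itself, so that axioms can be formulated before a
co-Heyting algebra is available. -/
def cBot (M : Type) [LSC.Structure M] : M := Structure.funMap (L := LSC) ScFunc.bot ![]
def cTop (M : Type) [LSC.Structure M] : M := Structure.funMap (L := LSC) ScFunc.top ![]
def cSup (a b : M) : M := Structure.funMap (L := LSC) ScFunc.sup ![a, b]
def cInf (a b : M) : M := Structure.funMap (L := LSC) ScFunc.inf ![a, b]
def cSdiff (a b : M) : M := Structure.funMap (L := LSC) ScFunc.sdiff ![a, b]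

/-- The join of the `C^i(a)`, `i ∈ I`. -/
def cJoin (I : List ℕ) (a : M) : M := I.foldr (fun i x => cSup (pcMap M i a) x) (cBot M)

/-- A property of tuples defined by a first-order formula. -/
def FODef {n : ℕ} (P : ∀ (M : Type) [LSC.Structure M], (Fin n → M) → Prop) : Prop :=
  ∃ φ : LSC.BoundedFormula Empty n, ∀ (M : Type) [LSC.Structure M] (v : Fin n → M),
    φ.Realize default v ↔ P M v

/-- A property of tuples defined by a quantifier-free formula. -/
def QFDef {n : ℕ} (P : ∀ (M : Type) [LSC.Structure M], (Fin n → M) → Prop) : Prop :=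
  ∃ φ : LSC.BoundedFormula Empty n, φ.IsQF ∧ ∀ (M : Type) [LSC.Structure M] (v : Fin n → M),
    φ.Realize default v ↔ P M v

/-- A function of tuples defined by a term. -/
def TmDef {n : ℕ} (f : ∀ (M : Type) [LSC.Structure M], (Fin n → M) → M) : Prop :=
  ∃ t : LSC.Term (Empty ⊕ Fin n), ∀ (M : Type) [LSC.Structure M] (v : Fin n → M),
    t.realize (Sum.elim default v) = f M v

end Operations

section Closure

variable {n : ℕ} {f g : ∀ (M : Type) [LSC.Structure M], (Fin n → M) → M}
  {P Q : ∀ (M : Type) [LSC.Structure M], (Fin n → M) → Prop}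

theorem TmDef.var (i : Fin n) : TmDef fun _ _ v => v i := ⟨.var (.inr i), fun _ _ _ => rfl⟩

theorem TmDef.bot : TmDef (n := n) fun M _ _ => cBot M :=
  ⟨.func ScFunc.bot ![], fun _ _ _ => by
    rw [Term.realize_func]; exact congrArg _ (Subsingleton.elim _ _)⟩

theorem TmDef.top : TmDef (n := n) fun M _ _ => cTop M :=
  ⟨.func ScFunc.top ![], fun _ _ _ => by
    rw [Term.realize_func]; exact congrArg _ (Subsingleton.elim _ _)⟩

theorem TmDef.app₂ (F : ScFunc 2) (hf : TmDef f) (hg : TmDef g) :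
    TmDef fun M _ v => Structure.funMap (L := LSC) F ![f M v, g M v] := by
  obtain ⟨t, ht⟩ := hf
  obtain ⟨u, hu⟩ := hg
  refine ⟨.func F ![t, u], fun M _ v => ?_⟩
  rw [Term.realize_func]
  congr 1
  ext i
  fin_cases i
  · exact ht M v
  · exact hu M v

theorem TmDef.sup (hf : TmDef f) (hg : TmDef g) : TmDef fun M _ v => cSup (f M v) (g M v) :=
  TmDef.app₂ _ hf hg

theorem TmDef.inf (hf : TmDef f) (hg : TmDef g) : TmDef fun M _ v => cInf (f M v) (g M v) :=
  TmDef.app₂ _ hf hg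

theorem TmDef.sdiff (hf : TmDef f) (hg : TmDef g) : TmDef fun M _ v => cSdiff (f M v) (g M v) :=
  TmDef.app₂ _ hf hg

theorem TmDef.pc (k : ℕ) (hf : TmDef f) : TmDef fun M _ v => pcMap M k (f M v) := by
  obtain ⟨t, ht⟩ := hf
  refine ⟨.func (ScFunc.pc k) ![t], fun M _ v => ?_⟩
  rw [Term.realize_func]
  refine congrArg (Structure.funMap (L := LSC) (ScFunc.pc k)) (funext fun i => ?_)
  fin_cases i
  exact ht M v

theorem TmDef.join (I : List ℕ) (hf : TmDef f) : TmDef fun M _ v => cJoin I (f M v) := by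
  induction I with
  | nil => exact TmDef.bot
  | cons i I ih => exact TmDef.sup (TmDef.pc i hf) ih

theorem QFDef.fo (h : QFDef P) : FODef P := by
  obtain ⟨φ, -, h⟩ := h
  exact ⟨φ, h⟩

theorem QFDef.eq (hf : TmDef f) (hg : TmDef g) : QFDef fun M _ v => f M v = g M v := by
  obtain ⟨t, ht⟩ := hf
  obtain ⟨u, hu⟩ := hg
  refine ⟨t.bdEqual u, (BoundedFormula.IsAtomic.equal t u).isQF, fun M _ v => ?_⟩
  rw [BoundedFormula.realize_bdEqual, ht, hu]

theorem QFDef.imp (hP : QFDef P) (hQ : QFDef Q) : QFDef fun M _ v => P M v → Q M v := by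
  obtain ⟨φ, h1, h2⟩ := hP
  obtain ⟨ψ, h3, h4⟩ := hQ
  exact ⟨φ.imp ψ, h1.imp h3, fun M _ v => by rw [BoundedFormula.realize_imp, h2, h4]⟩

theorem QFDef.false : QFDef (n := n) fun _ _ _ => False :=
  ⟨⊥, BoundedFormula.isQF_bot, fun M _ v => by simp⟩

theorem QFDef.of_iff (hP : QFDef P) (h : ∀ (M : Type) [LSC.Structure M] (v : Fin n → M),
    P M v ↔ Q M v) : QFDef Q := by
  obtain ⟨φ, h1, h2⟩ := hP
  exact ⟨φ, h1, fun M _ v => (h2 M v).trans (h M v)⟩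

theorem QFDef.not (hP : QFDef P) : QFDef fun M _ v => ¬ P M v := hP.imp QFDef.false

theorem QFDef.ne (hf : TmDef f) (hg : TmDef g) : QFDef fun M _ v => f M v ≠ g M v :=
  (QFDef.eq hf hg).not

theorem QFDef.and (hP : QFDef P) (hQ : QFDef Q) : QFDef fun M _ v => P M v ∧ Q M v :=
  (hP.imp hQ.not).not.of_iff fun M _ v => by tauto

theorem QFDef.iff (hP : QFDef P) (hQ : QFDef Q) : QFDef fun M _ v => (P M v ↔ Q M v) :=
  ((hP.imp hQ).and (hQ.imp hP)).of_iff fun M _ v => by tauto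

theorem QFDef.forall_mem {ι : Type} (l : List ι)
    {R : ι → ∀ (M : Type) [LSC.Structure M], (Fin n → M) → Prop} (h : ∀ i, QFDef (R i)) :
    QFDef fun M _ v => ∀ i ∈ l, R i M v := by
  induction l with
  | nil => exact QFDef.false.not.of_iff fun M _ v => by simp
  | cons i l ih => exact ((h i).and ih).of_iff fun M _ v => by simp

theorem QFDef.exists_mem {ι : Type} (l : List ι)
    {R : ι → ∀ (M : Type) [LSC.Structure M], (Fin n → M) → Prop} (h : ∀ i, QFDef (R i)) :
    QFDef fun M _ v => ∃ i ∈ l, R i M v :=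
  (QFDef.forall_mem l fun i => (h i).not).not.of_iff fun M _ v => by
    push Not; rfl

theorem QFDef.const (p : Prop) : QFDef (n := n) fun _ _ _ => p := by
  by_cases hp : p
  · exact QFDef.false.not.of_iff fun M _ v => by simp [hp]
  · exact QFDef.false.of_iff fun M _ v => by simp [hp]

theorem FODef.imp (hP : FODef P) (hQ : FODef Q) : FODef fun M _ v => P M v → Q M v := by
  obtain ⟨φ, h2⟩ := hP
  obtain ⟨ψ, h4⟩ := hQ
  exact ⟨φ.imp ψ, fun M _ v => by rw [BoundedFormula.realize_imp, h2, h4]⟩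

theorem FODef.all {P : ∀ (M : Type) [LSC.Structure M], (Fin (n + 1) → M) → Prop} (hP : FODef P) :
    FODef fun M _ v => ∀ a : M, P M (Fin.snoc v a) := by
  obtain ⟨φ, h⟩ := hP
  exact ⟨φ.all, fun M _ v => by rw [BoundedFormula.realize_all]; exact forall_congr' fun a => h M _⟩

theorem FODef.ex {P : ∀ (M : Type) [LSC.Structure M], (Fin (n + 1) → M) → Prop} (hP : FODef P) :
    FODef fun M _ v => ∃ a : M, P M (Fin.snoc v a) := by
  obtain ⟨φ, h⟩ := hP
  exact ⟨φ.ex, fun M _ v => by rw [BoundedFormula.realize_ex]; exact exists_congr fun a => h M _⟩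

end Closure

theorem BoundedFormula.IsQF.realize_embedding {M N : Type} [LSC.Structure M] [LSC.Structure N]
    (f : M ↪[LSC] N) {n : ℕ} {φ : LSC.BoundedFormula Empty n} (h : φ.IsQF) (v : Fin n → M) :
    φ.Realize default (f ∘ v) ↔ φ.Realize default v := by
  induction h with
  | falsum => exact Iff.rfl
  | of_isAtomic h =>
    cases h with
    | equal t u =>
      have e : Sum.elim (default : Empty → N) (f ∘ v) = f ∘ Sum.elim default v := by
        ext x
        rcases x with x | x
        · exact x.elim
        · rfl
      rw [BoundedFormula.realize_bdEqual, BoundedFormula.realize_bdEqual, e,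
        HomClass.realize_term, HomClass.realize_term]
      exact f.injective.eq_iff
    | rel R => exact Empty.elim R
  | imp _ _ h1 h2 => rw [BoundedFormula.realize_imp, BoundedFormula.realize_imp, h1, h2]

theorem QFDef.realize_embedding {n : ℕ} {P : ∀ (M : Type) [LSC.Structure M], (Fin n → M) → Prop}
    (h : QFDef P) {M N : Type} [LSC.Structure M] [LSC.Structure N] (f : M ↪[LSC] N)
    (v : Fin n → M) : P N (f ∘ v) ↔ P M v := by
  obtain ⟨φ, h1, h2⟩ := h
  rw [← h2, ← h2, BoundedFormula.IsQF.realize_embedding f h1]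

/-! ## Maps of structures -/

section Maps

variable {M N : Type} [LSC.Structure M] [LSC.Structure N]

theorem funMap_bot (x : Fin 0 → M) : Structure.funMap (L := LSC) ScFunc.bot x = cBot M := by
  rw [cBot]; congr 1; exact Subsingleton.elim _ _

theorem funMap_top (x : Fin 0 → M) : Structure.funMap (L := LSC) ScFunc.top x = cTop M := by
  rw [cTop]; congr 1; exact Subsingleton.elim _ _

theorem eq_vec₂ {α : Type*} (x : Fin 2 → α) : x = ![x 0, x 1] := by
  ext i; fin_cases i <;> rfl

theorem eq_vec₁ {α : Type*} (x : Fin 1 → α) : x = ![x 0] := by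
  ext i; fin_cases i; rfl

theorem funMap_sup (x : Fin 2 → M) :
    Structure.funMap (L := LSC) ScFunc.sup x = cSup (x 0) (x 1) := by
  conv_lhs => rw [eq_vec₂ x]
  rfl

theorem funMap_inf (x : Fin 2 → M) :
    Structure.funMap (L := LSC) ScFunc.inf x = cInf (x 0) (x 1) := by
  conv_lhs => rw [eq_vec₂ x]
  rfl

theorem funMap_sdiff (x : Fin 2 → M) :
    Structure.funMap (L := LSC) ScFunc.sdiff x = cSdiff (x 0) (x 1) := by
  conv_lhs => rw [eq_vec₂ x]
  rfl

theorem funMap_pc (i : ℕ) (x : Fin 1 → M) :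
    Structure.funMap (L := LSC) (ScFunc.pc i) x = pcMap M i (x 0) := by
  conv_lhs => rw [eq_vec₁ x]
  rfl

/-- An injective map that preserves the operations is an embedding. -/
def LSC.mkEmbedding (f : M → N) (hf : Function.Injective f) (hbot : f (cBot M) = cBot N)
    (htop : f (cTop M) = cTop N) (hsup : ∀ a b, f (cSup a b) = cSup (f a) (f b))
    (hinf : ∀ a b, f (cInf a b) = cInf (f a) (f b))
    (hsdiff : ∀ a b, f (cSdiff a b) = cSdiff (f a) (f b))
    (hpc : ∀ i a, f (pcMap M i a) = pcMap N i (f a)) : M ↪[LSC] N where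
  toFun := f
  inj' := hf
  map_fun' := by
    intro n F x
    cases F with
    | bot => rw [funMap_bot, funMap_bot, hbot]
    | top => rw [funMap_top, funMap_top, htop]
    | sup => rw [funMap_sup, funMap_sup, hsup]; rfl
    | inf => rw [funMap_inf, funMap_inf, hinf]; rfl
    | sdiff => rw [funMap_sdiff, funMap_sdiff, hsdiff]; rfl
    | pc i => rw [funMap_pc, funMap_pc, hpc]; rfl
  map_rel' := fun R => Empty.elim R

variable (f : M ↪[LSC] N)

theorem map_cBot : f (cBot M) = cBot N := (f.map_fun ScFunc.bot _).trans (funMap_bot _)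
theorem map_cTop : f (cTop M) = cTop N := (f.map_fun ScFunc.top _).trans (funMap_top _)
theorem map_cSup (a b : M) : f (cSup a b) = cSup (f a) (f b) :=
  (f.map_fun ScFunc.sup _).trans (funMap_sup _)
theorem map_cInf (a b : M) : f (cInf a b) = cInf (f a) (f b) :=
  (f.map_fun ScFunc.inf _).trans (funMap_inf _)
theorem map_cSdiff (a b : M) : f (cSdiff a b) = cSdiff (f a) (f b) :=
  (f.map_fun ScFunc.sdiff _).trans (funMap_sdiff _)
theorem map_pcMap (i : ℕ) (a : M) : f (pcMap M i a) = pcMap N i (f a) :=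
  (f.map_fun (ScFunc.pc i) _).trans (funMap_pc _ _)

end Maps

/-! ## Universal axioms of subscaled lattices -/

/-- The axioms of co-Heyting algebras for the elements `v 0, v 1, v 2`. -/
structure CoheytingAx (M : Type) [LSC.Structure M] (a b c : M) : Prop where
  sup_comm : cSup a b = cSup b a
  sup_assoc : cSup (cSup a b) c = cSup a (cSup b c)
  inf_comm : cInf a b = cInf b a
  inf_assoc : cInf (cInf a b) c = cInf a (cInf b c)
  sup_inf_self : cSup a (cInf a b) = a
  inf_sup_self : cInf a (cSup a b) = a
  distrib : cSup (cInf (cSup a b) (cSup a c)) (cSup a (cInf b c)) = cSup a (cInf b c)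
  le_top : cSup a (cTop M) = cTop M
  bot_le : cSup (cBot M) a = a
  sdiff_le_iff : cSup (cSdiff a b) c = c ↔ cSup a (cSup b c) = cSup b c

/-- The axioms of `d`-subscaled lattices for the elements `a, b`. -/
structure SubscaledAx (d : ℕ) (M : Type) [LSC.Structure M] (a b : M) : Prop where
  join_pc : cJoin (List.range (d + 1)) a = a
  pc_join : ∀ I ∈ (List.range (d + 1)).sublists, ∀ k ∈ List.range (d + 1),
    (k ∈ I → pcMap M k (cJoin I a) = pcMap M k a) ∧ (k ∉ I → pcMap M k (cJoin I a) = cBot M)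
  pc_sup : ∀ k ∈ List.range (d + 1), cJoin (List.range (k + 1)) a = a →
    cJoin (List.range (k + 1)) b = b → pcMap M k (cSup a b) = cSup (pcMap M k a) (pcMap M k b)
  dim_inf : ∀ i ∈ List.range (d + 1), ∀ j ∈ List.range (d + 1), i ≠ j →
    cJoin (List.range (min i j)) (cInf (pcMap M i a) (pcMap M j a)) =
      cInf (pcMap M i a) (pcMap M j a)
  pc_sdiff : ∀ k ∈ List.range (d + 1), cJoin (List.range (k + 1)) b = b →
    cSdiff (pcMap M k a) b = cSdiff (pcMap M k a) (pcMap M k b)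
  dim_lt : a ≠ cBot M → cSup b a = a → cSdiff a b = a → ∃ k ∈ List.range (d + 1),
    cJoin (List.range k) b = b ∧ cJoin (List.range k) a ≠ a

theorem qfDef_coheytingAx : QFDef (n := 3) fun M _ v => CoheytingAx M (v 0) (v 1) (v 2) := by
  have h : QFDef (n := 3) _ :=
    (QFDef.eq ((TmDef.var 0).sup (TmDef.var 1)) ((TmDef.var 1).sup (TmDef.var 0))).and <|
    (QFDef.eq (((TmDef.var 0).sup (TmDef.var 1)).sup (TmDef.var 2))
      ((TmDef.var 0).sup ((TmDef.var 1).sup (TmDef.var 2)))).and <|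
    (QFDef.eq ((TmDef.var 0).inf (TmDef.var 1)) ((TmDef.var 1).inf (TmDef.var 0))).and <|
    (QFDef.eq (((TmDef.var 0).inf (TmDef.var 1)).inf (TmDef.var 2))
      ((TmDef.var 0).inf ((TmDef.var 1).inf (TmDef.var 2)))).and <|
    (QFDef.eq ((TmDef.var 0).sup ((TmDef.var 0).inf (TmDef.var 1))) (TmDef.var 0)).and <|
    (QFDef.eq ((TmDef.var 0).inf ((TmDef.var 0).sup (TmDef.var 1))) (TmDef.var 0)).and <|
    (QFDef.eq ((((TmDef.var 0).sup (TmDef.var 1)).inf ((TmDef.var 0).sup (TmDef.var 2))).sup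
      ((TmDef.var 0).sup ((TmDef.var 1).inf (TmDef.var 2))))
      ((TmDef.var 0).sup ((TmDef.var 1).inf (TmDef.var 2)))).and <|
    (QFDef.eq ((TmDef.var 0).sup TmDef.top) TmDef.top).and <|
    (QFDef.eq (TmDef.bot.sup (TmDef.var 0)) (TmDef.var 0)).and <|
    (QFDef.eq (((TmDef.var 0).sdiff (TmDef.var 1)).sup (TmDef.var 2)) (TmDef.var 2)).iff
      (QFDef.eq ((TmDef.var 0).sup ((TmDef.var 1).sup (TmDef.var 2)))
        ((TmDef.var 1).sup (TmDef.var 2)))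
  exact h.of_iff fun M _ v =>
    ⟨fun ⟨h1, h2, h3, h4, h5, h6, h7, h8, h9, h10⟩ => ⟨h1, h2, h3, h4, h5, h6, h7, h8, h9, h10⟩,
      fun ⟨h1, h2, h3, h4, h5, h6, h7, h8, h9, h10⟩ => ⟨h1, h2, h3, h4, h5, h6, h7, h8, h9, h10⟩⟩

theorem qfDef_subscaledAx (d : ℕ) : QFDef (n := 3) fun M _ v => SubscaledAx d M (v 0) (v 1) := by
  have x : TmDef (n := 3) fun _ _ v => v 0 := TmDef.var 0
  have y : TmDef (n := 3) fun _ _ v => v 1 := TmDef.var 1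
  have h : QFDef (n := 3) _ :=
    (QFDef.eq (x.join (List.range (d + 1))) x).and <|
    (QFDef.forall_mem (List.range (d + 1)).sublists fun I =>
      QFDef.forall_mem (List.range (d + 1)) fun k =>
        ((QFDef.const (k ∈ I)).imp (QFDef.eq ((x.join I).pc k) (x.pc k))).and
          ((QFDef.const (k ∉ I)).imp (QFDef.eq ((x.join I).pc k) TmDef.bot))).and <|
    (QFDef.forall_mem (List.range (d + 1)) fun k =>
      (QFDef.eq (x.join (List.range (k + 1))) x).imp <|
      (QFDef.eq (y.join (List.range (k + 1))) y).imp
        (QFDef.eq ((x.sup y).pc k) ((x.pc k).sup (y.pc k)))).and <|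
    (QFDef.forall_mem (List.range (d + 1)) fun i => QFDef.forall_mem (List.range (d + 1)) fun j =>
      (QFDef.const (i ≠ j)).imp
        (QFDef.eq (((x.pc i).inf (x.pc j)).join (List.range (min i j)))
          ((x.pc i).inf (x.pc j)))).and <|
    (QFDef.forall_mem (List.range (d + 1)) fun k =>
      (QFDef.eq (y.join (List.range (k + 1))) y).imp
        (QFDef.eq ((x.pc k).sdiff y) ((x.pc k).sdiff (y.pc k)))).and <|
    (QFDef.ne x TmDef.bot).imp <| (QFDef.eq (y.sup x) x).imp <| (QFDef.eq (x.sdiff y) x).imp <|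
      QFDef.exists_mem (List.range (d + 1)) fun k =>
        (QFDef.eq (y.join (List.range k)) y).and (QFDef.ne (x.join (List.range k)) x)
  exact h.of_iff fun M _ v =>
    ⟨fun ⟨h1, h2, h3, h4, h5, h6⟩ => ⟨h1, h2, h3, h4, h5, h6⟩,
      fun ⟨h1, h2, h3, h4, h5, h6⟩ => ⟨h1, h2, h3, h4, h5, h6⟩⟩

namespace IsTCReduct

variable {M : Type} [LSC.Structure M] [CoheytingAlgebra M]

theorem cBot_eq (t : IsTCReduct M) : cBot M = ⊥ := t.bot_eq
theorem cTop_eq (t : IsTCReduct M) : cTop M = ⊤ := t.top_eq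
theorem cSup_eq (t : IsTCReduct M) (a b : M) : cSup a b = a ⊔ b := t.sup_eq a b
theorem cInf_eq (t : IsTCReduct M) (a b : M) : cInf a b = a ⊓ b := t.inf_eq a b
theorem cSdiff_eq (t : IsTCReduct M) (a b : M) : cSdiff a b = a \ b := t.sdiff_eq a b

theorem cJoin_eq (t : IsTCReduct M) (I : List ℕ) (a : M) :
    cJoin I a = I.toFinset.sup fun i => pcMap M i a := by
  induction I with
  | nil => exact t.cBot_eq
  | cons i I ih =>
    rw [List.toFinset_cons, Finset.sup_insert, ← ih]
    exact t.cSup_eq _ _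

theorem cJoin_range_eq_iff (t : IsTCReduct M) (k : ℕ) (a : M) :
    cJoin (List.range k) a = a ↔ DimLt (pcMap M) k a := by
  rw [t.cJoin_eq, List.toFinset_range, DimLt]

end IsTCReduct

theorem exists_coheytingAlgebra (M : Type) [LSC.Structure M]
    (h : ∀ a b c : M, CoheytingAx M a b c) : ∃ _ : CoheytingAlgebra M, IsTCReduct M := by
  let : Max M := ⟨cSup⟩
  let : Min M := ⟨cInf⟩
  let l : Lattice M := Lattice.mk' (fun a b => (h a b a).sup_comm) (fun a b c => (h a b c).sup_assoc)
    (fun a b => (h a b a).inf_comm) (fun a b c => (h a b c).inf_assoc)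
    (fun a b => (h a b a).sup_inf_self) (fun a b => (h a b a).inf_sup_self)
  have hle : ∀ a b : M, a ≤ b ↔ cSup a b = b := fun a b => (sup_eq_right (a := a) (b := b)).symm
  let dl : DistribLattice M :=
    { l with le_sup_inf := fun a b c => (hle _ _).2 (h a b c).distrib }
  let bo : BoundedOrder M :=
    { top := cTop M, bot := cBot M, le_top := fun a => (hle _ _).2 (h a a a).le_top,
      bot_le := fun a => (hle _ _).2 (h a a a).bot_le }
  let : CoheytingAlgebra M := CoheytingAlgebra.ofSDiff cSdiff fun a b c => by
    rw [hle, hle]; exact (h a b c).sdiff_le_iff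
  exact ⟨this, ⟨rfl, rfl, fun _ _ => rfl, fun _ _ => rfl, fun _ _ => rfl⟩⟩

theorem IsTCReduct.coheytingAx {M : Type} [LSC.Structure M] [CoheytingAlgebra M]
    (t : IsTCReduct M) (a b c : M) : CoheytingAx M a b c := by
  constructor <;> simp only [t.cSup_eq, t.cInf_eq, t.cBot_eq, t.cTop_eq, t.cSdiff_eq]
  · exact _root_.sup_comm a b
  · exact _root_.sup_assoc a b c
  · exact _root_.inf_comm a b
  · exact _root_.inf_assoc a b c
  · exact _root_.sup_inf_self
  · exact _root_.inf_sup_self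
  · exact sup_eq_right.2 (le_sup_inf)
  · exact sup_top_eq a
  · exact bot_sup_eq a
  · rw [sup_eq_right, sup_eq_right, _root_.sdiff_le_iff]

/-- For indices above `d` all components vanish and the axioms hold trivially. So each scheme needs
finitely many instances, apart from the vanishing itself. -/
theorem IsTCReduct.isSubscaled_iff {d : ℕ} {M : Type} [LSC.Structure M] [CoheytingAlgebra M]
    (t : IsTCReduct M) : IsSubscaled d (pcMap M) ↔
      (∀ a b : M, SubscaledAx d M a b) ∧ ∀ i, d < i → ∀ a : M, pcMap M i a = cBot M := by
  constructor
  · intro h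
    refine ⟨fun a b => ⟨?_, ?_, ?_, ?_, ?_, ?_⟩, fun i hi a => by rw [h.pc_eq_bot a i hi, t.cBot_eq]⟩
    · exact (t.cJoin_range_eq_iff _ _).2 (h.dimLt_top a)
    · intro I hI k hk
      have hI' : I.toFinset ⊆ Finset.range (d + 1) := fun i hi => by
        have := (List.mem_sublists.1 hI).subset (List.mem_toFinset.1 hi)
        simpa using this
      rw [t.cJoin_eq, t.cBot_eq]
      exact ⟨fun hkI => h.pc_join_of_mem a _ hI' k (by simpa using hkI),
        fun hkI => h.pc_join_of_notMem a _ hI' k (by simpa using hkI)⟩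
    · intro k _ ha hb
      rw [t.cJoin_range_eq_iff] at ha hb
      rw [t.cSup_eq, t.cSup_eq, h.pc_sup_of_dimLt ha hb]
    · intro i _ j _ hij
      rw [t.cJoin_range_eq_iff, t.cInf_eq, ← h.scdim_lt_iff]
      exact h.scdim_inf_lt a i j hij
    · intro k _ hb
      rw [t.cJoin_range_eq_iff] at hb
      rw [t.cSdiff_eq, t.cSdiff_eq, h.pc_sdiff_of_dimLt a hb]
    · intro ha hb hab
      rw [t.cBot_eq] at ha
      rw [t.cSup_eq, sup_eq_right] at hb
      rw [t.cSdiff_eq] at hab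
      obtain ⟨k, hk, h1, h2⟩ :=
        h.scdim_lt_scdim_iff.1 (h.scdim_lt a b ha ((negligible_iff ha).2 ⟨hb, hab⟩))
      exact ⟨k, by simpa [Nat.lt_succ_iff] using hk, (t.cJoin_range_eq_iff _ _).2 h1,
        fun h3 => h2 ((t.cJoin_range_eq_iff _ _).1 h3)⟩
  · rintro ⟨h, h0⟩
    have hj : ∀ a : M, (Finset.range (d + 1)).sup (fun i => pcMap M i a) = a := fun a =>
      (t.cJoin_range_eq_iff _ _).1 (h a a).join_pc
    have h0' : ∀ (a : M) (i : ℕ), d < i → pcMap M i a = ⊥ := fun a i hi => by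
      rw [h0 i hi, t.cBot_eq]
    have hle : ∀ (i : ℕ) (a : M), pcMap M i a ≤ a := by
      intro i a
      by_cases hi : i < d + 1
      · exact (Finset.le_sup (f := fun i => pcMap M i a) (Finset.mem_range.2 hi)).trans (hj a).le
      · rw [h0' a i (by omega)]; exact bot_le
    have hI : ∀ I : Finset ℕ, I ⊆ Finset.range (d + 1) →
        ∃ l ∈ (List.range (d + 1)).sublists, l.toFinset = I := by
      intro I hI
      refine ⟨(List.range (d + 1)).filter (· ∈ I), List.mem_sublists.2 List.filter_sublist, ?_⟩
      ext i
      simp only [List.mem_toFinset, List.mem_filter, List.mem_range, decide_eq_true_eq]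
      exact ⟨fun h => h.2, fun h => ⟨Finset.mem_range.1 (hI h), h⟩⟩
    refine ⟨hj, h0', ?_, ?_, ?_, ?_, ?_, ?_⟩
    · intro a I hId k hk
      by_cases hkd : k < d + 1
      · obtain ⟨l, hl, rfl⟩ := hI I hId
        have := ((h a a).pc_join l hl k (by simpa using hkd)).2 (by simpa using hk)
        rwa [t.cJoin_eq, t.cBot_eq] at this
      · exact h0' _ k (by omega)
    · intro a I hId k hk
      obtain ⟨l, hl, rfl⟩ := hI I hId
      have := ((h a a).pc_join l hl k (by simpa using hId hk)).1 (by simpa using hk)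
      rwa [t.cJoin_eq] at this
    · intro a b k hk
      by_cases hkd : k < d + 1
      · have ha := (scdim_le_iff_of_pc_le hle).1 ((le_max_left _ _).trans hk)
        have hb := (scdim_le_iff_of_pc_le hle).1 ((le_max_right _ _).trans hk)
        have := (h a b).pc_sup k (by simpa using hkd) ((t.cJoin_range_eq_iff _ _).2 ha)
          ((t.cJoin_range_eq_iff _ _).2 hb)
        rwa [t.cSup_eq, t.cSup_eq] at this
      · simp [h0' _ k (by omega : d < k)]
    · intro a i j hij
      rw [scdim_lt_iff_of_pc_le hle]
      have hbot : ∀ k, DimLt (pcMap M) k ⊥ := fun k =>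
        le_bot_iff.1 (Finset.sup_le fun i _ => hle i ⊥)
      by_cases hi : i < d + 1
      · by_cases hj : j < d + 1
        · have := (h a a).dim_inf i (by simpa using hi) j (by simpa using hj) hij
          rwa [t.cJoin_range_eq_iff, t.cInf_eq] at this
        · rw [h0' _ j (by omega), inf_bot_eq]; exact hbot _
      · rw [h0' _ i (by omega), bot_inf_eq]; exact hbot _
    · intro a b k hk
      by_cases hkd : k < d + 1
      · have := (h a b).pc_sdiff k (by simpa using hkd)
          ((t.cJoin_range_eq_iff _ _).2 ((scdim_le_iff_of_pc_le hle).1 hk))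
        rwa [t.cSdiff_eq, t.cSdiff_eq] at this
      · simp [h0' _ k (by omega : d < k)]
    · intro a b ha hab
      rw [negligible_iff ha] at hab
      obtain ⟨k, -, h1, h2⟩ := (h a b).dim_lt (by rwa [t.cBot_eq])
        (by rw [t.cSup_eq, sup_eq_right]; exact hab.1) (by rw [t.cSdiff_eq]; exact hab.2)
      rw [t.cJoin_range_eq_iff] at h1
      have h2 : ¬ DimLt (pcMap M) k a := fun h3 => h2 ((t.cJoin_range_eq_iff _ _).2 h3)
      rw [← scdim_lt_iff_of_pc_le hle] at h1 h2
      exact h1.trans_le (not_lt.1 h2)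

theorem subscaledLattice_iff {d : ℕ} {M : Type} [LSC.Structure M] :
    SubscaledLattice d M ↔ (∀ a b c : M, CoheytingAx M a b c) ∧ (∀ a b : M, SubscaledAx d M a b) ∧
      ∀ i, d < i → ∀ a : M, pcMap M i a = cBot M := by
  constructor
  · rintro ⟨_, t, h⟩
    exact ⟨t.coheytingAx, t.isSubscaled_iff.1 h⟩
  · rintro ⟨h1, h2⟩
    obtain ⟨_, t⟩ := exists_coheytingAlgebra M h1
    exact ⟨_, t, t.isSubscaled_iff.2 h2⟩

/-- A structure is a subscaled lattice if any three elements lie in a subscaled lattice. -/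
theorem subscaledLattice_of_local {d : ℕ} {M : Type} [LSC.Structure M]
    (h : ∀ a b c : M, ∃ (N : Type) (_ : LSC.Structure N) (f : N ↪[LSC] M),
      SubscaledLattice d N ∧ a ∈ Set.range f ∧ b ∈ Set.range f ∧ c ∈ Set.range f) :
    SubscaledLattice d M := by
  refine subscaledLattice_iff.2 ⟨fun a b c => ?_, fun a b => ?_, fun i hi a => ?_⟩
  · obtain ⟨N, _, f, hN, ⟨a, rfl⟩, ⟨b, rfl⟩, ⟨c, rfl⟩⟩ := h a b c
    exact (qfDef_coheytingAx.realize_embedding f ![a, b, c]).2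
      ((subscaledLattice_iff.1 hN).1 a b c)
  · obtain ⟨N, _, f, hN, ⟨a, rfl⟩, ⟨b, rfl⟩, -⟩ := h a b a
    exact ((qfDef_subscaledAx d).realize_embedding f ![a, b, a]).2
      ((subscaledLattice_iff.1 hN).2.1 a b)
  · obtain ⟨N, _, f, hN, ⟨a, rfl⟩, -⟩ := h a a a
    rw [← map_pcMap, (subscaledLattice_iff.1 hN).2.2 i hi, map_cBot]

/-- The axioms are quantifier-free conditions on triples of elements, hence inherited by
substructures. -/
theorem SubscaledLattice.of_embedding {d : ℕ} {M N : Type} [LSC.Structure M] [LSC.Structure N]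
    (h : SubscaledLattice d M) (f : N ↪[LSC] M) : SubscaledLattice d N := by
  rw [subscaledLattice_iff] at h ⊢
  refine ⟨fun a b c => ?_, fun a b => ?_, fun i hi a => f.injective ?_⟩
  · exact (qfDef_coheytingAx.realize_embedding f ![a, b, c]).1 (h.1 _ _ _)
  · exact ((qfDef_subscaledAx d).realize_embedding f ![a, b, a]).1 (h.2.1 _ _)
  · rw [map_pcMap, h.2.2 i hi, map_cBot]

/-! ## Subscaled lattices of downsets -/

/-- A poset with a strictly increasing dimension bounded by `d`. -/
structure DimPoset (d : ℕ) where
  carrier : Type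
  [order : PartialOrder carrier]
  dim : carrier → ℕ
  strictMono : StrictMono dim
  dim_le : ∀ x, dim x ≤ d

namespace DimPoset

variable {d : ℕ}

instance : CoeSort (DimPoset d) Type := ⟨carrier⟩

instance (X : DimPoset d) : PartialOrder X := X.order

/-- The lattice of downsets. -/
def Low (X : DimPoset d) : Type := LowerSet X

noncomputable instance (X : DimPoset d) : CoheytingAlgebra X.Low :=
  inferInstanceAs (CoheytingAlgebra (LowerSet X))

instance (X : DimPoset d) : SetLike X.Low X := inferInstanceAs (SetLike (LowerSet X) X)

/-- The downset generated by the maximal `k`-dimensional elements. -/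
def pc (X : DimPoset d) (k : ℕ) (A : X.Low) : X.Low :=
  ⟨pcSet X.dim k (A : Set X), isLowerSet_pcSet _ _ _⟩

noncomputable instance (X : DimPoset d) : LSC.Structure X.Low where
  funMap {n} F x := match n, F with
    | _, ScFunc.bot => ⊥
    | _, ScFunc.top => ⊤
    | _, ScFunc.sup => x 0 ⊔ x 1
    | _, ScFunc.inf => x 0 ⊓ x 1
    | _, ScFunc.sdiff => x 0 \ x 1
    | _, ScFunc.pc i => X.pc i (x 0)
  RelMap R := Empty.elim R

theorem isTCReduct (X : DimPoset d) : IsTCReduct X.Low :=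
  ⟨rfl, rfl, fun _ _ => rfl, fun _ _ => rfl, fun _ _ => rfl⟩

theorem pcMap_eq (X : DimPoset d) : pcMap X.Low = X.pc := rfl

variable {X : DimPoset d} {A B : X.Low} {x : X}

theorem mem_sup : x ∈ A ⊔ B ↔ x ∈ A ∨ x ∈ B := Iff.rfl
theorem mem_top : x ∈ (⊤ : X.Low) := trivial
theorem notMem_bot : x ∉ (⊥ : X.Low) := fun h => h
theorem le_iff : A ≤ B ↔ ∀ x ∈ A, x ∈ B := Iff.rfl
theorem mem_pc {k : ℕ} : x ∈ X.pc k A ↔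
    ∃ i, x ≤ i ∧ i ∈ A ∧ X.dim i = k ∧ ∀ i' ∈ A, i ≤ i' → i' = i := Iff.rfl
theorem lower (A : X.Low) {x y : X} (h : x ≤ y) (hy : y ∈ A) : x ∈ A := A.lower' h hy

theorem low_ext (h : ∀ x, x ∈ A ↔ x ∈ B) : A = B := LowerSet.ext (Set.ext h)

theorem ne_bot_iff : A ≠ ⊥ ↔ ∃ x, x ∈ A := by
  constructor
  · intro h
    by_contra hno
    push Not at hno
    exact h (low_ext fun x => iff_of_false (hno x) notMem_bot)
  · rintro ⟨x, hx⟩ rfl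
    exact hx

theorem mem_sdiff : x ∈ A \ B ↔ ∃ i, x ≤ i ∧ i ∈ A ∧ i ∉ B := by
  set D : X.Low := ⟨sdiffSet (A : Set X) (B : Set X), isLowerSet_sdiffSet _ _⟩ with hD
  have : A \ B = D := by
    apply le_antisymm
    · rw [sdiff_le_iff, le_iff]
      intro x hx
      by_cases hB : x ∈ B
      · exact Or.inl hB
      · exact Or.inr ⟨x, le_rfl, hx, hB⟩
    · rw [le_iff]
      rintro x ⟨i, hxi, hiA, hiB⟩
      have h1 : A ≤ B ⊔ A \ B := le_sup_sdiff
      exact lower _ hxi ((le_iff.1 h1 i hiA).resolve_left hiB)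
  rw [this]
  exact Iff.rfl

theorem mem_finsetSup {ι : Type*} {s : Finset ι} {f : ι → X.Low} :
    x ∈ s.sup f ↔ ∃ i ∈ s, x ∈ f i := by
  classical
  induction s using Finset.induction_on with
  | empty => simpa using notMem_bot
  | insert i s _ ih => rw [Finset.sup_insert, mem_sup, ih]; simp

theorem exists_maximal (hx : x ∈ A) :
    ∃ m, x ≤ m ∧ m ∈ A ∧ ∀ m' ∈ A, m ≤ m' → m' = m := by
  obtain ⟨n, hn⟩ : ∃ n, n = d - X.dim x := ⟨_, rfl⟩
  induction n using Nat.strong_induction_on generalizing x with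
  | _ n ih =>
    by_cases h : ∀ m' ∈ A, x ≤ m' → m' = x
    · exact ⟨x, le_rfl, hx, h⟩
    · push Not at h
      obtain ⟨y, hy, hxy, hne⟩ := h
      have h1 := X.strictMono (lt_of_le_of_ne hxy (Ne.symm hne))
      have h2 := X.dim_le y
      obtain ⟨m, h3, h4⟩ := ih (d - X.dim y) (by omega) hy rfl
      exact ⟨m, hxy.trans h3, h4⟩

theorem pc_le (k : ℕ) (A : X.Low) : X.pc k A ≤ A := fun _ ⟨_, h1, h2, _⟩ => lower A h1 h2

theorem dimLt_iff' {k : ℕ} : DimLt X.pc k A ↔ ∀ x ∈ A, X.dim x < k := by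
  constructor
  · intro h x hx
    rw [← h, mem_finsetSup] at hx
    obtain ⟨i, hi, j, hxj, -, hj, -⟩ := hx
    exact (X.strictMono.monotone hxj).trans_lt (hj ▸ Finset.mem_range.1 hi)
  · intro h
    refine le_antisymm (Finset.sup_le fun i _ => pc_le i A) (le_iff.2 fun x hx => ?_)
    obtain ⟨m, h1, h2, h3⟩ := exists_maximal hx
    rw [mem_finsetSup]
    exact ⟨X.dim m, Finset.mem_range.2 (h m h2), m, h1, h2, rfl, h3⟩

theorem eq_of_dim_le {x y : X} (h : x ≤ y) (hd : X.dim y ≤ X.dim x) : x = y := by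
  by_contra hne
  exact absurd (X.strictMono (lt_of_le_of_ne h hne)) (by omega)

theorem mem_pc_of_dimLt {k : ℕ} (hA : ∀ x ∈ A, X.dim x < k + 1) :
    x ∈ X.pc k A ↔ ∃ i, x ≤ i ∧ i ∈ A ∧ X.dim i = k := by
  rw [mem_pc]
  refine exists_congr fun i => and_congr_right fun _ => and_congr_right fun _ =>
    ⟨fun h => h.1, fun h => ⟨h, fun i' hi' hle => (eq_of_dim_le hle ?_).symm⟩⟩
  have := hA i' hi'
  omega

theorem pc_join (I : Finset ℕ) (k : ℕ) (A : X.Low) :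
    x ∈ X.pc k (I.sup fun i => X.pc i A) ↔ k ∈ I ∧ x ∈ X.pc k A := by
  constructor
  · rintro ⟨i, h1, h2, h3, h4⟩
    obtain ⟨j, hj, m, h5, h6, h7, h8⟩ := mem_finsetSup.1 h2
    have h9 : m = i := h4 m (mem_finsetSup.2 ⟨j, hj, m, le_rfl, h6, h7, h8⟩) h5
    subst h9
    rw [h7] at h3
    subst h3
    exact ⟨hj, m, h1, h6, h7, h8⟩
  · rintro ⟨hk, m, h1, h2, h3, h4⟩
    refine ⟨m, h1, mem_finsetSup.2 ⟨k, hk, m, le_rfl, h2, h3, h4⟩, h3, fun i' hi' hle => ?_⟩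
    obtain ⟨j, -, hj⟩ := mem_finsetSup.1 hi'
    exact h4 i' (pc_le j A hj) hle

/-- If all points of `A` have dimension at most `k`, those of dimension `k` are automatically
maximal; this yields the axioms on joins and differences. A point lying below maximal points of two
different dimensions cannot equal the lower one, which yields the axiom on meets. A negligible `B`
contains no point of maximal dimension of `A`, which yields the last axiom. -/
theorem isSubscaled (X : DimPoset d) : IsSubscaled d X.pc := by
  refine ⟨fun A => dimLt_iff'.2 fun x _ => Nat.lt_succ_of_le (X.dim_le x), fun A i hi => ?_,
    fun A I _ k hk => ?_, fun A I _ k hk => ?_, fun A B k hk => ?_, fun A i j hij => ?_,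
    fun A B k hk => ?_, fun A B hA hB => ?_⟩
  · refine low_ext fun x => iff_of_false ?_ notMem_bot
    rintro ⟨m, -, -, h, -⟩
    have := X.dim_le m
    omega
  · exact low_ext fun x => iff_of_false (fun h => hk ((pc_join I k A).1 h).1) notMem_bot
  · exact low_ext fun x => (pc_join I k A).trans (and_iff_right hk)
  · have hA := dimLt_iff'.1 ((scdim_le_iff_of_pc_le pc_le).1 ((le_max_left _ _).trans hk))
    have hB := dimLt_iff'.1 ((scdim_le_iff_of_pc_le pc_le).1 ((le_max_right _ _).trans hk))
    have hAB : ∀ x ∈ A ⊔ B, X.dim x < k + 1 := fun x hx => hx.elim (hA x) (hB x)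
    refine low_ext fun x => ?_
    rw [mem_sup, mem_pc_of_dimLt hA, mem_pc_of_dimLt hB, mem_pc_of_dimLt hAB]
    constructor
    · rintro ⟨i, h1, h2 | h2, h3⟩
      exacts [Or.inl ⟨i, h1, h2, h3⟩, Or.inr ⟨i, h1, h2, h3⟩]
    · rintro (⟨i, h1, h2, h3⟩ | ⟨i, h1, h2, h3⟩)
      exacts [⟨i, h1, Or.inl h2, h3⟩, ⟨i, h1, Or.inr h2, h3⟩]
  · rw [scdim_lt_iff_of_pc_le pc_le, dimLt_iff']
    rintro x ⟨⟨m, h1, h2, h3, h4⟩, ⟨m', h5, h6, h7, h8⟩⟩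
    have e1 := X.strictMono.monotone h1
    have e2 := X.strictMono.monotone h5
    rcases lt_or_gt_of_ne hij with hlt | hlt
    · rw [min_eq_left hlt.le]
      by_contra hx
      have e3 : x = m := eq_of_dim_le h1 (by omega)
      have e4 : m' = m := h4 m' h6 (e3 ▸ h5)
      rw [e4] at h7
      omega
    · rw [min_eq_right hlt.le]
      by_contra hx
      have e3 : x = m' := eq_of_dim_le h5 (by omega)
      have e4 : m = m' := h8 m h2 (e3 ▸ h1)
      rw [e4] at h3
      omega
  · have hB := dimLt_iff'.1 ((scdim_le_iff_of_pc_le pc_le).1 hk)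
    refine low_ext fun x => ?_
    rw [mem_sdiff, mem_sdiff]
    constructor
    · rintro ⟨i, h1, h2, h3⟩
      exact ⟨i, h1, h2, fun h4 => h3 (pc_le k B h4)⟩
    · rintro ⟨i, h1, ⟨m, h2, h3, h4, h5⟩, h6⟩
      refine ⟨m, h1.trans h2, ⟨m, le_rfl, h3, h4, h5⟩, fun h7 => h6 ?_⟩
      exact (mem_pc_of_dimLt hB).2 ⟨m, h2, h7, h4⟩
  · rw [negligible_iff hA] at hB
    obtain ⟨x, hx⟩ := ne_bot_iff.1 hA
    -- Dimensions are bounded by `d`, so a maximal one is attained in `A` even if `A` is infinite.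
    have hfin : ((fun x => X.dim x) '' (A : Set X)).Finite :=
      (Set.finite_Iic d).subset (by rintro _ ⟨y, -, rfl⟩; exact X.dim_le y)
    obtain ⟨k, ⟨y, hy, rfl⟩, hmax⟩ := hfin.exists_maximal ⟨_, x, hx, rfl⟩
    have hmax' : ∀ z ∈ A, X.dim z ≤ X.dim y := fun z hz => by
      by_contra h
      exact h (hmax ⟨z, hz, rfl⟩ (by simp only; omega))
    have h1 : scdim X.pc B < (X.dim y : WithBot ℕ∞) := by
      rw [scdim_lt_iff_of_pc_le pc_le, dimLt_iff']
      intro z hz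
      have hzA : z ∈ A := hB.1 hz
      rw [← hB.2, mem_sdiff] at hzA
      obtain ⟨i, h1, h2, h3⟩ := hzA
      by_contra h4
      have := hmax' i h2
      rw [eq_of_dim_le h1 (by omega)] at hz
      exact h3 hz
    refine h1.trans_le (not_lt.1 fun h2 => ?_)
    rw [scdim_lt_iff_of_pc_le pc_le, dimLt_iff'] at h2
    exact lt_irrefl _ (h2 y hy)

theorem subscaledLattice (X : DimPoset d) : SubscaledLattice d X.Low :=
  ⟨inferInstance, X.isTCReduct, X.isSubscaled⟩

/-- The embedding of lattices of downsets dual to a morphism. -/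
noncomputable def comap {X Y : DimPoset d} (f : Y → X) (hf : IsScMap Y.dim X.dim f) :
    X.Low ↪[LSC] Y.Low :=
  LSC.mkEmbedding (fun A => ⟨f ⁻¹' (A : Set X), fun _ _ hab hb => lower A (hf.mono hab) hb⟩)
    (fun A B h => low_ext fun x => by
      obtain ⟨y, rfl⟩ := hf.surj x
      have : y ∈ (⟨f ⁻¹' (A : Set X), fun _ _ hab hb => lower A (hf.mono hab) hb⟩ : Y.Low) ↔
        y ∈ (⟨f ⁻¹' (B : Set X), fun _ _ hab hb => lower B (hf.mono hab) hb⟩ : Y.Low) := by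
        simp only at h
        rw [h]
      exact this)
    rfl rfl (fun _ _ => rfl) (fun _ _ => rfl)
    (fun A B => low_ext fun y => by
      change f y ∈ A \ B ↔ y ∈ (_ \ _ : Y.Low)
      rw [mem_sdiff, mem_sdiff]
      constructor
      · rintro ⟨i, h1, h2, h3⟩
        obtain ⟨y', h4, rfl⟩ := hf.lift y i h1
        exact ⟨y', h4, h2, h3⟩
      · rintro ⟨y', h1, h2, h3⟩
        exact ⟨f y', hf.mono h1, h2, h3⟩)
    (fun k A => low_ext fun y => by
      change f y ∈ X.pc k A ↔ y ∈ Y.pc k _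
      have hle : ∀ w, Y.dim w ≤ X.dim (f w) := fun w => by
        obtain ⟨w', h1, -, h3⟩ := hf.dim w
        rw [← h3]; exact Y.strictMono.monotone h1
      constructor
      · rintro ⟨i, h1, h2, h3, h4⟩
        obtain ⟨y', h5, rfl⟩ := hf.lift y i h1
        obtain ⟨y'', h6, h7, h8⟩ := hf.dim y'
        refine ⟨y'', h5.trans h6, show f y'' ∈ A by rwa [h7], h8.trans h3, fun w hw hle' => ?_⟩
        have h9 : f w = f y' := h4 (f w) hw (h7 ▸ hf.mono hle')
        refine (eq_of_dim_le hle' ?_).symm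
        have := hle w
        rw [h9] at this
        omega
      · rintro ⟨m, h1, h2, h3, h4⟩
        refine ⟨f m, hf.mono h1, h2, ?_, fun i' hi' hle' => ?_⟩
        · obtain ⟨m', h5, h6, h7⟩ := hf.dim m
          rw [h4 m' (show f m' ∈ A by rw [h6]; exact h2) h5] at h7
          rw [← h7, h3]
        · obtain ⟨m', h5, rfl⟩ := hf.lift m i' hle'
          rw [h4 m' hi' h5])

theorem mem_comap {X Y : DimPoset d} {f : Y → X} {hf : IsScMap Y.dim X.dim f} {A : X.Low}
    {y : Y} : y ∈ comap f hf A ↔ f y ∈ A := Iff.rfl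

/-! ### The universal cover -/

/-- A node of the tree over `X`: a sequence of labelled elements of `X`, the last one first. -/
@[ext]
structure Node (X : DimPoset d) where
  hd : X × ℕ × Bool
  tl : List (X × ℕ × Bool)
  pairwise : (hd :: tl).Pairwise fun p q => q.1 ≤ p.1 ∧ q.2.1 < p.2.1
  dim_le : ∀ p ∈ hd :: tl, p.2.1 ≤ X.dim p.1

namespace Node

theorem cons_injective {s t : Node X} (h : s.hd :: s.tl = t.hd :: t.tl) : s = t := by
  rw [List.cons.injEq] at h
  exact Node.ext h.1 h.2

/-- Sequences are stored with the last term first, so initial segments are suffixes. The nodes form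
a forest. -/
instance : PartialOrder (Node X) where
  le s t := s.hd :: s.tl <:+ t.hd :: t.tl
  le_refl s := List.suffix_rfl
  le_trans _ _ _ h h' := h.trans h'
  le_antisymm s t h h' := cons_injective (h.eq_of_length (le_antisymm h.length_le h'.length_le))

theorem le_def {s t : Node X} : s ≤ t ↔ s.hd :: s.tl <:+ t.hd :: t.tl := Iff.rfl

theorem le_iff {s t : Node X} : s ≤ t ↔ s = t ∨ s.hd :: s.tl <:+ t.tl := by
  rw [le_def, List.suffix_cons_iff]
  exact or_congr_left ⟨cons_injective, fun h => by rw [h]⟩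

theorem rel_of_mem {s : Node X} {p : X × ℕ × Bool} (h : p ∈ s.tl) :
    p.1 ≤ s.hd.1 ∧ p.2.1 < s.hd.2.1 :=
  (List.pairwise_cons.1 s.pairwise).1 p h

theorem mono {s t : Node X} (h : s ≤ t) : s.hd.1 ≤ t.hd.1 := by
  rcases le_iff.1 h with rfl | h
  · exact le_rfl
  · exact (rel_of_mem (h.subset (by simp))).1

theorem dim_strictMono : StrictMono fun s : Node X => s.hd.2.1 := by
  intro s t h
  rcases le_iff.1 h.le with rfl | h'
  · exact absurd h (lt_irrefl _)
  · exact (rel_of_mem (h'.subset (by simp))).2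

/-- The one-term sequence. -/
def root (p : X × ℕ × Bool) (h : p.2.1 ≤ X.dim p.1) : Node X :=
  ⟨p, [], by simp, by simpa using h⟩

/-- A sequence extended by one term. -/
def snoc (s : Node X) (p : X × ℕ × Bool) (h1 : s.hd.1 ≤ p.1) (h2 : s.hd.2.1 < p.2.1)
    (h : p.2.1 ≤ X.dim p.1) : Node X :=
  ⟨p, s.hd :: s.tl, List.pairwise_cons.2 ⟨fun q hq => by
    rcases List.mem_cons.1 hq with rfl | hq
    · exact ⟨h1, h2⟩
    · exact ⟨(rel_of_mem hq).1.trans h1, (rel_of_mem hq).2.trans h2⟩, s.pairwise⟩, fun q hq => by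
    rcases List.mem_cons.1 hq with rfl | hq
    · exact h
    · exact s.dim_le q hq⟩

theorem le_snoc (s : Node X) (p : X × ℕ × Bool) (h1 h2 h) : s ≤ s.snoc p h1 h2 h :=
  List.suffix_cons _ _

end Node

/-- The poset of nodes. -/
def cover (X : DimPoset d) : DimPoset d where
  carrier := Node X
  dim s := s.hd.2.1
  strictMono := Node.dim_strictMono
  dim_le s := (s.dim_le s.hd (by simp)).trans (X.dim_le _)

/-- The projection of the cover. -/
def coverMap (X : DimPoset d) (s : X.cover) : X := Node.hd s |>.1

/-- The integer label of a node may be smaller than the dimension of the underlying point. Both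
lifting conditions are met by appending one more term whose label is the full dimension. -/
theorem isScMap_coverMap (X : DimPoset d) : IsScMap X.cover.dim X.dim X.coverMap := by
  have hd : ∀ s : Node X, s.hd.2.1 ≤ X.dim s.hd.1 := fun s => s.dim_le s.hd (by simp)
  refine ⟨fun x => ⟨Node.root (x, X.dim x, false) le_rfl, rfl⟩, fun s t h => Node.mono h,
    fun (s : Node X) x h => ?_, fun (s : Node X) => ?_⟩
  · rcases eq_or_lt_of_le h with h | h
    · exact ⟨s, le_rfl, h⟩
    · exact ⟨s.snoc (x, X.dim x, false) h.le ((hd s).trans_lt (X.strictMono h)) le_rfl,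
        s.le_snoc _ _ _ _, rfl⟩
  · rcases eq_or_lt_of_le (hd s) with h | h
    · exact ⟨s, le_rfl, rfl, h⟩
    · exact ⟨s.snoc (s.hd.1, X.dim s.hd.1, false) le_rfl h le_rfl, s.le_snoc _ _ _ _, rfl, rfl⟩

/-- The embedding into the lattice of downsets of the cover. -/
noncomputable def lift (X : DimPoset d) : X.Low ↪[LSC] X.cover.Low :=
  comap X.coverMap X.isScMap_coverMap

theorem pure_iff {k : ℕ} : X.pc k A = A ↔ ∀ x ∈ A, ∃ i, x ≤ i ∧ i ∈ A ∧ X.dim i = k := by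
  constructor
  · intro h x hx
    rw [← h] at hx
    obtain ⟨i, h1, h2, h3, -⟩ := hx
    exact ⟨i, h1, h2, h3⟩
  · intro h
    refine low_ext fun x => ⟨fun hx => pc_le k A hx, fun hx => (mem_pc_of_dimLt ?_).2 (h x hx)⟩
    intro y hy
    obtain ⟨i, h1, -, h3⟩ := h y hy
    exact Nat.lt_succ_of_le (h3 ▸ X.strictMono.monotone h1)

/-- The integer labels are free below the dimension, so nodes over `a` with label `q` exist, and the
downset they generate is `q`-pure. A node over `c` has label at most `r ≤ q`; unless it is already
`q`, it is prolonged by a point of `a` of dimension `p` carrying the label `q`. -/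
theorem cover_catenary (c a : X.Low) (r q p : ℕ) (hrq : r ≤ q) (hqp : q ≤ p) (hca : c ≤ a)
    (ha : a ≠ ⊥) (hc : X.pc r c = c) (hap : X.pc p a = a) :
    ∃ b : X.cover.Low, b ≠ ⊥ ∧ X.cover.pc q b = b ∧ X.lift c ≤ b ∧ b ≤ X.lift a := by
  rw [pure_iff] at hc hap
  set b : X.cover.Low := ⟨{s | ∃ t : Node X, (s : Node X) ≤ t ∧ t.hd.1 ∈ a ∧ t.hd.2.1 = q},
    fun s s' h ⟨t, h1, h2⟩ => ⟨t, le_trans (α := Node X) h h1, h2⟩⟩ with hb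
  refine ⟨b, ne_bot_iff.2 ?_, pure_iff.2 ?_, le_iff.2 fun (s : Node X) hs => ?_,
    le_iff.2 fun (s : Node X) ⟨t, h1, h2, _⟩ => lower a (Node.mono h1) h2⟩
  · obtain ⟨x, hx⟩ := ne_bot_iff.1 ha
    obtain ⟨y, -, hy, hyp⟩ := hap x hx
    refine ⟨Node.root (y, q, false) (by simpa [hyp] using hqp), ?_⟩
    exact ⟨_, le_refl (α := Node X) _, hy, rfl⟩
  · rintro s ⟨t, h1, h2, h3⟩
    exact ⟨t, h1, ⟨t, le_refl (α := Node X) _, h2, h3⟩, h3⟩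
  · have hs : s.hd.1 ∈ c := hs
    obtain ⟨y, h1, h2, h3⟩ := hc _ hs
    obtain ⟨z, h4, h5, h6⟩ := hap y (hca h2)
    have h7 : s.hd.2.1 ≤ q := by
      have h8 := s.dim_le s.hd (by simp)
      have h9 := X.strictMono.monotone h1
      omega
    rcases h7.eq_or_lt with h7 | h7
    · exact ⟨s, le_refl (α := Node X) _, hca hs, h7⟩
    · exact ⟨s.snoc (z, q, false) (h1.trans h4) h7 (by simpa [h6] using hqp), s.le_snoc _ _ _ _,
        h5, rfl⟩

open Classical in
/-- The side on which a node lies in the splitting of a downset along `b₁` and `b₂`. -/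
noncomputable def side (b₁ b₂ : X.Low) : List (X × ℕ × Bool) → Bool
  | [] => false
  | [p] => p.2.2
  | p :: q :: l =>
    if q.1 ∈ b₁ ∧ q.1 ∈ b₂ then p.2.2
    else if q.1 ∈ b₁ then true
    else if q.1 ∈ b₂ then false
    else side b₁ b₂ (q :: l)

/-- The side of a node is inherited from its predecessor unless the predecessor lies in `b₁` or
`b₂`. So initial segments of a node on side `β` stay on that side or lie over the corresponding `b`;
this makes `sideLow` a downset. -/
theorem side_suffix (b₁ b₂ : X.Low) (β : Bool) (p : X × ℕ × Bool) (l : List (X × ℕ × Bool))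
    (hp : (p :: l).Pairwise fun p q => q.1 ≤ p.1 ∧ q.2.1 < p.2.1) (h : side b₁ b₂ (p :: l) = β)
    (q : X × ℕ × Bool) (l' : List (X × ℕ × Bool)) (hq : q :: l' <:+ l) :
    q.1 ∈ cond β b₁ b₂ ∨ (q.1 ∉ b₁ ∧ q.1 ∉ b₂ ∧ side b₁ b₂ (q :: l') = β) := by
  induction l generalizing p with
  | nil => simp at hq
  | cons q₀ l ih =>
    have hp' := (List.pairwise_cons.1 hp).2
    have hle : q.1 ≤ q₀.1 := by
      rcases List.mem_cons.1 (hq.subset (List.mem_cons_self ..)) with rfl | h'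
      · exact le_rfl
      · exact ((List.pairwise_cons.1 hp').1 q h').1
    by_cases h1 : q₀.1 ∈ b₁ <;> by_cases h2 : q₀.1 ∈ b₂
    · left
      cases β
      · exact lower b₂ hle h2
      · exact lower b₁ hle h1
    · rw [side, if_neg (by tauto), if_pos h1] at h
      subst h
      exact Or.inl (lower b₁ hle h1)
    · rw [side, if_neg (by tauto), if_neg h1, if_pos h2] at h
      subst h
      exact Or.inl (lower b₂ hle h2)
    · rw [side, if_neg (by tauto), if_neg h1, if_neg h2] at h
      rcases List.suffix_cons_iff.1 hq with h3 | h3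
      · rw [List.cons.injEq] at h3
        obtain ⟨rfl, rfl⟩ := h3
        exact Or.inr ⟨h1, h2, h⟩
      · exact ih q₀ hp' h h3

/-- One side of the splitting of `a`. -/
noncomputable def sideLow (a b₁ b₂ : X.Low) (β : Bool) : X.cover.Low :=
  ⟨{s | (Node.hd s).1 ∈ cond β b₁ b₂ ∨ ((Node.hd s).1 ∈ a ∧ (Node.hd s).1 ∉ b₁ ∧
      (Node.hd s).1 ∉ b₂ ∧ side b₁ b₂ (Node.hd s :: Node.tl s) = β)}, by
    intro (s : Node X) (t : Node X) hts hs
    rcases hs with h | ⟨h1, h2, h3, h4⟩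
    · exact Or.inl (lower _ (Node.mono hts) h)
    · rcases Node.le_iff.1 hts with rfl | h5
      · exact Or.inr ⟨h1, h2, h3, h4⟩
      · rcases side_suffix b₁ b₂ β _ _ s.pairwise h4 _ _ h5 with h6 | h6
        · exact Or.inl h6
        · exact Or.inr ⟨lower a (Node.mono hts) h1, h6⟩⟩

/-- The Boolean labels distribute the nodes over `a` outside `b₁` and `b₂` between the two sides,
which meet only over `b₁ ⊓ b₂`. A node over that meet is prolonged by a point of `a` outside `b₁`
and `b₂` with label `β`, and this continuation lies on side `β` only. Hence each side is the
difference of `a` and the other. -/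
theorem cover_splitting (b₁ b₂ a : X.Low) (hba : b₁ ⊔ b₂ ≤ a) (hab : a \ (b₁ ⊔ b₂) = a)
    (ha : a ≠ ⊥) :
    ∃ a₁ a₂ : X.cover.Low, a₁ ≠ ⊥ ∧ a₂ ≠ ⊥ ∧ X.lift b₁ ≤ a₁ ∧ X.lift b₂ ≤ a₂ ∧
      a₁ = X.lift a \ a₂ ∧ a₂ = X.lift a \ a₁ ∧ a₁ ⊓ a₂ = X.lift b₁ ⊓ X.lift b₂ := by
  have hup : ∀ x ∈ a, ∃ y, x ≤ y ∧ y ∈ a ∧ y ∉ b₁ ∧ y ∉ b₂ := by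
    intro x hx
    rw [← hab, mem_sdiff] at hx
    obtain ⟨y, h1, h2, h3⟩ := hx
    exact ⟨y, h1, h2, fun h => h3 (Or.inl h), fun h => h3 (Or.inr h)⟩
  have hne : ∀ β, sideLow a b₁ b₂ β ≠ ⊥ := by
    intro β
    obtain ⟨x, hx⟩ := ne_bot_iff.1 ha
    obtain ⟨y, -, h2, h3, h4⟩ := hup x hx
    exact ne_bot_iff.2 ⟨Node.root (y, X.dim y, β) le_rfl, Or.inr ⟨h2, h3, h4, rfl⟩⟩
  have hsub : ∀ β, sideLow a b₁ b₂ β ≤ X.lift a := by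
    rintro β s (h | h)
    · cases β
      · exact hba (Or.inr h)
      · exact hba (Or.inl h)
    · exact h.1
  have hinf : ∀ s : Node X, (show X.cover from s) ∈ sideLow a b₁ b₂ true →
      (show X.cover from s) ∈ sideLow a b₁ b₂ false → s.hd.1 ∈ b₁ ∧ s.hd.1 ∈ b₂ := by
    rintro s (h | h) (h' | h')
    · exact ⟨h, h'⟩
    · exact absurd h h'.2.1
    · exact absurd h' h.2.2.1
    · exact absurd (h.2.2.2.symm.trans h'.2.2.2) (by simp)
  have hsd : ∀ β, sideLow a b₁ b₂ β = X.lift a \ sideLow a b₁ b₂ (!β) := by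
    intro β
    refine low_ext fun (s : Node X) => Iff.trans ?_ (mem_sdiff (X := X.cover) (x := s)).symm
    constructor
    · intro hs
      by_cases hs' : (show X.cover from s) ∈ sideLow a b₁ b₂ (!β)
      · have h1 : s.hd.1 ∈ b₁ ∧ s.hd.1 ∈ b₂ := by
          cases β
          · exact hinf s hs' hs
          · exact hinf s hs hs'
        obtain ⟨y, h2, h3, h4, h5⟩ := hup _ (hsub β hs)
        have h6 : s.hd.1 < y := lt_of_le_of_ne h2 fun e => h4 (e ▸ h1.1)
        refine ⟨s.snoc (y, X.dim y, β) h2 ((s.dim_le s.hd (by simp)).trans_lt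
          (X.strictMono h6)) le_rfl, s.le_snoc _ _ _ _, h3, ?_⟩
        rintro (h | h)
        · cases β
          · exact h4 h
          · exact h5 h
        · have h7 := h.2.2.2
          change side b₁ b₂ ((y, X.dim y, β) :: s.hd :: s.tl) = !β at h7
          rw [side, if_pos h1] at h7
          cases β <;> simp at h7
      · exact ⟨s, le_rfl, hsub β hs, hs'⟩
    · rintro ⟨(t : Node X), h1, h2, h3⟩
      refine lower _ h1 ?_
      have h4 : ∀ γ, t.hd.1 ∈ cond γ b₁ b₂ → γ = β := fun γ hγ => by
        by_contra hne
        exact h3 (Or.inl (by rwa [← Bool.eq_not_of_ne hne]))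
      by_cases h5 : t.hd.1 ∈ b₁
      · have := h4 true h5
        subst this
        exact Or.inl h5
      by_cases h6 : t.hd.1 ∈ b₂
      · have := h4 false h6
        subst this
        exact Or.inl h6
      refine Or.inr ⟨h2, h5, h6, ?_⟩
      by_contra hne
      exact h3 (Or.inr ⟨h2, h5, h6, Bool.eq_not_of_ne hne⟩)
  refine ⟨sideLow a b₁ b₂ true, sideLow a b₁ b₂ false, hne _, hne _, fun s h => Or.inl h,
    fun s h => Or.inl h, hsd true, hsd false, low_ext fun s => ⟨fun h => hinf s h.1 h.2,
      fun h => ⟨Or.inl h.1, Or.inl h.2⟩⟩⟩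

end DimPoset

/-! ## Super scaled lattices: axioms and existence -/

/-- Catenarity, in terms of the operations of the language. -/
def CatenaryAx (d : ℕ) (M : Type) [LSC.Structure M] : Prop :=
  ∀ c a : M, ∀ r ∈ List.range (d + 1), ∀ q ∈ List.range (d + 1), ∀ p ∈ List.range (d + 1),
    r ≤ q → q ≤ p → cSup c a = a → a ≠ cBot M → pcMap M r c = c → pcMap M p a = a →
      ∃ b : M, b ≠ cBot M ∧ pcMap M q b = b ∧ cSup c b = b ∧ cSup b a = a

/-- Splitting, in terms of the operations of the language. -/
def SplittingAx (M : Type) [LSC.Structure M] : Prop :=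
  ∀ b₁ b₂ a : M, cSup (cSup b₁ b₂) a = a → cSdiff a (cSup b₁ b₂) = a → a ≠ cBot M →
    ∃ a₁ a₂ : M, a₁ ≠ cBot M ∧ a₂ ≠ cBot M ∧ cSup b₁ a₁ = a₁ ∧ cSup b₂ a₂ = a₂ ∧
      a₁ = cSdiff a a₂ ∧ a₂ = cSdiff a a₁ ∧ cInf a₁ a₂ = cInf b₁ b₂

theorem IsTCReduct.isCatenary_iff {d : ℕ} {M : Type} [LSC.Structure M] [CoheytingAlgebra M]
    (t : IsTCReduct M) (h : IsSubscaled d (pcMap M)) : IsCatenary (pcMap M) ↔ CatenaryAx d M := by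
  constructor
  · intro hc c a r _ q _ p _ hrq hqp hca ha hrc hpa
    rw [t.cSup_eq, sup_eq_right] at hca
    rw [t.cBot_eq] at ha
    obtain ⟨b, h1, h2, h3, h4⟩ := hc r q p hrq hqp c a hca ha (h.isScPure_iff.2 hrc)
      (h.isScPure_iff.2 hpa)
    refine ⟨b, by rwa [t.cBot_eq], h.isScPure_iff.1 h2, ?_, ?_⟩
    · rw [t.cSup_eq, sup_eq_right]; exact h3
    · rw [t.cSup_eq, sup_eq_right]; exact h4
  · intro hc r q p hrq hqp c a hca ha hrc hpa
    rw [h.isScPure_iff] at hrc hpa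
    have hpd : p ≤ d := h.le_of_pure hpa ha
    obtain ⟨b, h1, h2, h3, h4⟩ := hc c a r (by simp; omega) q (by simp; omega) p (by simp; omega)
      hrq hqp (by rwa [t.cSup_eq, sup_eq_right]) (by rwa [t.cBot_eq]) hrc hpa
    rw [t.cSup_eq, sup_eq_right] at h3 h4
    exact ⟨b, by rwa [t.cBot_eq] at h1, h.isScPure_iff.2 h2, h3, h4⟩

theorem IsTCReduct.hasSplitting_iff {M : Type} [LSC.Structure M] [CoheytingAlgebra M]
    (t : IsTCReduct M) : HasSplitting M ↔ SplittingAx M := by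
  unfold HasSplitting SplittingAx
  simp only [t.cSup_eq, t.cBot_eq, t.cSdiff_eq, t.cInf_eq, sup_eq_right]
  refine forall₃_congr fun b₁ b₂ a => ⟨fun h h1 h2 h3 => h ((negligible_iff h3).2 ⟨h1, h2⟩) h3,
    fun h h1 h3 => h ((negligible_iff h3).1 h1).1 ((negligible_iff h3).1 h1).2 h3⟩

/-- Dimension is monotone, so a bound for `⊤` bounds every element and all components above `d`
vanish. The parameter `e` can therefore always be taken to be `d`. -/
theorem IsSubscaled.of_scdim_top {L : Type*} [CoheytingAlgebra L] {C : ℕ → L → L} {d e : ℕ}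
    (h : IsSubscaled e C) (hd : scdim C (⊤ : L) ≤ (d : WithBot ℕ∞)) : IsSubscaled d C := by
  rw [h.scdim_le_iff] at hd
  have hdim : ∀ a : L, DimLt C (d + 1) a := fun a => h.dimLt_of_le le_top hd
  have h0 : ∀ (a : L) (i : ℕ), d < i → C i a = ⊥ := fun a i hi => h.dimLt_iff.1 (hdim a) i hi
  have hI : ∀ (I : Finset ℕ) (a : L), I.sup (fun i => C i a) =
      (I ∩ Finset.range (e + 1)).sup (fun i => C i a) := by
    intro I a
    apply le_antisymm
    · refine Finset.sup_le fun i hi => ?_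
      by_cases hk : i < e + 1
      · exact Finset.le_sup (f := fun i => C i a) (by simpa [hk] using hi)
      · rw [h.pc_eq_bot a i (by omega)]; exact bot_le
    · exact Finset.sup_mono Finset.inter_subset_left
  refine ⟨hdim, h0, fun a I _ k hk => ?_, fun a I _ k hk => ?_, h.pc_sup, h.scdim_inf_lt,
    h.pc_sdiff, h.scdim_lt⟩
  · rw [hI]
    exact h.pc_join_of_notMem a _ Finset.inter_subset_right k (by simp [hk])
  · by_cases hke : k < e + 1
    · rw [hI]
      exact h.pc_join_of_mem a _ Finset.inter_subset_right k (by simp [hk, hke])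
    · rw [h.pc_eq_bot _ k (by omega), h.pc_eq_bot _ k (by omega)]

theorem superScaledLattice_iff {d : ℕ} {M : Type} [LSC.Structure M] :
    SuperScaledLattice d M ↔ SubscaledLattice d M ∧ CatenaryAx d M ∧ SplittingAx M := by
  constructor
  · rintro ⟨_, t, ⟨e, h⟩, h1, h2, h3⟩
    have h' := h.of_scdim_top h1
    exact ⟨⟨_, t, h'⟩, (t.isCatenary_iff h').1 h2, t.hasSplitting_iff.1 h3⟩
  · rintro ⟨⟨_, t, h⟩, h2, h3⟩
    exact ⟨_, t, ⟨d, h⟩, h.scdim_le_iff.2 (h.dimLt_top _), (t.isCatenary_iff h).2 h2,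
      t.hasSplitting_iff.2 h3⟩

theorem SuperScaledLattice.subscaledLattice {d : ℕ} {M : Type} [LSC.Structure M]
    (h : SuperScaledLattice d M) : SubscaledLattice d M := (superScaledLattice_iff.1 h).1

theorem FODef.exists_sentence {P : ∀ (M : Type) [LSC.Structure M], (Fin 0 → M) → Prop}
    (h : FODef P) {Q : ∀ (M : Type) [LSC.Structure M], Prop}
    (hQ : ∀ (M : Type) [LSC.Structure M], P M default ↔ Q M) :
    ∃ φ : LSC.Sentence, ∀ (M : Type) [LSC.Structure M], M ⊨ φ ↔ Q M := by
  obtain ⟨φ, hφ⟩ := h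
  exact ⟨φ, fun M _ => (hφ M default).trans (hQ M)⟩

theorem exists_sentence_coheytingAx : ∃ φ : LSC.Sentence, ∀ (M : Type) [LSC.Structure M],
    M ⊨ φ ↔ ∀ a b c : M, CoheytingAx M a b c :=
  qfDef_coheytingAx.fo.all.all.all.exists_sentence fun _ _ => Iff.rfl

theorem exists_sentence_subscaledAx (d : ℕ) : ∃ φ : LSC.Sentence,
    ∀ (M : Type) [LSC.Structure M], M ⊨ φ ↔ ∀ a b : M, SubscaledAx d M a b :=
  (qfDef_subscaledAx d).fo.all.all.all.exists_sentence fun M _ =>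
    ⟨fun h a b => h a b (cBot M), fun h a b _ => h a b⟩

theorem FODef.forall_mem {n : ℕ} {ι : Type} (l : List ι)
    {R : ι → ∀ (M : Type) [LSC.Structure M], (Fin n → M) → Prop} (h : ∀ i, FODef (R i)) :
    FODef fun M _ v => ∀ i ∈ l, R i M v := by
  induction l with
  | nil =>
    obtain ⟨φ, -, hφ⟩ := QFDef.false (n := n).not
    exact ⟨φ, fun M _ v => (hφ M v).trans (by simp)⟩
  | cons i l ih =>
    obtain ⟨φ, hφ⟩ := h i
    obtain ⟨ψ, hψ⟩ := ih
    exact ⟨φ ⊓ ψ, fun M _ v => by rw [BoundedFormula.realize_inf, hφ, hψ]; simp⟩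

theorem exists_sentence_catenaryAx (d : ℕ) : ∃ φ : LSC.Sentence,
    ∀ (M : Type) [LSC.Structure M], M ⊨ φ ↔ CatenaryAx d M := by
  have c : TmDef (n := 2) fun _ _ v => v 0 := TmDef.var 0
  have a : TmDef (n := 2) fun _ _ v => v 1 := TmDef.var 1
  have c' : TmDef (n := 3) fun _ _ v => v 0 := TmDef.var 0
  have a' : TmDef (n := 3) fun _ _ v => v 1 := TmDef.var 1
  have b' : TmDef (n := 3) fun _ _ v => v 2 := TmDef.var 2
  have h : FODef (n := 2) _ :=
    FODef.forall_mem (List.range (d + 1)) fun r => FODef.forall_mem (List.range (d + 1)) fun q =>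
    FODef.forall_mem (List.range (d + 1)) fun p =>
      (QFDef.const (r ≤ q)).fo.imp <| (QFDef.const (q ≤ p)).fo.imp <|
      (QFDef.eq (c.sup a) a).fo.imp <| (QFDef.ne a TmDef.bot).fo.imp <|
      (QFDef.eq (c.pc r) c).fo.imp <| (QFDef.eq (a.pc p) a).fo.imp <|
      ((QFDef.ne b' TmDef.bot).and <| (QFDef.eq (b'.pc q) b').and <|
        (QFDef.eq (c'.sup b') b').and (QFDef.eq (b'.sup a') a')).fo.ex
  exact h.all.all.exists_sentence fun _ _ => Iff.rfl

theorem exists_sentence_splittingAx : ∃ φ : LSC.Sentence,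
    ∀ (M : Type) [LSC.Structure M], M ⊨ φ ↔ SplittingAx M := by
  have x : TmDef (n := 3) fun _ _ v => v 0 := TmDef.var 0
  have y : TmDef (n := 3) fun _ _ v => v 1 := TmDef.var 1
  have a : TmDef (n := 3) fun _ _ v => v 2 := TmDef.var 2
  have x' : TmDef (n := 5) fun _ _ v => v 0 := TmDef.var 0
  have y' : TmDef (n := 5) fun _ _ v => v 1 := TmDef.var 1
  have a' : TmDef (n := 5) fun _ _ v => v 2 := TmDef.var 2
  have u : TmDef (n := 5) fun _ _ v => v 3 := TmDef.var 3
  have w : TmDef (n := 5) fun _ _ v => v 4 := TmDef.var 4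
  have h : FODef (n := 3) _ :=
    (QFDef.eq ((x.sup y).sup a) a).fo.imp <| (QFDef.eq (a.sdiff (x.sup y)) a).fo.imp <|
    (QFDef.ne a TmDef.bot).fo.imp <|
    ((QFDef.ne u TmDef.bot).and <| (QFDef.ne w TmDef.bot).and <| (QFDef.eq (x'.sup u) u).and <|
      (QFDef.eq (y'.sup w) w).and <| (QFDef.eq u (a'.sdiff w)).and <|
      (QFDef.eq w (a'.sdiff u)).and <| QFDef.eq (u.inf w) (x'.inf y')).fo.ex.ex
  exact h.all.all.all.exists_sentence fun _ _ => Iff.rfl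

theorem exists_finite_axioms (d : ℕ) : ∃ F : LSC.Theory, F.Finite ∧
    ∀ (M : Type) [LSC.Structure M], SuperScaledLattice d M ↔
      M ⊨ F ∧ ∀ i : ℕ, d < i → ∀ a : M,
        pcMap M i a = Structure.funMap (L := LSC) ScFunc.bot ![] := by
  obtain ⟨φ₁, h₁⟩ := exists_sentence_coheytingAx
  obtain ⟨φ₂, h₂⟩ := exists_sentence_subscaledAx d
  obtain ⟨φ₃, h₃⟩ := exists_sentence_catenaryAx d
  obtain ⟨φ₄, h₄⟩ := exists_sentence_splittingAx
  refine ⟨{φ₁, φ₂, φ₃, φ₄}, Set.toFinite _, fun M _ => ?_⟩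
  rw [superScaledLattice_iff, subscaledLattice_iff, Theory.model_iff]
  simp only [Set.mem_insert_iff, Set.mem_singleton_iff, forall_eq_or_imp, forall_eq, h₁, h₂, h₃, h₄]
  change _ ↔ _ ∧ ∀ i : ℕ, d < i → ∀ a : M, pcMap M i a = cBot M
  tauto

/-- The sentence `∀ x, C^i(x) = 0`. -/
def vanishingSentence (i : ℕ) : LSC.Sentence :=
  BoundedFormula.all (Term.bdEqual (.func (ScFunc.pc i) ![.var (.inr (0 : Fin 1))])
    (.func ScFunc.bot ![]))

theorem realize_vanishingSentence (i : ℕ) (M : Type) [LSC.Structure M] :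
    M ⊨ vanishingSentence i ↔ ∀ a : M, pcMap M i a = cBot M := by
  unfold vanishingSentence Sentence.Realize Formula.Realize
  rw [BoundedFormula.realize_all]
  refine forall_congr' fun a => ?_
  rw [BoundedFormula.realize_bdEqual, Term.realize_func, Term.realize_func, funMap_pc, funMap_bot]
  exact Iff.rfl

/-- The theory is defined semantically, so it could have unintended models. It does not, because the
finitely many axioms and the vanishing sentences belong to it. -/
theorem models_superTheory_iff (d : ℕ) (M : Type) [LSC.Structure M] :
    M ⊨ superTheory d ↔ SuperScaledLattice d M := by
  constructor
  · intro h
    obtain ⟨F, -, hF⟩ := exists_finite_axioms d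
    rw [hF]
    rw [Theory.model_iff] at h ⊢
    refine ⟨fun φ hφ => h φ fun N _ hN => ?_, fun i hi => ?_⟩
    · exact (Theory.model_iff F).1 ((hF N).1 hN).1 φ hφ
    · refine (realize_vanishingSentence i M).1 (h _ fun N _ hN => ?_)
      exact (realize_vanishingSentence i N).2 (((hF N).1 hN).2 i hi)
  · intro h
    exact (Theory.model_iff _).2 fun φ hφ => hφ M h

/-! ### The limit of the iterated covers -/

namespace DimPoset

variable {d : ℕ}

/-- The iterated covers. -/
def tower (X : DimPoset d) : ℕ → DimPoset d
  | 0 => X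
  | n + 1 => (X.tower n).cover

/-- The lattice of downsets of the `n`-th iterated cover. -/
def Level (X : DimPoset d) (n : ℕ) : Type := (X.tower n).Low

noncomputable instance (X : DimPoset d) (n : ℕ) : LSC.Structure (X.Level n) :=
  inferInstanceAs (LSC.Structure (X.tower n).Low)

/-- The embedding of each level into the next one. -/
noncomputable def towerLift (X : DimPoset d) (n : ℕ) :
    (X.tower n).Low ↪[LSC] (X.tower (n + 1)).Low :=
  (X.tower n).lift

/-- The same embedding between the levels as a family of structures. -/
noncomputable def levelEmb (X : DimPoset d) (n : ℕ) : X.Level n ↪[LSC] X.Level (n + 1) :=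
  X.towerLift n

/-- The limit of the lattices of downsets of the iterated covers. -/
abbrev Limit (X : DimPoset d) : Type :=
  Language.DirectLimit X.Level (DirectedSystem.natLERec X.levelEmb)

/-- The embedding of the `n`-th lattice into the limit. -/
noncomputable def ofLevel (X : DimPoset d) (n : ℕ) : (X.tower n).Low ↪[LSC] X.Limit :=
  Language.DirectLimit.of LSC ℕ X.Level (DirectedSystem.natLERec X.levelEmb) n

theorem ofLevel_lift (X : DimPoset d) (n : ℕ) (a : (X.tower n).Low) :
    X.ofLevel (n + 1) (X.towerLift n a) = X.ofLevel n a := by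
  have h : ∀ a : X.Level n, DirectedSystem.natLERec X.levelEmb n (n + 1) (Nat.le_succ n) a
      = X.levelEmb n a := fun a => by
    rw [DirectedSystem.coe_natLERec]
    exact Nat.leRecOn_succ' (C := X.Level) a
  have := Language.DirectLimit.of_f (L := LSC) (ι := ℕ) (G := X.Level)
    (f := DirectedSystem.natLERec X.levelEmb) (hij := Nat.le_succ n) (x := a)
  exact (congrArg _ (h a)).symm.trans this

theorem range_ofLevel_mono (X : DimPoset d) {m n : ℕ} (h : m ≤ n) :
    Set.range (X.ofLevel m) ⊆ Set.range (X.ofLevel n) := by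
  induction n, h using Nat.le_induction with
  | base => exact le_rfl
  | succ n _ ih =>
    refine ih.trans ?_
    rintro _ ⟨a, rfl⟩
    exact ⟨_, X.ofLevel_lift n a⟩

theorem exists_level (X : DimPoset d) (a b c : X.Limit) :
    ∃ n, a ∈ Set.range (X.ofLevel n) ∧ b ∈ Set.range (X.ofLevel n) ∧
      c ∈ Set.range (X.ofLevel n) := by
  obtain ⟨i, a, rfl⟩ := Language.DirectLimit.exists_of (L := LSC) a
  obtain ⟨j, b, rfl⟩ := Language.DirectLimit.exists_of (L := LSC) b
  obtain ⟨k, c, rfl⟩ := Language.DirectLimit.exists_of (L := LSC) c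
  refine ⟨i + j + k, X.range_ofLevel_mono (m := i) (by omega) ⟨a, rfl⟩,
    X.range_ofLevel_mono (m := j) (by omega) ⟨b, rfl⟩,
    X.range_ofLevel_mono (m := k) (by omega) ⟨c, rfl⟩⟩

/-- An instance of Catenarity or Splitting involves elements of a single level `n`, and its
witnesses appear at level `n + 1`. The universal axioms are checked on triples, hence inside one
level. -/
theorem superScaledLattice_limit (X : DimPoset d) : SuperScaledLattice d X.Limit := by
  rw [superScaledLattice_iff]
  refine ⟨subscaledLattice_of_local fun a b c => ?_, ?_, ?_⟩
  · obtain ⟨n, h⟩ := X.exists_level a b c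
    exact ⟨_, _, X.ofLevel n, (X.tower n).subscaledLattice, h⟩
  · intro c a r _ q _ p _ hrq hqp hca ha hrc hpa
    obtain ⟨n, ⟨c, rfl⟩, ⟨a, rfl⟩, -⟩ := X.exists_level c a a
    rw [← map_cSup, (X.ofLevel n).injective.eq_iff] at hca
    rw [← map_cBot (X.ofLevel n), (X.ofLevel n).injective.ne_iff] at ha
    rw [← map_pcMap, (X.ofLevel n).injective.eq_iff] at hrc hpa
    obtain ⟨b, h1, h2, h3, h4⟩ : ∃ b : (X.tower (n + 1)).Low, b ≠ cBot _ ∧ pcMap _ q b = b ∧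
        cSup (X.towerLift n c) b = b ∧ cSup b (X.towerLift n a) = X.towerLift n a := by
      obtain ⟨b, h1, h2, h3, h4⟩ :=
        cover_catenary c a r q p hrq hqp (sup_eq_right.1 hca) ha hrc hpa
      exact ⟨b, h1, h2, sup_eq_right.2 h3, sup_eq_right.2 h4⟩
    refine ⟨X.ofLevel (n + 1) b, ?_, ?_, ?_, ?_⟩
    · rwa [← map_cBot (X.ofLevel (n + 1)), (X.ofLevel (n + 1)).injective.ne_iff]
    · rw [← map_pcMap, h2]
    · rw [← ofLevel_lift, ← map_cSup, h3]
    · rw [← ofLevel_lift X n a, ← map_cSup, h4]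
  · intro b₁ b₂ a hba hab ha
    obtain ⟨n, ⟨b₁, rfl⟩, ⟨b₂, rfl⟩, ⟨a, rfl⟩⟩ := X.exists_level b₁ b₂ a
    rw [← map_cSup, ← map_cSup, (X.ofLevel n).injective.eq_iff] at hba
    rw [← map_cSup, ← map_cSdiff, (X.ofLevel n).injective.eq_iff] at hab
    rw [← map_cBot (X.ofLevel n), (X.ofLevel n).injective.ne_iff] at ha
    obtain ⟨a₁, a₂, h1, h2, h3, h4, h5, h6, h7⟩ : ∃ a₁ a₂ : (X.tower (n + 1)).Low,
        a₁ ≠ cBot _ ∧ a₂ ≠ cBot _ ∧ cSup (X.towerLift n b₁) a₁ = a₁ ∧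
        cSup (X.towerLift n b₂) a₂ = a₂ ∧ a₁ = cSdiff (X.towerLift n a) a₂ ∧
        a₂ = cSdiff (X.towerLift n a) a₁ ∧
        cInf a₁ a₂ = cInf (X.towerLift n b₁) (X.towerLift n b₂) := by
      obtain ⟨a₁, a₂, h1, h2, h3, h4, h5⟩ := cover_splitting b₁ b₂ a (sup_eq_right.1 hba) hab ha
      exact ⟨a₁, a₂, h1, h2, sup_eq_right.2 h3, sup_eq_right.2 h4, h5⟩
    refine ⟨X.ofLevel (n + 1) a₁, X.ofLevel (n + 1) a₂, ?_, ?_, ?_, ?_, ?_, ?_, ?_⟩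
    · rwa [← map_cBot (X.ofLevel (n + 1)), (X.ofLevel (n + 1)).injective.ne_iff]
    · rwa [← map_cBot (X.ofLevel (n + 1)), (X.ofLevel (n + 1)).injective.ne_iff]
    · rw [← ofLevel_lift, ← map_cSup, h3]
    · rw [← ofLevel_lift, ← map_cSup, h4]
    · rw [← ofLevel_lift X n a, ← map_cSdiff, ← h5]
    · rw [← ofLevel_lift X n a, ← map_cSdiff, ← h6]
    · rw [← ofLevel_lift X n b₁, ← ofLevel_lift X n b₂, ← map_cInf, ← map_cInf, h7]

theorem exists_superScaledLattice (X : DimPoset d) :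
    ∃ (M : Type) (_ : LSC.Structure M), SuperScaledLattice d M ∧ Nonempty (X.Low ↪[LSC] M) :=
  ⟨X.Limit, _, X.superScaledLattice_limit, ⟨X.ofLevel 0⟩⟩

end DimPoset

/-! ## Embeddings of finite lattices of downsets -/

namespace DimPoset

variable {d : ℕ} {M : Type} [LSC.Structure M]

theorem mem_joinOf {X : DimPoset d} {J : Type*} [Fintype J] {e : J → X.Low} {A : Set J} {x : X} :
    x ∈ joinOf e A ↔ ∃ i ∈ A, x ∈ e i := by
  rw [joinOf, mem_finsetSup]
  simp

/-- The principal downsets. -/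
def prin {X : DimPoset d} (x : X) : X.Low := ⟨{y | y ≤ x}, fun _ _ hab hb => hab.trans hb⟩

theorem mem_prin {X : DimPoset d} {x y : X} : y ∈ prin x ↔ y ≤ x := Iff.rfl

theorem joinOf_prin {X : DimPoset d} [Fintype X] (A : X.Low) : joinOf prin (A : Set X) = A :=
  low_ext fun x => by
    rw [mem_joinOf]
    exact ⟨fun ⟨_, hi, hx⟩ => lower A hx hi, fun hx => ⟨x, hx, mem_prin.2 le_rfl⟩⟩

section

variable [CoheytingAlgebra M]

/-- The embedding given by a representation. -/
noncomputable def ofRep (t : IsTCReduct M) (h : IsSubscaled d (pcMap M)) {X : DimPoset d}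
    [Fintype X] {e : X → M} (r : IsRep (pcMap M) X.dim e) : X.Low ↪[LSC] M :=
  LSC.mkEmbedding (fun A => joinOf e (A : Set X))
    (fun A B hAB => SetLike.coe_injective
      (r.joinOf_injective (fun _ _ h => lower A h) (fun _ _ h => lower B h) hAB))
    (t.cBot_eq ▸ joinOf_empty e)
    (t.cTop_eq ▸ r.top)
    (fun A B => t.cSup_eq _ _ ▸ joinOf_union e _ _)
    (fun A B => t.cInf_eq _ _ ▸ r.joinOf_inter (fun _ _ h => lower A h) (fun _ _ h => lower B h))
    (fun A B => by
      rw [t.cSdiff_eq, ← r.joinOf_sdiff (fun _ _ h => lower B h)]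
      exact congrArg _ (Set.ext fun x => mem_sdiff))
    (fun k A => r.joinOf_pc h k A)

theorem ofRep_apply (t : IsTCReduct M) (h : IsSubscaled d (pcMap M)) {X : DimPoset d}
    [Fintype X] {e : X → M} (r : IsRep (pcMap M) X.dim e) (A : X.Low) :
    ofRep t h r A = joinOf e (A : Set X) := rfl

variable {X : DimPoset d} (t : IsTCReduct M) (f : X.Low ↪[LSC] M)

include t

theorem emb_bot : f ⊥ = ⊥ := (map_cBot f).trans t.cBot_eq
theorem emb_top : f ⊤ = ⊤ := (map_cTop f).trans t.cTop_eq
theorem emb_sup (A B : X.Low) : f (A ⊔ B) = f A ⊔ f B := (map_cSup f A B).trans (t.cSup_eq _ _)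
theorem emb_inf (A B : X.Low) : f (A ⊓ B) = f A ⊓ f B := (map_cInf f A B).trans (t.cInf_eq _ _)
theorem emb_sdiff (A B : X.Low) : f (A \ B) = f A \ f B :=
  (map_cSdiff f A B).trans (t.cSdiff_eq _ _)

theorem emb_mono {A B : X.Low} (h : A ≤ B) : f A ≤ f B := by
  rw [← sup_eq_right, ← emb_sup t f, sup_eq_right.2 h]

theorem emb_joinOf {J : Type*} [Fintype J] (e : J → X.Low) (A : Set J) :
    f (joinOf e A) = joinOf (fun i => f (e i)) A := by
  classical
  unfold joinOf
  induction Finset.univ.filter (· ∈ A) using Finset.induction_on with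
  | empty => exact emb_bot t f
  | insert i s _ ih => rw [Finset.sup_insert, Finset.sup_insert, emb_sup t f, ih]

theorem emb_eq_joinOf [Fintype X] (A : X.Low) : f A = joinOf (fun x => f (prin x)) (A : Set X) := by
  conv_lhs => rw [← joinOf_prin A]
  exact emb_joinOf t f _ _

/-- An embedding gives a representation. -/
theorem isRep_of_embedding [Fintype X] : IsRep (pcMap M) X.dim fun x => f (prin x) where
  ne_bot x h := by
    rw [← emb_bot t f, f.injective.eq_iff] at h
    exact ne_bot_iff.2 ⟨x, mem_prin.2 le_rfl⟩ h
  pure x := by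
    rw [← map_pcMap, pcMap_eq, pure_iff.2 fun y hy => ⟨x, hy, mem_prin.2 le_rfl, rfl⟩]
  mono x y h := emb_mono t f fun _ hz => le_trans hz h
  disj x y h := by
    rw [← emb_sdiff t f]
    refine congrArg f (low_ext fun z => ?_)
    rw [mem_sdiff]
    exact ⟨fun ⟨i, h1, h2, _⟩ => le_trans h1 h2, fun hz => ⟨x, hz, mem_prin.2 le_rfl, h⟩⟩
  inf_le x y := by
    rw [← emb_inf t f, ← emb_joinOf t f]
    exact emb_mono t f fun z hz => mem_joinOf.2 ⟨z, hz, mem_prin.2 le_rfl⟩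
  top := by
    rw [← emb_top t f, emb_eq_joinOf t f]
    rfl

end

/-- A finite lattice of downsets inside a subscaled lattice extends to one containing a given
element. -/
theorem exists_extension_of_mem (hM : SubscaledLattice d M) {X : DimPoset d} [Fintype X]
    (ε : X.Low ↪[LSC] M) (m : M) :
    ∃ (Y : DimPoset d) (_ : Fintype Y) (f : Y → X) (hf : IsScMap Y.dim X.dim f)
      (ε' : Y.Low ↪[LSC] M) (a : Y.Low),
      Fintype.card Y ≤ genBound (d + 1) (Fintype.card X + 2) 0 ∧
      (∀ A, ε' (comap f hf A) = ε A) ∧ ε' a = m := by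
  classical
  obtain ⟨_, t, h⟩ := hM
  have r₀ := isRep_of_embedding t ε
  set e₀ : X → M := fun x => ε (prin x)
  obtain ⟨J, δ, hcard, r, hJ⟩ := h.exists_isRep (insert m (Finset.univ.image e₀))
  obtain ⟨f, hf, hfe⟩ := r₀.exists_isScMap h r fun x =>
    (hJ (e₀ x) (Finset.mem_insert_of_mem (Finset.mem_image_of_mem _ (Finset.mem_univ x)))).eq_joinOf
  let Y : DimPoset d := ⟨J, δ, r.strictMono h, r.le_dim h⟩
  let _ : Fintype Y := inferInstanceAs (Fintype J)
  have r' : IsRep (pcMap M) Y.dim (Subtype.val : J → M) := r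
  refine ⟨Y, inferInstance, f, hf, ofRep t h r', ⟨{y : J | (y : M) ≤ m}, ?_⟩, ?_, fun A => ?_, ?_⟩
  · exact fun x y hxy hy => le_trans (show (y : M) ≤ x from hxy) hy
  · have h1 : Fintype.card Y = J.card := Fintype.card_coe J
    rw [h1]
    refine hcard.trans (genBound_mono _ (Nat.succ_le_succ ?_) le_rfl)
    refine (Finset.card_insert_le _ _).trans (Nat.succ_le_succ ?_)
    exact Finset.card_image_le
  · rw [emb_eq_joinOf t ε]
    refine le_antisymm (joinOf_le_iff.2 fun y hy => ?_) (joinOf_le_iff.2 fun x hx => ?_)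
    · exact ((hfe (f y) y).2 le_rfl).trans (le_joinOf e₀ (x := f y) hy)
    · have h1 : joinOf Subtype.val {y : J | (y : M) ≤ e₀ x} = e₀ x :=
        (hJ _ (Finset.mem_insert_of_mem (Finset.mem_image_of_mem _ (Finset.mem_univ x)))).eq_joinOf
      refine h1.ge.trans (joinOf_mono (J := J) Subtype.val fun y hy => ?_)
      exact lower A ((hfe x y).1 hy) hx
  · exact (hJ m (Finset.mem_insert_self _ _)).eq_joinOf

/-- The amalgamation property of super scaled lattices. -/
theorem exists_extension_of_isScMap (hM : SuperScaledLattice d M) {X Y : DimPoset d} [Fintype X]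
    [Fintype Y] (ε : X.Low ↪[LSC] M) (f : Y → X) (hf : IsScMap Y.dim X.dim f) :
    ∃ ε' : Y.Low ↪[LSC] M, ∀ A, ε' (comap f hf A) = ε A := by
  obtain ⟨_, t, h⟩ := hM
  obtain ⟨_, h'⟩ := h.subscaled
  have h' := h'.of_scdim_top h.scdim_le
  obtain ⟨e', r', he'⟩ := (isRep_of_embedding t ε).exists_extension h'
    h.splitting h.catenary hf Y.strictMono
  refine ⟨ofRep t h' r', fun A => ?_⟩
  rw [emb_eq_joinOf t ε, ofRep_apply]
  refine le_antisymm (joinOf_le_iff.2 fun y hy => ?_) (joinOf_le_iff.2 fun x hx => ?_)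
  · refine le_trans ?_ (le_joinOf (fun x => ε (prin x)) (x := f y) hy)
    exact (le_joinOf e' (A := {z | f z ≤ f y}) le_rfl).trans (he' (f y)).ge
  · exact (he' x).le.trans (joinOf_mono e' fun y hy => lower A hy hx)

/-- Every subscaled lattice contains a finite lattice of downsets, the one it generates. -/
theorem exists_embedding (hM : SubscaledLattice d M) (s : Finset M) :
    ∃ (X : DimPoset d) (_ : Fintype X) (ε : X.Low ↪[LSC] M),
      Fintype.card X ≤ genBound (d + 1) (s.card + 1) 0 ∧ ∀ m ∈ s, m ∈ Set.range ε := by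
  obtain ⟨_, t, h⟩ := hM
  obtain ⟨J, δ, hcard, r, hJ⟩ := h.exists_isRep s
  let Y : DimPoset d := ⟨J, δ, r.strictMono h, r.le_dim h⟩
  let _ : Fintype Y := inferInstanceAs (Fintype J)
  have r' : IsRep (pcMap M) Y.dim (Subtype.val : J → M) := r
  refine ⟨Y, inferInstance, ofRep t h r', ?_, fun m hm => ⟨⟨{y : J | (y : M) ≤ m}, ?_⟩, ?_⟩⟩
  · have h1 : Fintype.card Y = J.card := Fintype.card_coe J
    rw [h1]
    exact hcard
  · exact fun x y hxy hy => le_trans (show (y : M) ≤ x from hxy) hy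
  · exact (hJ m hm).eq_joinOf

end DimPoset

/-! ## Back and forth -/

/-- Two embeddings of the same structure define a partial equivalence. -/
noncomputable def PartialEquiv.ofEmbeddings {A M N : Type} [LSC.Structure A] [LSC.Structure M]
    [LSC.Structure N] (ε : A ↪[LSC] M) (η : A ↪[LSC] N) : M ≃ₚ[LSC] N :=
  ⟨ε.toHom.range, η.toHom.range, η.equivRange.comp ε.equivRange.symm⟩

theorem PartialEquiv.le_ofEmbeddings {A M N : Type} [LSC.Structure A] [LSC.Structure M]
    [LSC.Structure N] (f : M ≃ₚ[LSC] N) (ε : A ↪[LSC] M) (η : A ↪[LSC] N)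
    (h : ∀ m : f.dom, ∃ a, ε a = m ∧ η a = f.toEquiv m) : f ≤ PartialEquiv.ofEmbeddings ε η := by
  refine ⟨fun m hm => ?_, ?_⟩
  · obtain ⟨a, ha, -⟩ := h ⟨m, hm⟩
    exact ⟨a, ha⟩
  · ext m
    obtain ⟨a, ha, ha'⟩ := h m
    have h1 : (Substructure.inclusion (L := LSC) (S := f.dom)
        (T := (PartialEquiv.ofEmbeddings ε η).dom) (fun m hm => by
          obtain ⟨a, ha, -⟩ := h ⟨m, hm⟩
          exact ⟨a, ha⟩)) m = ε.equivRange a := Subtype.ext ha.symm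
    change ((η.equivRange (ε.equivRange.symm _) : η.toHom.range) : N) = (f.toEquiv m : N)
    erw [h1]
    rw [Language.Equiv.symm_apply_apply, Embedding.equivRange_apply, ha']

/-- The finitely generated domain of `f` is a finite lattice of downsets. Adjoining `m` inside `M`
is dual to an `IsScMap` from a larger finite poset, and the copy in `N` extends along that map. -/
theorem SuperScaledLattice.isExtensionPair {d : ℕ} {M N : Type} [LSC.Structure M]
    [LSC.Structure N] (hM : SuperScaledLattice d M) (hN : SuperScaledLattice d N) :
    LSC.IsExtensionPair M N := by
  classical
  rintro ⟨f, hf⟩ m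
  obtain ⟨S, hS⟩ := id hf
  have hSd : ∀ s ∈ S, s ∈ f.dom := fun s hs => hS ▸ Substructure.subset_closure hs
  obtain ⟨X, _, ε, -, hε⟩ := DimPoset.exists_embedding
    (hM.subscaledLattice.of_embedding f.dom.subtype) (S.attach.image fun s : {x // x ∈ S} => (⟨s.1, hSd s.1 s.2⟩ : f.dom))
  have hr : f.dom ≤ (f.dom.subtype.comp ε).toHom.range := by
    refine hS.ge.trans (Substructure.closure_le.2 fun s hs => ?_)
    obtain ⟨a, ha⟩ := hε ⟨s, hSd s hs⟩ (Finset.mem_image.2 ⟨⟨s, hs⟩, Finset.mem_attach _ _, rfl⟩)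
    exact ⟨a, congrArg Subtype.val ha⟩
  obtain ⟨Y, _, g, hg, ε', a, -, h1, h2⟩ := DimPoset.exists_extension_of_mem
    hM.subscaledLattice (f.dom.subtype.comp ε) m
  obtain ⟨η', h3⟩ := DimPoset.exists_extension_of_isScMap hN
    (f.cod.subtype.comp (f.toEquiv.toEmbedding.comp ε)) g hg
  have : Finite Y.Low := Finite.of_injective (fun A : Y.Low => (A : Set Y)) SetLike.coe_injective
  refine ⟨⟨PartialEquiv.ofEmbeddings ε' η', ?_⟩, ⟨a, h2⟩,
    PartialEquiv.le_ofEmbeddings f ε' η' fun x => ?_⟩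
  · have : Finite ε'.toHom.range := Finite.of_equiv _ ε'.equivRange.toEquiv
    exact Substructure.FG.of_finite (s := ε'.toHom.range)
  · obtain ⟨A, hA⟩ := hr x.2
    have hA' : ε A = x := Subtype.ext hA
    exact ⟨DimPoset.comap g hg A, (h1 A).trans hA, (h3 A).trans (by rw [← hA']; rfl)⟩

theorem SuperScaledLattice.nonempty_equiv {d : ℕ} {M N P : Type} [LSC.Structure M]
    [LSC.Structure N] [LSC.Structure P] [Countable M] [Countable N] [Finite P]
    (hM : SuperScaledLattice d M) (hN : SuperScaledLattice d N) (f : P ↪[LSC] M)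
    (g : P ↪[LSC] N) : Nonempty (M ≃[LSC] N) := by
  have : Finite f.toHom.range := Finite.of_equiv _ f.equivRange.toEquiv
  obtain ⟨e, -⟩ := equiv_between_cg (Structure.cg_of_countable (L := LSC) (M := M))
    (Structure.cg_of_countable (L := LSC) (M := N))
    ⟨PartialEquiv.ofEmbeddings f g, Substructure.FG.of_finite (s := f.toHom.range)⟩
    (hM.isExtensionPair hN) (hN.isExtensionPair hM)
  exact ⟨e⟩

/-! ## Prime subscaled lattices -/

namespace PrimeSubscaledLattice

variable {d : ℕ} {P : Type} [LSC.Structure P]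

theorem range_eq_top (hP : PrimeSubscaledLattice d P) {A : Type} [LSC.Structure A]
    (f : A ↪[LSC] P) : f.toHom.range = ⊤ :=
  hP.2 _ (hP.1.of_embedding (f.toHom.range).subtype)

/-- A prime subscaled lattice is the lattice of downsets of a small poset. -/
theorem exists_equiv (hP : PrimeSubscaledLattice d P) :
    ∃ (X : DimPoset d) (_ : Fintype X), Fintype.card X ≤ genBound (d + 1) 1 0 ∧
      Nonempty (X.Low ≃[LSC] P) := by
  obtain ⟨X, hX, ε, hcard, -⟩ := DimPoset.exists_embedding hP.1 ∅
  refine ⟨X, hX, hcard, ?_⟩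
  have h := hP.range_eq_top ε
  have := ε.equivRange
  rw [h] at this
  exact ⟨Substructure.topEquiv.comp this⟩

theorem finite (hP : PrimeSubscaledLattice d P) : Finite P := by
  obtain ⟨X, _, -, ⟨e⟩⟩ := hP.exists_equiv
  have : Finite X.Low := Finite.of_injective (fun A : X.Low => (A : Set X)) SetLike.coe_injective
  exact Finite.of_equiv _ e.toEquiv

theorem exists_term (hP : PrimeSubscaledLattice d P) (x : P) :
    ∃ t : LSC.Term Empty, t.realize (default : Empty → P) = x := by
  have h : Substructure.closure LSC (∅ : Set P) = ⊤ := hP.2 _ (hP.1.of_embedding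
    (Substructure.subtype _))
  have hx : x ∈ Substructure.closure LSC (∅ : Set P) := h ▸ Substructure.mem_top x
  obtain ⟨t, rfl⟩ := Substructure.mem_closure_iff_exists_term.1 hx
  refine ⟨t.relabel fun x => x.2.elim, ?_⟩
  rw [Term.realize_relabel]
  exact congrArg t.realize (funext fun x => x.2.elim)

end PrimeSubscaledLattice

/-- The substructure generated by the constants is prime. -/
theorem SubscaledLattice.prime_closure {d : ℕ} {M : Type} [LSC.Structure M]
    (h : SubscaledLattice d M) :
    PrimeSubscaledLattice d (Substructure.closure LSC (∅ : Set M)) := by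
  refine ⟨h.of_embedding (Substructure.subtype _), fun S _ => ?_⟩
  have h1 : Substructure.closure LSC (∅ : Set M) ≤ S.map (Substructure.subtype _).toHom :=
    Substructure.closure_le.2 (Set.empty_subset _)
  refine eq_top_iff.2 fun x _ => ?_
  obtain ⟨y, hy, hyx⟩ := h1 x.2
  have : y = x := Subtype.ext hyx
  exact this ▸ hy

/-- Each element of `P` is sent to the value in `M` of a closed term naming it. Agreement of `P` and
`M` on equalities of closed terms makes this injective and compatible with the operations. -/
theorem nonempty_embedding_of_terms {P M : Type} [LSC.Structure P] [LSC.Structure M]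
    (hP : ∀ x : P, ∃ t : LSC.Term Empty, t.realize (default : Empty → P) = x)
    (h : ∀ t u : LSC.Term Empty, t.realize (default : Empty → P) = u.realize default ↔
      t.realize (default : Empty → M) = u.realize default) : Nonempty (P ↪[LSC] M) := by
  choose τ hτ using hP
  refine ⟨⟨⟨fun x => (τ x).realize default, fun x y hxy => ?_⟩, fun {n} F x => ?_,
    fun R => Empty.elim R⟩⟩
  · rw [← hτ x, ← hτ y]
    exact (h _ _).2 hxy
  · have := (h (τ (Structure.funMap F x)) (Term.func F fun i => τ (x i))).1 (by
      rw [hτ, Term.realize_func]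
      exact congrArg _ (funext fun i => (hτ (x i)).symm))
    exact this

/-- Equalities and inequalities between closed terms transfer from `P` to every structure containing
it, so they belong to the theory. As `P` consists of values of closed terms, each model contains a
copy of `P`. -/
theorem models_superTheoryOver_iff {d : ℕ} {P : Type} [LSC.Structure P]
    (hP : PrimeSubscaledLattice d P) (M : Type) [LSC.Structure M] :
    M ⊨ superTheoryOver d P ↔ SuperScaledLattice d M ∧ Nonempty (P ↪[LSC] M) := by
  constructor
  · intro hM
    rw [Theory.model_iff] at hM
    refine ⟨(models_superTheory_iff d M).1 ((Theory.model_iff _).2 fun φ hφ =>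
      hM φ fun N _ hN _ => hφ N hN), nonempty_embedding_of_terms hP.exists_term fun t u => ?_⟩
    have key : ∀ (N : Type) [LSC.Structure N] (f : P ↪[LSC] N),
        t.realize (default : Empty → P) = u.realize default ↔
          t.realize (default : Empty → N) = u.realize default := fun N _ f => by
      rw [← f.injective.eq_iff, ← HomClass.realize_term f, ← HomClass.realize_term f,
        Subsingleton.elim (f ∘ default) default]
    constructor
    · intro h
      have := hM (t.equal u) fun N _ _ ⟨f⟩ => Formula.realize_equal.2 ((key N f).1 h)
      exact Formula.realize_equal.1 this
    · intro h
      by_contra hn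
      have := hM (t.equal u).not fun N _ _ ⟨f⟩ =>
        Formula.realize_not.2 fun h' => hn ((key N f).2 (Formula.realize_equal.1 h'))
      exact Formula.realize_not.1 this (Formula.realize_equal.2 h)
  · rintro ⟨h1, h2⟩
    exact (Theory.model_iff _).2 fun φ hφ => hφ M h1 h2

theorem PrimeSubscaledLattice.exists_model {d : ℕ} {P : Type} [LSC.Structure P]
    (hP : PrimeSubscaledLattice d P) :
    ∃ (M : Type) (_ : LSC.Structure M), SuperScaledLattice d M ∧ Nonempty (P ↪[LSC] M) := by
  obtain ⟨X, -, -, ⟨e⟩⟩ := hP.exists_equiv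
  obtain ⟨M, hM, h1, ⟨f⟩⟩ := X.exists_superScaledLattice
  exact ⟨M, hM, h1, ⟨f.comp e.symm.toEmbedding⟩⟩

theorem nonempty_of_structure (M : Type) [LSC.Structure M] : Nonempty M := ⟨cBot M⟩

theorem models_superTheoryOver_sentence_iff {d : ℕ} {P : Type} [LSC.Structure P]
    (hP : PrimeSubscaledLattice d P) (φ : LSC.Sentence) : superTheoryOver d P ⊨ᵇ φ ↔
      ∀ (M : Type) [LSC.Structure M], SuperScaledLattice d M → Nonempty (P ↪[LSC] M) → M ⊨ φ := by
  rw [Theory.models_sentence_iff]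
  constructor
  · intro h M _ h1 h2
    have : M ⊨ superTheoryOver d P := (models_superTheoryOver_iff hP M).2 ⟨h1, h2⟩
    have := nonempty_of_structure M
    exact h (Theory.ModelType.of _ M)
  · intro h M
    obtain ⟨h1, h2⟩ := (models_superTheoryOver_iff hP M).1 M.is_model
    exact h M h1 h2

theorem models_superTheory_sentence_iff (d : ℕ) (φ : LSC.Sentence) : superTheory d ⊨ᵇ φ ↔
      ∀ (M : Type) [LSC.Structure M], SuperScaledLattice d M → M ⊨ φ := by
  rw [Theory.models_sentence_iff]
  constructor
  · intro h M _ h1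
    have : M ⊨ superTheory d := (models_superTheory_iff d M).2 h1
    have := nonempty_of_structure M
    exact h (Theory.ModelType.of _ M)
  · intro h M
    exact h M ((models_superTheory_iff d M).1 M.is_model)

theorem categorical_superTheoryOver {d : ℕ} {P : Type} [LSC.Structure P]
    (hP : PrimeSubscaledLattice d P) :
    Cardinal.Categorical Cardinal.aleph0.{0} (superTheoryOver d P) := by
  intro M N hM hN
  obtain ⟨h1, ⟨f⟩⟩ := (models_superTheoryOver_iff hP M).1 M.is_model
  obtain ⟨h2, ⟨g⟩⟩ := (models_superTheoryOver_iff hP N).1 N.is_model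
  have := hP.finite
  have : Countable M := Cardinal.mk_le_aleph0_iff.1 hM.le
  have : Countable N := Cardinal.mk_le_aleph0_iff.1 hN.le
  exact h1.nonempty_equiv h2 f g

/-! ## Codes of finite posets with downsets -/

/-- The number of elements of the coded poset. -/
def codeSize (s : ℕ) : ℕ := s.unpair.1

/-- The number of coded downsets. -/
def codeVars (s : ℕ) : ℕ := s.unpair.2.unpair.1

/-- The coded relations: the order (0), the dimension (1), the membership in the downsets (2), and
the graph of a map to another coded poset (3). -/
def codeRel (s τ i j : ℕ) : Prop :=
  s.unpair.2.unpair.2 / 2 ^ Nat.pair τ (Nat.pair i j) % 2 = 1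

/-- A bound on the codes of given size. -/
def codeBound (d N n : ℕ) : ℕ :=
  Nat.pair N (Nat.pair n (2 ^ (Nat.pair 3 (Nat.pair (N + n + d) (N + n + d)) + 1)))

theorem Nat.pair_le_pair' {a b a' b' : ℕ} (ha : a ≤ a') (hb : b ≤ b') :
    Nat.pair a b ≤ Nat.pair a' b' := by
  rcases ha.eq_or_lt with rfl | ha
  · rcases hb.eq_or_lt with rfl | hb
    · exact le_rfl
    · exact (Nat.pair_lt_pair_right _ hb).le
  · rcases hb.eq_or_lt with rfl | hb
    · exact (Nat.pair_lt_pair_left _ ha).le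
    · exact ((Nat.pair_lt_pair_left _ ha).trans (Nat.pair_lt_pair_right _ hb)).le

theorem codeBound_mono (d : ℕ) {N N' n n' : ℕ} (hN : N ≤ N') (hn : n ≤ n') :
    codeBound d N n ≤ codeBound d N' n' :=
  Nat.pair_le_pair' hN (Nat.pair_le_pair' hn (Nat.pow_le_pow_right (by norm_num)
    (Nat.succ_le_succ (Nat.pair_le_pair' le_rfl (Nat.pair_le_pair' (by omega) (by omega))))))

theorem exists_bits (k : ℕ) (Q : ℕ → Prop) :
    ∃ x < 2 ^ k, ∀ p < k, x / 2 ^ p % 2 = 1 ↔ Q p := by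
  classical
  refine ⟨Nat.ofBits fun i : Fin k => decide (Q i), Nat.ofBits_lt_two_pow _, fun p hp => ?_⟩
  have := Nat.testBit_ofBits_lt (fun i : Fin k => decide (Q i)) p hp
  rw [Nat.testBit_eq_decide_div_mod_eq, decide_eq_decide] at this
  exact this

/-- The element of the lattice of downsets given by a downset. -/
def DimPoset.mkLow {d : ℕ} {X : DimPoset d} (A : Set X) (hA : IsLowerSet A) : X.Low := ⟨A, hA⟩

/-- The number `s` is a code of the poset `X` with the downsets `v`, whose elements are numbered
by `π`. -/
structure IsCode {d : ℕ} (s : ℕ) (X : DimPoset d) {n : ℕ} (v : Fin n → X.Low) (π : X → ℕ) :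
    Prop where
  lt : ∀ x, π x < codeSize s
  surj : ∀ i < codeSize s, ∃ x, π x = i
  le : ∀ x y, codeRel s 0 (π x) (π y) ↔ x ≤ y
  dim : ∀ x, ∀ k < d + 1, codeRel s 1 (π x) k ↔ X.dim x = k
  mem : ∀ (k : Fin n) x, codeRel s 2 k (π x) ↔ x ∈ v k
  vars : codeVars s = n

namespace IsCode

variable {d s n : ℕ} {X : DimPoset d} {v : Fin n → X.Low} {π : X → ℕ}

theorem injective (h : IsCode s X v π) : Function.Injective π := fun x y hxy =>
  le_antisymm ((h.le x y).1 (hxy ▸ (h.le x x).2 le_rfl))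
    ((h.le y x).1 (hxy ▸ (h.le x x).2 le_rfl))

theorem size_eq (h : IsCode s X v π) [Fintype X] : codeSize s = Fintype.card X := by
  have := Fintype.card_of_bijective (f := fun x => (⟨π x, h.lt x⟩ : Fin (codeSize s)))
    ⟨fun x y hxy => h.injective (congrArg Fin.val hxy), fun i => by
      obtain ⟨x, hx⟩ := h.surj i i.2
      exact ⟨x, Fin.ext hx⟩⟩
  rw [this, Fintype.card_fin]

end IsCode

theorem exists_isCode {d n : ℕ} (X : DimPoset d) [Fintype X] (v : Fin n → X.Low) (g : X → ℕ) :
    ∃ s < codeBound d (Fintype.card X) n, ∃ π, IsCode s X v π ∧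
      ∀ x, ∀ j < Fintype.card X, codeRel s 3 (π x) j ↔ g x = j := by
  set N := Fintype.card X
  -- One bound for all the numbers in use: elements and values `j` of interest are below `N`,
  -- indices of downsets below `n`, and dimensions at most `d`.
  set R := N + n + d with hR
  let e := Fintype.equivFin X
  obtain ⟨b, hb, hbQ⟩ := exists_bits (Nat.pair 3 (Nat.pair R R) + 1) fun p =>
    (p.unpair.1 = 0 ∧ ∃ x y, (e x : ℕ) = p.unpair.2.unpair.1 ∧ (e y : ℕ) = p.unpair.2.unpair.2 ∧
      x ≤ y) ∨
    (p.unpair.1 = 1 ∧ ∃ x, (e x : ℕ) = p.unpair.2.unpair.1 ∧ X.dim x = p.unpair.2.unpair.2) ∨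
    (p.unpair.1 = 2 ∧ ∃ (k : Fin n) (x : X), (k : ℕ) = p.unpair.2.unpair.1 ∧
      (e x : ℕ) = p.unpair.2.unpair.2 ∧ x ∈ v k) ∨
    (p.unpair.1 = 3 ∧ ∃ x, (e x : ℕ) = p.unpair.2.unpair.1 ∧ g x = p.unpair.2.unpair.2)
  have hpos : ∀ τ i j, τ ≤ 3 → i ≤ R → j ≤ R →
      Nat.pair τ (Nat.pair i j) < Nat.pair 3 (Nat.pair R R) + 1 := fun τ i j h1 h2 h3 =>
    Nat.lt_succ_of_le (Nat.pair_le_pair' h1 (Nat.pair_le_pair' h2 h3))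
  set s := Nat.pair N (Nat.pair n b) with hs
  have hsize : codeSize s = N := by simp [codeSize, hs]
  have hvars : codeVars s = n := by simp [codeVars, hs]
  have he : ∀ x, (e x : ℕ) ≤ R := fun x => by have := (e x).2; omega
  have hinj : ∀ {x y}, (e x : ℕ) = e y ↔ x = y := fun {x y} => by
    rw [← Fin.ext_iff, e.injective.eq_iff]
  have hrel : ∀ τ i j, codeRel s τ i j ↔ b / 2 ^ Nat.pair τ (Nat.pair i j) % 2 = 1 := by
    intro τ i j
    simp [codeRel, hs]
  refine ⟨s, Nat.pair_lt_pair_right _ (Nat.pair_lt_pair_right _ hb), fun x => e x,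
    ⟨fun x => hsize ▸ (e x).2, fun i hi => ⟨e.symm ⟨i, hi.trans_eq hsize⟩, by simp⟩, fun x y => ?_,
      fun x k hk => ?_, fun k x => ?_, hvars⟩, fun x j hj => ?_⟩
  · rw [hrel, hbQ _ (hpos _ _ _ (by omega) (he x) (he y))]
    simp [hinj]
  · rw [hrel, hbQ _ (hpos _ _ _ (by omega) (he x) (by omega))]
    simp [hinj]
  · rw [hrel, hbQ _ (hpos _ _ _ (by omega) (by have := k.2; omega) (he x))]
    simp [hinj, ← Fin.ext_iff]
  · rw [hrel, hbQ _ (hpos _ _ _ le_rfl (he x) (by omega))]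
    simp [hinj]

/-- The number `t` codes an extension of the poset coded by `s`, with one more downset. -/
structure IsStep (d s t : ℕ) : Prop where
  size : codeSize t ≤ genBound (d + 1) (codeSize s + 2) 0
  vars : codeVars t = codeVars s + 1
  refl : ∀ i < codeSize t, codeRel t 0 i i
  trans : ∀ i < codeSize t, ∀ j < codeSize t, ∀ k < codeSize t,
    codeRel t 0 i j → codeRel t 0 j k → codeRel t 0 i k
  antisymm : ∀ i < codeSize t, ∀ j < codeSize t, codeRel t 0 i j → codeRel t 0 j i → i = j
  dim : ∀ i < codeSize t, ∃ k < d + 1, codeRel t 1 i k ∧ ∀ l < d + 1, codeRel t 1 i l → l = k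
  dim_lt : ∀ i < codeSize t, ∀ j < codeSize t, ∀ k < d + 1, ∀ l < d + 1,
    codeRel t 0 i j → i ≠ j → codeRel t 1 i k → codeRel t 1 j l → k < l
  lower : ∀ k < codeVars t, ∀ i < codeSize t, ∀ j < codeSize t,
    codeRel t 0 i j → codeRel t 2 k j → codeRel t 2 k i
  map : ∀ i < codeSize t, ∃ x < codeSize s, codeRel t 3 i x ∧
    ∀ y < codeSize s, codeRel t 3 i y → y = x
  map_surj : ∀ x < codeSize s, ∃ i < codeSize t, codeRel t 3 i x
  map_mono : ∀ i < codeSize t, ∀ j < codeSize t, ∀ x < codeSize s, ∀ y < codeSize s,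
    codeRel t 0 i j → codeRel t 3 i x → codeRel t 3 j y → codeRel s 0 x y
  map_lift : ∀ i < codeSize t, ∀ x < codeSize s, ∀ y < codeSize s,
    codeRel t 3 i x → codeRel s 0 x y → ∃ j < codeSize t, codeRel t 0 i j ∧ codeRel t 3 j y
  map_dim : ∀ i < codeSize t, ∀ x < codeSize s, ∀ k < d + 1, codeRel t 3 i x → codeRel s 1 x k →
    ∃ j < codeSize t, codeRel t 0 i j ∧ codeRel t 3 j x ∧ codeRel t 1 j k
  map_mem : ∀ k < codeVars s, ∀ i < codeSize t, ∀ x < codeSize s,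
    codeRel t 3 i x → (codeRel t 2 k i ↔ codeRel s 2 k x)

/-- Decodes a step into an actual morphism of posets with one more downset, so that a bounded search
meets only genuine extensions. `IsCode.exists_isStep` shows that it meets all those of bounded size.
-/
theorem IsCode.of_isStep {d s t n : ℕ} {X : DimPoset d} {v : Fin n → X.Low} {π : X → ℕ}
    (h : IsCode s X v π) (hst : IsStep d s t) :
    ∃ (Y : DimPoset d) (_ : Fintype Y) (f : Y → X) (hf : IsScMap Y.dim X.dim f) (w : Y.Low)
      (ρ : Y → ℕ), IsCode t Y (Fin.snoc (fun i => DimPoset.comap f hf (v i)) w) ρ := by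
  have hdim : ∀ i : Fin (codeSize t), ∃ k < d + 1, ∀ l < d + 1, codeRel t 1 i l ↔ k = l := fun i => by
    obtain ⟨k, hk, h1, h2⟩ := hst.dim i i.2
    exact ⟨k, hk, fun l hl => ⟨fun hl' => (h2 l hl hl').symm, fun hkl => hkl ▸ h1⟩⟩
  choose δ hδ hδ' using hdim
  have hmap : ∀ i : Fin (codeSize t), ∃ x, ∀ y, codeRel t 3 i (π y) ↔ x = y := fun i => by
    obtain ⟨x, hx, h1, h2⟩ := hst.map i i.2
    obtain ⟨x, rfl⟩ := h.surj x hx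
    exact ⟨x, fun y => ⟨fun hy => (h.injective (h2 _ (h.lt y) hy)).symm, fun hxy => hxy ▸ h1⟩⟩
  choose f hf using hmap
  let _ : PartialOrder (Fin (codeSize t)) :=
    { le := fun i j => codeRel t 0 i j
      lt := fun i j => codeRel t 0 i j ∧ ¬codeRel t 0 j i
      lt_iff_le_not_ge := fun _ _ => Iff.rfl
      le_refl := fun i => hst.refl i i.2
      le_trans := fun i j k => hst.trans i i.2 j j.2 k k.2
      le_antisymm := fun i j h1 h2 => Fin.ext (hst.antisymm i i.2 j j.2 h1 h2) }
  have hsm : StrictMono δ := fun i j hij =>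
    hst.dim_lt i i.2 j j.2 _ (hδ i) _ (hδ j) hij.le (fun h => hij.ne (Fin.ext h))
      ((hδ' i _ (hδ i)).2 rfl) ((hδ' j _ (hδ j)).2 rfl)
  let Y : DimPoset d := ⟨Fin (codeSize t), δ, hsm, fun i => Nat.lt_succ_iff.1 (hδ i)⟩
  let val : Y → ℕ := Fin.val
  let w : Y.Low := DimPoset.mkLow {i : Y | codeRel t 2 n (val i)} fun j i hij hj =>
    hst.lower n (by rw [hst.vars, h.vars]; omega) _ i.2 _ j.2 hij hj
  have hfY : IsScMap (J₁ := Y) Y.dim X.dim f := by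
    refine ⟨fun x => ?_, fun i j hij => ?_, fun i x hx => ?_, fun i => ?_⟩
    · obtain ⟨i, hi, hix⟩ := hst.map_surj _ (h.lt x)
      exact ⟨⟨i, hi⟩, (hf ⟨i, hi⟩ x).1 hix⟩
    · exact (h.le _ _).1 (hst.map_mono i i.2 j j.2 _ (h.lt _) _ (h.lt _) hij
        ((hf i _).2 rfl) ((hf j _).2 rfl))
    · obtain ⟨j, hj, h1, h2⟩ := hst.map_lift i i.2 _ (h.lt _) _ (h.lt _) ((hf i _).2 rfl)
        ((h.le _ _).2 hx)
      exact ⟨⟨j, hj⟩, h1, (hf ⟨j, hj⟩ x).1 h2⟩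
    · obtain ⟨j, hj, h1, h2, h3⟩ := hst.map_dim i i.2 _ (h.lt _) (X.dim (f i))
        (Nat.lt_succ_of_le (X.dim_le _)) ((hf i _).2 rfl)
        ((h.dim _ _ (Nat.lt_succ_of_le (X.dim_le _))).2 rfl)
      exact ⟨⟨j, hj⟩, h1, (hf ⟨j, hj⟩ _).1 h2 |>.symm ▸ rfl,
        (hδ' ⟨j, hj⟩ _ (Nat.lt_succ_of_le (X.dim_le _))).1 h3⟩
  refine ⟨Y, inferInstanceAs (Fintype (Fin (codeSize t))), f, hfY, w, val,
    ⟨fun i => i.2, fun i hi => ⟨⟨i, hi⟩, rfl⟩, fun i j => Iff.rfl, fun i k hk => hδ' i k hk,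
      fun k i => ?_, by rw [hst.vars, h.vars]⟩⟩
  refine Fin.lastCases ?_ (fun k => ?_) k
  · rw [Fin.snoc_last]
    exact Iff.rfl
  · rw [Fin.snoc_castSucc, DimPoset.mem_comap, ← h.mem k]
    exact hst.map_mem k (by rw [h.vars]; exact k.2) i i.2 _ (h.lt _) ((hf i _).2 rfl)

theorem IsCode.exists_isStep {d s n : ℕ} {X : DimPoset d} {v : Fin n → X.Low} {π : X → ℕ}
    (h : IsCode s X v π) {Y : DimPoset d} [Fintype Y] {f : Y → X} (hf : IsScMap Y.dim X.dim f)
    (hY : Fintype.card Y ≤ genBound (d + 1) (codeSize s + 2) 0) (w : Y.Low) :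
    ∃ t < codeBound d (Fintype.card Y) (n + 1), IsStep d s t ∧
      ∃ ρ, IsCode t Y (Fin.snoc (fun i => DimPoset.comap f hf (v i)) w) ρ := by
  classical
  obtain ⟨t, ht, ρ, hρ, hg⟩ := exists_isCode Y
    (Fin.snoc (fun i => DimPoset.comap f hf (v i)) w : Fin (n + 1) → Y.Low) (fun y => π (f y))
  -- The graph of the map is recorded only for values below the size of `Y`. As `f` is surjective,
  -- this includes the numbers of all points of `X`.
  have hle : codeSize s ≤ Fintype.card Y := by
    let _ : Fintype X := Fintype.ofSurjective f hf.surj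
    rw [h.size_eq]
    exact Fintype.card_le_of_surjective f hf.surj
  have hg : ∀ y x, codeRel t 3 (ρ y) (π x) ↔ f y = x := fun y x => by
    rw [hg y _ ((h.lt x).trans_le hle), h.injective.eq_iff]
  have hY' : ∀ {p : ℕ → Prop}, (∀ i < codeSize t, p i) ↔ ∀ y, p (ρ y) := fun {p} =>
    ⟨fun hp y => hp _ (hρ.lt y), fun hp i hi => by obtain ⟨y, rfl⟩ := hρ.surj i hi; exact hp y⟩
  have hX' : ∀ {p : ℕ → Prop}, (∀ i < codeSize s, p i) ↔ ∀ x, p (π x) := fun {p} =>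
    ⟨fun hp y => hp _ (h.lt y), fun hp i hi => by obtain ⟨y, rfl⟩ := h.surj i hi; exact hp y⟩
  refine ⟨t, ht, ?_, ρ, hρ⟩
  constructor
  · rwa [hρ.size_eq]
  · rw [hρ.vars, h.vars]
  · exact hY'.2 fun y => (hρ.le y y).2 le_rfl
  · refine hY'.2 fun x => hY'.2 fun y => hY'.2 fun z => ?_
    rw [hρ.le, hρ.le, hρ.le]
    exact le_trans
  · refine hY'.2 fun x => hY'.2 fun y => ?_
    rw [hρ.le, hρ.le]
    exact fun h1 h2 => congrArg ρ (le_antisymm h1 h2)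
  · refine hY'.2 fun y => ⟨Y.dim y, Nat.lt_succ_of_le (Y.dim_le y),
      (hρ.dim y _ (Nat.lt_succ_of_le (Y.dim_le y))).2 rfl, fun l hl hl' => ((hρ.dim y l hl).1 hl').symm⟩
  · refine hY'.2 fun y => hY'.2 fun z => fun k hk l hl => ?_
    rw [hρ.le, hρ.dim y k hk, hρ.dim z l hl]
    rintro h1 h2 rfl rfl
    exact Y.strictMono (lt_of_le_of_ne h1 fun h => h2 (congrArg ρ h))
  · intro k hk
    refine hY'.2 fun y => hY'.2 fun z => ?_
    rw [hρ.vars] at hk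
    rw [hρ.le, hρ.mem ⟨k, hk⟩, hρ.mem ⟨k, hk⟩]
    exact fun h1 h2 => DimPoset.lower _ h1 h2
  · refine hY'.2 fun y => ⟨π (f y), h.lt _, (hg y _).2 rfl, hX'.2 fun x hx => ?_⟩
    rw [(hg y x).1 hx]
  · refine hX'.2 fun x => ?_
    obtain ⟨y, hy⟩ := hf.surj x
    exact ⟨ρ y, hρ.lt y, (hg y x).2 hy⟩
  · refine hY'.2 fun y => hY'.2 fun z => hX'.2 fun a => hX'.2 fun b => ?_
    rw [hρ.le, hg, hg, h.le]
    rintro h1 rfl rfl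
    exact hf.mono h1
  · refine hY'.2 fun y => hX'.2 fun a => hX'.2 fun b => ?_
    rw [hg, h.le]
    rintro rfl h1
    obtain ⟨z, h2, h3⟩ := hf.lift y b h1
    exact ⟨ρ z, hρ.lt z, (hρ.le y z).2 h2, (hg z b).2 h3⟩
  · refine hY'.2 fun y => hX'.2 fun a => fun k hk => ?_
    rw [hg, h.dim a k hk]
    rintro rfl rfl
    obtain ⟨z, h2, h3, h4⟩ := hf.dim y
    exact ⟨ρ z, hρ.lt z, (hρ.le y z).2 h2, (hg z _).2 h3, (hρ.dim z _ hk).2 h4⟩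
  · intro k hk
    refine hY'.2 fun y => hX'.2 fun a => ?_
    rw [hg]
    rintro rfl
    rw [h.vars] at hk
    have h1 := hρ.mem (Fin.castSucc ⟨k, hk⟩) y
    rw [Fin.snoc_castSucc, DimPoset.mem_comap, ← h.mem] at h1
    exact h1

/-! ## Course-of-values recursion for predicates -/

/-- The list of the first `k` values of the course-of-values recursion given by `g`. -/
def evalTable (g : List Bool → Bool) : ℕ → List Bool
  | 0 => []
  | k + 1 => evalTable g k ++ [g (evalTable g k)]

theorem length_evalTable (g : List Bool → Bool) (k : ℕ) : (evalTable g k).length = k := by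
  induction k with
  | zero => rfl
  | succ k ih => simp [evalTable, ih]

theorem getD_evalTable (g : List Bool → Bool) {j k : ℕ} (h : j < k) :
    (evalTable g k).getD j false = g (evalTable g j) := by
  induction k with
  | zero => omega
  | succ k ih =>
    rw [evalTable]
    rcases (Nat.lt_succ_iff.1 h).eq_or_lt with rfl | h
    · rw [List.getD_append_right _ _ _ _ (length_evalTable g j).le, length_evalTable]
      simp
    · rw [List.getD_append _ _ _ _ ((length_evalTable g k).symm ▸ h), ih h]

open Classical in
/-- The step of the recursion `recPred`, applied to the list of the earlier values. -/
noncomputable def recStep (G : ℕ → ℕ → (ℕ → ℕ → Prop) → Prop) (M : ℕ) (l : List Bool) : Bool :=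
  decide (G (l.length / M) (l.length % M) fun c b => l.getD (c * M + b) false = true)

/-- The predicate `R c b` for `b < M` that is equivalent to `G c b R`, where `G` depends only on the
values of `R` at smaller `c`. -/
def recPred (G : ℕ → ℕ → (ℕ → ℕ → Prop) → Prop) (M c b : ℕ) : Prop :=
  recStep G M (evalTable (recStep G M) (c * M + b)) = true

/-- The pairs with second entry below `M` are listed in lexicographic order, `(c, b)` at position `c
* M + b`; so all values with smaller first entry are already in the table when `(c, b)` is reached.
`R` reads off the table, and nothing is claimed about its other values. -/
theorem recPred_iff (G : ℕ → ℕ → (ℕ → ℕ → Prop) → Prop) {M b : ℕ} (hb : b < M) (c : ℕ) :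
    ∃ R : ℕ → ℕ → Prop, (∀ c' < c, ∀ b' < M, (R c' b' ↔ recPred G M c' b')) ∧
      (recPred G M c b ↔ G c b R) := by
  refine ⟨fun c' b' => (evalTable (recStep G M) (c * M + b)).getD (c' * M + b') false = true,
    fun c' hc b' hb' => ?_, ?_⟩
  · refine iff_of_eq (congrArg (· = true) (getD_evalTable _ ?_))
    calc c' * M + b' < (c' + 1) * M := by rw [Nat.succ_mul]; omega
      _ ≤ c * M := Nat.mul_le_mul_right M hc
      _ ≤ _ := Nat.le_add_right _ _
  · have h1 : (c * M + b) / M = c := by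
      rw [Nat.add_comm, Nat.add_mul_div_right _ _ (by omega), Nat.div_eq_of_lt hb, Nat.zero_add]
    have h2 : (c * M + b) % M = b := by
      rw [Nat.add_comm, Nat.add_mul_mod_self_right, Nat.mod_eq_of_lt hb]
    refine (@decide_eq_true_iff _ (_)).trans ?_
    rw [length_evalTable, h1, h2]

theorem Nat.lt_pair_of_le {a b c : ℕ} (ha : 1 ≤ a) (h : c ≤ b) : c < Nat.pair a b := by
  have := Nat.add_le_pair a b
  omega

/-! ## Evaluation of terms and formulas in coded posets -/

/-- The recursion step for the membership of `j` in the value of the term with code `c`. -/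
def TermStep (d s c j : ℕ) (R : ℕ → ℕ → Prop) : Prop :=
  (c.unpair.1 = 0 ∧ codeRel s 2 c.unpair.2 j) ∨ c.unpair.1 = 2 ∨
  (c.unpair.1 = 3 ∧ (R c.unpair.2.unpair.1 j ∨ R c.unpair.2.unpair.2 j)) ∨
  (c.unpair.1 = 4 ∧ (R c.unpair.2.unpair.1 j ∧ R c.unpair.2.unpair.2 j)) ∨
  (c.unpair.1 = 5 ∧ ∃ i < codeSize s, codeRel s 0 j i ∧ R c.unpair.2.unpair.1 i ∧
    ¬R c.unpair.2.unpair.2 i) ∨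
  (c.unpair.1 = 6 ∧ c.unpair.2.unpair.1 < d + 1 ∧ ∃ i < codeSize s, codeRel s 0 j i ∧
    R c.unpair.2.unpair.2 i ∧ codeRel s 1 i c.unpair.2.unpair.1 ∧
    ∀ k < codeSize s, R c.unpair.2.unpair.2 k → codeRel s 0 i k → k = i)

/-- The membership of `j` in the value of the term with code `c`. -/
def TermMem (d s c j : ℕ) : Prop := recPred (TermStep d s) (codeSize s) c j

theorem termMem_iff {d s n : ℕ} {X : DimPoset d} {v : Fin n → X.Low} {π : X → ℕ}
    (h : IsCode s X v π) (t : LSC.Term (Empty ⊕ Fin n)) (x : X) :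
    TermMem d s (termCode t) (π x) ↔ x ∈ t.realize (Sum.elim default v : Empty ⊕ Fin n → X.Low) := by
  have hX' : ∀ {p : ℕ → Prop}, (∃ i < codeSize s, p i) ↔ ∃ x, p (π x) := fun {p} =>
    ⟨fun ⟨i, hi, hp⟩ => by obtain ⟨y, rfl⟩ := h.surj i hi; exact ⟨y, hp⟩,
      fun ⟨y, hp⟩ => ⟨_, h.lt y, hp⟩⟩
  have hX : ∀ {p : ℕ → Prop}, (∀ i < codeSize s, p i) ↔ ∀ x, p (π x) := fun {p} =>
    ⟨fun hp y => hp _ (h.lt y), fun hp i hi => by obtain ⟨y, rfl⟩ := h.surj i hi; exact hp y⟩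
  induction t generalizing x with
  | var i =>
    rcases i with i | i
    · exact i.elim
    obtain ⟨R, -, h2⟩ := recPred_iff (TermStep d s) (h.lt x) (termCode (.var (.inr i) :
      LSC.Term (Empty ⊕ Fin n)))
    rw [TermMem, h2]
    simp [TermStep, termCode, h.mem]
  | @func l F ts ih =>
    obtain ⟨R, h1, h2⟩ := recPred_iff (TermStep d s) (h.lt x) (termCode (Term.func F ts))
    have key : ∀ i, termCode (ts i) < termCode (Term.func F ts) → ∀ y,
        R (termCode (ts i)) (π y) ↔ y ∈ (ts i).realize (Sum.elim default v) := fun i hi y =>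
      (h1 _ hi _ (h.lt y)).trans (ih i y)
    rw [TermMem, h2, Term.realize_func]
    cases F with
    | bot => exact iff_of_false (by simp [TermStep, termCode]) DimPoset.notMem_bot
    | top => exact iff_of_true (by simp [TermStep, termCode]) DimPoset.mem_top
    | sup =>
      have k0 := key 0 (Nat.lt_pair_of_le (by norm_num) (Nat.left_le_pair _ _))
      have k1 := key 1 (Nat.lt_pair_of_le (by norm_num) (Nat.right_le_pair _ _))
      simp only [TermStep, termCode, Nat.unpair_pair, k0, k1]
      simp only [OfNat.ofNat_ne_zero, false_and, true_and, false_or,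
        Nat.reduceEqDiff, or_false]
      exact Iff.rfl
    | inf =>
      have k0 := key 0 (Nat.lt_pair_of_le (by norm_num) (Nat.left_le_pair _ _))
      have k1 := key 1 (Nat.lt_pair_of_le (by norm_num) (Nat.right_le_pair _ _))
      simp only [TermStep, termCode, Nat.unpair_pair, k0, k1]
      simp only [OfNat.ofNat_ne_zero, false_and, true_and, false_or,
        Nat.reduceEqDiff, or_false]
      exact Iff.rfl
    | sdiff =>
      have k0 := key 0 (Nat.lt_pair_of_le (by norm_num) (Nat.left_le_pair _ _))
      have k1 := key 1 (Nat.lt_pair_of_le (by norm_num) (Nat.right_le_pair _ _))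
      simp only [TermStep, termCode, Nat.unpair_pair, hX', k0, k1, h.le]
      simp only [OfNat.ofNat_ne_zero, false_and, true_and, false_or,
        Nat.reduceEqDiff, or_false]
      exact DimPoset.mem_sdiff.symm
    | pc m =>
      have k0 := key 0 (Nat.lt_pair_of_le (by norm_num) (Nat.right_le_pair _ _))
      simp only [TermStep, termCode, Nat.unpair_pair, hX', hX, k0, h.le, h.injective.eq_iff]
      simp only [OfNat.ofNat_ne_zero, false_and, true_and, false_or,
        Nat.reduceEqDiff]
      change _ ↔ x ∈ X.pc m ((ts 0).realize (Sum.elim default v))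
      rw [DimPoset.mem_pc]
      -- The coded dimension relation is only controlled for indices below `d + 1`. Requiring `m < d
      -- + 1` loses nothing, since no point has larger dimension.
      constructor
      · rintro ⟨hm, i, h3, h4, h5, h6⟩
        exact ⟨i, h3, h4, (h.dim i m hm).1 h5, h6⟩
      · rintro ⟨i, h3, h4, rfl, h6⟩
        have := Nat.lt_succ_of_le (X.dim_le i)
        exact ⟨this, i, h3, h4, (h.dim i _ this).2 rfl, h6⟩

/-- The recursion step for the truth of the formula with code `c` at the coded poset `s`, the
quantifiers ranging over the extensions with code less than `M`. -/
def EvalStep (d M c s : ℕ) (R : ℕ → ℕ → Prop) : Prop :=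
  (c.unpair.1 = 1 ∧ ∀ j < codeSize s,
    (TermMem d s c.unpair.2.unpair.1 j ↔ TermMem d s c.unpair.2.unpair.2 j)) ∨
  (c.unpair.1 = 2 ∧ (R c.unpair.2.unpair.1 s → R c.unpair.2.unpair.2 s)) ∨
  (c.unpair.1 = 3 ∧ ∀ t < M, IsStep d s t → R c.unpair.2 t)

/-- The truth of the formula with code `c` at the coded poset `s`. -/
def Eval (d M c s : ℕ) : Prop := recPred (EvalStep d M) M c s

/-- A bound on the sizes of iterated extensions. -/
def sizeBound (d N : ℕ) : ℕ → ℕ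
  | 0 => N
  | k + 1 => genBound (d + 1) (sizeBound d N k + 2) 0

theorem le_genBound (k z : ℕ) : z ≤ genBound (k + 1) z 0 := by
  have : z < 2 ^ z := Nat.lt_two_pow_self
  simp only [genBound, Nat.add_zero]
  omega

theorem sizeBound_mono (d N : ℕ) : Monotone (sizeBound d N) :=
  monotone_nat_of_le_succ fun k => by
    have := le_genBound d (sizeBound d N k + 2)
    simp only [sizeBound]
    omega

/-- Only the quantifier needs an argument. Every element of `A` lies in a one-step extension of the
given finite lattice, of size at most `genBound`; conversely, every coded step is realised in `A`
over `ε` by the extension property. Passing under a quantifier raises `n` by one and lowers the code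
by at least one, so `n + formulaCode φ ≤ K` is preserved and a single bound `M` serves the whole
evaluation. -/
theorem eval_iff {d N K M : ℕ} (hKM : codeBound d (sizeBound d N K) K ≤ M) {A : Type}
    [LSC.Structure A] (hA : SuperScaledLattice d A) {n : ℕ} (φ : LSC.BoundedFormula Empty n)
    (hK : n + formulaCode φ ≤ K) {s : ℕ} {X : DimPoset d} [Fintype X] {v : Fin n → X.Low}
    {π : X → ℕ} (h : IsCode s X v π) (hs : s < M) (hN : codeSize s ≤ sizeBound d N n)
    (ε : X.Low ↪[LSC] A) :
    Eval d M (formulaCode φ) s ↔ φ.Realize default fun i => ε (v i) := by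
  induction φ generalizing s X with
  | falsum =>
    obtain ⟨R, -, h2⟩ := recPred_iff (EvalStep d M) hs (formulaCode (.falsum :
      LSC.BoundedFormula Empty _))
    rw [Eval, h2]
    refine iff_of_false ?_ id
    simp [EvalStep, formulaCode]
  | @equal n t u =>
    obtain ⟨R, -, h2⟩ := recPred_iff (EvalStep d M) hs (formulaCode (.equal t u))
    rw [Eval, h2]
    have hX : ∀ {p : ℕ → Prop}, (∀ i < codeSize s, p i) ↔ ∀ x, p (π x) := fun {p} =>
      ⟨fun hp y => hp _ (h.lt y), fun hp i hi => by obtain ⟨y, rfl⟩ := h.surj i hi; exact hp y⟩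
    simp only [EvalStep, formulaCode, Nat.unpair_pair, hX, termMem_iff h]
    have hv : (Sum.elim default fun i => ε (v i) : Empty ⊕ Fin n → A) =
        ε ∘ (Sum.elim default v : Empty ⊕ Fin n → X.Low) := by
      funext i
      rcases i with i | i
      · exact i.elim
      · rfl
    change _ ↔ t.realize _ = u.realize _
    rw [hv, HomClass.realize_term, HomClass.realize_term, ε.injective.eq_iff]
    simp only [true_and, OfNat.one_ne_ofNat, false_and, or_false]
    exact ⟨fun h => DimPoset.low_ext h, fun h x => h ▸ Iff.rfl⟩
  | rel R _ => exact Empty.elim R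
  | imp φ ψ ih₁ ih₂ =>
    obtain ⟨R, h1, h2⟩ := recPred_iff (EvalStep d M) hs (formulaCode (φ.imp ψ))
    have l1 : formulaCode φ < formulaCode (φ.imp ψ) :=
      Nat.lt_pair_of_le (by norm_num) (Nat.left_le_pair _ _)
    have l2 : formulaCode ψ < formulaCode (φ.imp ψ) :=
      Nat.lt_pair_of_le (by norm_num) (Nat.right_le_pair _ _)
    have k1 := (h1 _ l1 s hs).trans (ih₁ (by omega) h hs hN ε)
    have k2 := (h1 _ l2 s hs).trans (ih₂ (by omega) h hs hN ε)
    rw [Eval, h2, BoundedFormula.realize_imp]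
    simp [EvalStep, formulaCode, k1, k2]
  | @all n φ ih =>
    obtain ⟨R, h1, h2⟩ := recPred_iff (EvalStep d M) hs (formulaCode φ.all)
    have l1 : formulaCode φ < formulaCode φ.all := Nat.lt_pair_of_le (by norm_num) le_rfl
    have hN' : genBound (d + 1) (codeSize s + 2) 0 ≤ sizeBound d N (n + 1) :=
      genBound_mono _ (by omega) le_rfl
    have hv : ∀ {Y : DimPoset d} (f : Y → X) (hf : IsScMap Y.dim X.dim f) (ε' : Y.Low ↪[LSC] A)
        (_ : ∀ B, ε' (DimPoset.comap f hf B) = ε B) (w : Y.Low),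
        (fun i => ε' ((Fin.snoc (fun i => DimPoset.comap f hf (v i)) w : Fin (n + 1) → Y.Low) i)) =
          Fin.snoc (fun i => ε (v i)) (ε' w) := by
      intro Y f hf ε' hε w
      funext i
      refine Fin.lastCases ?_ (fun i => ?_) i
      · rw [Fin.snoc_last, Fin.snoc_last]
      · rw [Fin.snoc_castSucc, Fin.snoc_castSucc, hε]
    have k1 : (∀ t < M, IsStep d s t → R (formulaCode φ) t) ↔
        ∀ a : A, φ.Realize default (Fin.snoc (fun i => ε (v i)) a) := by
      constructor
      · intro hR a
        obtain ⟨Y, _, f, hf, ε', w, hcard, h3, rfl⟩ :=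
          DimPoset.exists_extension_of_mem hA.subscaledLattice ε a
        rw [← h.size_eq] at hcard
        obtain ⟨t, ht, hst, ρ, hρ⟩ := h.exists_isStep hf hcard w
        have htM : t < M := ht.trans_le ((codeBound_mono d ((hcard.trans hN').trans
          (sizeBound_mono d N (by omega))) (by omega)).trans hKM)
        rw [← hv f hf ε' h3 w, ← ih (by omega) hρ htM (by rw [hρ.size_eq]; exact hcard.trans hN')]
        exact (h1 _ l1 t htM).1 (hR t htM hst)
      · intro hr t ht hst
        obtain ⟨Y, _, f, hf, w, ρ, hρ⟩ := h.of_isStep hst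
        obtain ⟨ε', hε⟩ := DimPoset.exists_extension_of_isScMap hA ε f hf
        refine (h1 _ l1 t ht).2 ((ih (by omega) hρ ht (hst.size.trans hN') ε').2 ?_)
        rw [hv f hf ε' hε w]
        exact hr _
    rw [Eval, h2, BoundedFormula.realize_all, ← k1]
    simp [EvalStep, formulaCode]

/-! ## Well-formed codes -/

/-- The recursion step for being the code of a term. -/
def WfTermStep (n c : ℕ) (R : ℕ → ℕ → Prop) : Prop :=
  (c.unpair.1 = 0 ∧ c.unpair.2 < n) ∨ (c.unpair.1 = 1 ∧ c.unpair.2 = 0) ∨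
  (c.unpair.1 = 2 ∧ c.unpair.2 = 0) ∨
  ((c.unpair.1 = 3 ∨ c.unpair.1 = 4 ∨ c.unpair.1 = 5) ∧
    (R c.unpair.2.unpair.1 0 ∧ R c.unpair.2.unpair.2 0)) ∨
  (c.unpair.1 = 6 ∧ R c.unpair.2.unpair.2 0)

/-- The number `c` is the code of a term. -/
def WfTerm (n c : ℕ) : Prop := recPred (fun c _ => WfTermStep n c) 1 c 0

theorem wfTerm_iff (n c : ℕ) : WfTerm n c ↔ ∃ t : LSC.Term (Empty ⊕ Fin n), termCode t = c := by
  induction c using Nat.strong_induction_on with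
  | _ c ih =>
  obtain ⟨R, h1, h2⟩ := recPred_iff (fun c _ => WfTermStep n c) (M := 1) (b := 0) (by norm_num) c
  have key : ∀ c' < c, R c' 0 ↔ ∃ t : LSC.Term (Empty ⊕ Fin n), termCode t = c' := fun c' hc =>
    (h1 c' hc 0 (by norm_num)).trans (ih c' hc)
  rw [WfTerm, h2]
  obtain ⟨τ, x, rfl⟩ : ∃ τ x, c = Nat.pair τ x := ⟨_, _, (Nat.pair_unpair c).symm⟩
  simp only [WfTermStep, Nat.unpair_pair]
  constructor
  · rintro (⟨rfl, hx⟩ | ⟨rfl, rfl⟩ | ⟨rfl, rfl⟩ | ⟨hτ, hx₁, hx₂⟩ | ⟨rfl, hx⟩)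
    · exact ⟨.var (.inr ⟨x, hx⟩), rfl⟩
    · exact ⟨.func ScFunc.bot ![], rfl⟩
    · exact ⟨.func ScFunc.top ![], rfl⟩
    · rw [key _ (Nat.lt_pair_of_le (by omega) (Nat.unpair_left_le _))] at hx₁
      rw [key _ (Nat.lt_pair_of_le (by omega) (Nat.unpair_right_le _))] at hx₂
      obtain ⟨t, ht⟩ := hx₁
      obtain ⟨u, hu⟩ := hx₂
      rcases hτ with rfl | rfl | rfl
      · refine ⟨.func ScFunc.sup ![t, u], ?_⟩
        rw [termCode]
        simp [ht, hu]
      · refine ⟨.func ScFunc.inf ![t, u], ?_⟩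
        rw [termCode]
        simp [ht, hu]
      · refine ⟨.func ScFunc.sdiff ![t, u], ?_⟩
        rw [termCode]
        simp [ht, hu]
    · rw [key _ (Nat.lt_pair_of_le (by omega) (Nat.unpair_right_le _))] at hx
      obtain ⟨t, ht⟩ := hx
      refine ⟨.func (ScFunc.pc x.unpair.1) ![t], ?_⟩
      rw [termCode]
      simp [ht]
  · rintro ⟨t, ht⟩
    rcases t with (e | i) | @⟨l, F, ts⟩
    · exact e.elim
    · simp only [termCode, Nat.pair_eq_pair] at ht
      exact Or.inl ⟨ht.1.symm, ht.2 ▸ i.2⟩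
    · cases F with
      | bot =>
        simp only [termCode, Nat.pair_eq_pair] at ht
        exact Or.inr (Or.inl ⟨ht.1.symm, ht.2.symm⟩)
      | top =>
        simp only [termCode, Nat.pair_eq_pair] at ht
        exact Or.inr (Or.inr (Or.inl ⟨ht.1.symm, ht.2.symm⟩))
      | pc m =>
        simp only [termCode, Nat.pair_eq_pair] at ht
        obtain ⟨rfl, rfl⟩ := ht
        refine Or.inr (Or.inr (Or.inr (Or.inr ⟨rfl, ?_⟩)))
        rw [Nat.unpair_pair]
        exact (key _ (Nat.lt_pair_of_le (by norm_num) (Nat.right_le_pair _ _))).2 ⟨_, rfl⟩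
      | _ =>
        simp only [termCode, Nat.pair_eq_pair] at ht
        obtain ⟨rfl, rfl⟩ := ht
        refine Or.inr (Or.inr (Or.inr (Or.inl ⟨by simp, ?_, ?_⟩))) <;> rw [Nat.unpair_pair]
        · exact (key _ (Nat.lt_pair_of_le (by norm_num) (Nat.left_le_pair _ _))).2 ⟨_, rfl⟩
        · exact (key _ (Nat.lt_pair_of_le (by norm_num) (Nat.right_le_pair _ _))).2 ⟨_, rfl⟩

/-- The recursion step for being the code of a formula in `n` free variables. -/
def WfStep (c n : ℕ) (R : ℕ → ℕ → Prop) : Prop :=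
  (c.unpair.1 = 0 ∧ c.unpair.2 = 0) ∨
  (c.unpair.1 = 1 ∧ WfTerm n c.unpair.2.unpair.1 ∧ WfTerm n c.unpair.2.unpair.2) ∨
  (c.unpair.1 = 2 ∧ R c.unpair.2.unpair.1 n ∧ R c.unpair.2.unpair.2 n) ∨
  (c.unpair.1 = 3 ∧ R c.unpair.2 (n + 1))

/-- The number `c` is the code of a formula in `n < M` free variables. -/
def WfFormula (M c n : ℕ) : Prop := recPred WfStep M c n

/-- Under a quantifier the number of variables rises by one while the code drops, so `n + c < M` is
preserved and the table never needs more than `M` columns. -/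
theorem wfFormula_iff (M c n : ℕ) (hM : n + c < M) :
    WfFormula M c n ↔ ∃ φ : LSC.BoundedFormula Empty n, formulaCode φ = c := by
  induction c using Nat.strong_induction_on generalizing n with
  | _ c ih =>
  obtain ⟨R, h1, h2⟩ := recPred_iff WfStep (M := M) (b := n) (by omega) c
  have key : ∀ c' < c, ∀ m, m ≤ n + 1 →
      (R c' m ↔ ∃ φ : LSC.BoundedFormula Empty m, formulaCode φ = c') := fun c' hc m hm =>
    (h1 c' hc m (by omega)).trans (ih c' hc m (by omega))
  rw [WfFormula, h2]
  obtain ⟨τ, x, rfl⟩ : ∃ τ x, c = Nat.pair τ x := ⟨_, _, (Nat.pair_unpair c).symm⟩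
  simp only [WfStep, Nat.unpair_pair, wfTerm_iff]
  constructor
  · rintro (⟨rfl, rfl⟩ | ⟨rfl, ⟨t, ht⟩, ⟨u, hu⟩⟩ | ⟨rfl, hx₁, hx₂⟩ | ⟨rfl, hx⟩)
    · exact ⟨.falsum, rfl⟩
    · refine ⟨.equal t u, ?_⟩
      rw [formulaCode, ht, hu, Nat.pair_unpair]
    · rw [key _ (Nat.lt_pair_of_le (by omega) (Nat.unpair_left_le _)) _ (by omega)] at hx₁
      rw [key _ (Nat.lt_pair_of_le (by omega) (Nat.unpair_right_le _)) _ (by omega)] at hx₂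
      obtain ⟨φ, hφ⟩ := hx₁
      obtain ⟨ψ, hψ⟩ := hx₂
      refine ⟨.imp φ ψ, ?_⟩
      rw [formulaCode, hφ, hψ, Nat.pair_unpair]
    · rw [key _ (Nat.lt_pair_of_le (by omega) le_rfl) _ (by omega)] at hx
      obtain ⟨φ, hφ⟩ := hx
      exact ⟨.all φ, by rw [formulaCode, hφ]⟩
  · rintro ⟨φ, hφ⟩
    cases φ with
    | falsum =>
      simp only [formulaCode, Nat.pair_eq_pair] at hφ
      exact Or.inl ⟨hφ.1.symm, hφ.2.symm⟩
    | equal t u =>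
      simp only [formulaCode, Nat.pair_eq_pair] at hφ
      obtain ⟨rfl, rfl⟩ := hφ
      refine Or.inr (Or.inl ⟨rfl, ?_⟩)
      rw [Nat.unpair_pair]
      exact ⟨⟨_, rfl⟩, ⟨_, rfl⟩⟩
    | rel R _ => exact Empty.elim R
    | imp φ ψ =>
      simp only [formulaCode, Nat.pair_eq_pair] at hφ
      obtain ⟨rfl, rfl⟩ := hφ
      refine Or.inr (Or.inr (Or.inl ⟨rfl, ?_⟩))
      rw [Nat.unpair_pair]
      exact ⟨(key _ (Nat.lt_pair_of_le (by norm_num) (Nat.left_le_pair _ _)) _ (by omega)).2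
        ⟨_, rfl⟩, (key _ (Nat.lt_pair_of_le (by norm_num) (Nat.right_le_pair _ _)) _ (by omega)).2
        ⟨_, rfl⟩⟩
    | all φ =>
      simp only [formulaCode, Nat.pair_eq_pair] at hφ
      obtain ⟨rfl, rfl⟩ := hφ
      exact Or.inr (Or.inr (Or.inr ⟨rfl,
        (key _ (Nat.lt_pair_of_le (by norm_num) le_rfl) _ (by omega)).2 ⟨_, rfl⟩⟩))

/-! ## Primitive recursiveness -/

section Primrec

variable {α : Type} [Primcodable α]

theorem Primrec.id_fun : Primrec fun a : α => a := Primrec.id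

theorem PrimrecPred.forall_bdd {f : α → ℕ} {p : α → ℕ → Prop} (hf : Primrec f)
    (hp : PrimrecPred fun x : α × ℕ => p x.1 x.2) : PrimrecPred fun a => ∀ i < f a, p a i := by
  have h : PrimrecRel fun (i : ℕ) (a : α) => p a i := hp.comp (Primrec.snd.pair Primrec.fst)
  exact (h.forall_mem_list.comp (Primrec.list_range.comp hf) Primrec.id_fun).of_eq fun a => by simp

theorem PrimrecPred.exists_bdd {f : α → ℕ} {p : α → ℕ → Prop} (hf : Primrec f)
    (hp : PrimrecPred fun x : α × ℕ => p x.1 x.2) : PrimrecPred fun a => ∃ i < f a, p a i := by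
  have h : PrimrecRel fun (i : ℕ) (a : α) => p a i := hp.comp (Primrec.snd.pair Primrec.fst)
  exact (h.exists_mem_list.comp (Primrec.list_range.comp hf) Primrec.id_fun).of_eq fun a => by simp

theorem PrimrecPred.imp {p q : α → Prop} (hp : PrimrecPred p) (hq : PrimrecPred q) :
    PrimrecPred fun a => p a → q a :=
  (hp.not.or hq).of_eq fun _ => imp_iff_not_or.symm

theorem PrimrecPred.iff {p q : α → Prop} (hp : PrimrecPred p) (hq : PrimrecPred q) :
    PrimrecPred fun a => (p a ↔ q a) :=
  ((hp.imp hq).and (hq.imp hp)).of_eq fun _ => iff_iff_implies_and_implies.symm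

theorem Primrec.nat_pow : Primrec₂ ((· ^ ·) : ℕ → ℕ → ℕ) :=
  Primrec₂.unpaired'.1 Nat.Primrec.pow

theorem PrimrecPred.codeRel {s τ i j : α → ℕ} (hs : Primrec s) (hτ : Primrec τ) (hi : Primrec i)
    (hj : Primrec j) : PrimrecPred fun a => codeRel (s a) (τ a) (i a) (j a) := by
  have h1 := Primrec.snd.comp (Primrec.unpair.comp (Primrec.snd.comp (Primrec.unpair.comp hs)))
  have h2 := Primrec.nat_pow.comp (Primrec.const (α := α) 2)
    (Primrec₂.natPair.comp hτ (Primrec₂.natPair.comp hi hj))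
  exact Primrec.eq.comp (Primrec.nat_mod.comp (Primrec.nat_div.comp h1 h2) (Primrec.const 2))
    (Primrec.const 1)

theorem Primrec.codeSize {s : α → ℕ} (hs : Primrec s) : Primrec fun a => codeSize (s a) :=
  Primrec.fst.comp (Primrec.unpair.comp hs)

theorem Primrec.codeVars {s : α → ℕ} (hs : Primrec s) : Primrec fun a => codeVars (s a) :=
  Primrec.fst.comp (Primrec.unpair.comp (Primrec.snd.comp (Primrec.unpair.comp hs)))

theorem Primrec.genBound (k : ℕ) {z y : α → ℕ} (hz : Primrec z) (hy : Primrec y) :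
    Primrec fun a => genBound k (z a) (y a) := by
  induction k generalizing z y with
  | zero => exact Primrec.const 0
  | succ k ih =>
    have hp := Primrec.nat_pow.comp (Primrec.const (α := α) 2) (Primrec.nat_add.comp hz hy)
    exact Primrec.nat_add.comp hp (ih (Primrec.nat_add.comp (Primrec.nat_add.comp hz
      (Primrec.nat_mul.comp hp hp)) (Primrec.nat_mul.comp hp hy)) (Primrec.nat_add.comp hy hp))

/-- The table is a list of Booleans built by primitive recursion. It suffices that the step, with
`R` replaced by lookup in the list, is primitive recursive. -/
theorem PrimrecPred.recPred {G : α → ℕ → ℕ → (ℕ → ℕ → Prop) → Prop} {M c b : α → ℕ}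
    (hM : Primrec M) (hG : PrimrecPred fun x : α × List Bool =>
      G x.1 (x.2.length / M x.1) (x.2.length % M x.1)
        fun c b => x.2.getD (c * M x.1 + b) false = true)
    (hc : Primrec c) (hb : Primrec b) :
    PrimrecPred fun a => recPred (G a) (M a) (c a) (b a) := by
  classical
  have h1 : Primrec₂ fun (a : α) (l : List Bool) => recStep (G a) (M a) l :=
    hG.decide.of_eq fun x => by
      unfold recStep
      congr 1
  have h2 : Primrec₂ fun (a : α) (k : ℕ) => evalTable (recStep (G a) (M a)) k := by
    have h := Primrec.nat_rec (f := fun _ : α => ([] : List Bool))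
      (g := fun a p => p.2 ++ [recStep (G a) (M a) p.2]) (Primrec.const [])
      (Primrec.list_concat.comp (Primrec.snd.comp Primrec.snd)
        (h1.comp Primrec.fst (Primrec.snd.comp Primrec.snd)))
    refine h.of_eq fun a k => ?_
    induction k with
    | zero => rfl
    | succ k ih => simp only [evalTable, ← ih]
  exact Primrec.eq.comp (h1.comp Primrec.id (h2.comp Primrec.id
    (Primrec.nat_add.comp (Primrec.nat_mul.comp hc hM) hb))) (Primrec.const true)

theorem PrimrecPred.termMem (d : ℕ) {s c j : α → ℕ} (hs : Primrec s) (hc : Primrec c)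
    (hj : Primrec j) : PrimrecPred fun a => TermMem d (s a) (c a) (j a) := by
  have h : PrimrecPred fun x : ℕ × ℕ × ℕ => TermMem d x.1 x.2.1 x.2.2 := by
    unfold TermMem
    refine PrimrecPred.recPred (α := ℕ × ℕ × ℕ) (G := fun x => TermStep d x.1)
      (M := fun x => codeSize x.1) (c := fun x => x.2.1) (b := fun x => x.2.2) (Primrec.codeSize Primrec.fst) ?_ (Primrec.fst.comp Primrec.snd)
      (Primrec.snd.comp Primrec.snd)
    unfold TermStep
    beta_reduce
    -- The step is composed of equalities, inequalities, connectives, bounded quantifiers and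
    -- arithmetic functions; the closure properties are applied along this syntax.
    repeat' first
      | with_reducible_and_instances exact Primrec.const _
      | with_reducible_and_instances exact Primrec.id_fun
      | with_reducible_and_instances refine PrimrecPred.codeRel ?_ ?_ ?_ ?_
      | with_reducible_and_instances refine PrimrecPred.and ?_ ?_
      | with_reducible_and_instances refine PrimrecPred.or ?_ ?_
      | with_reducible_and_instances refine PrimrecPred.not ?_
      | with_reducible_and_instances refine PrimrecPred.iff ?_ ?_
      | with_reducible_and_instances refine PrimrecPred.forall_bdd ?_ ?_
      | with_reducible_and_instances refine PrimrecPred.exists_bdd ?_ ?_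
      | with_reducible_and_instances refine PrimrecPred.imp ?_ ?_
      | with_reducible_and_instances refine PrimrecRel.comp Primrec.eq ?_ ?_
      | with_reducible_and_instances refine PrimrecRel.comp Primrec.nat_lt ?_ ?_
      | with_reducible_and_instances refine PrimrecRel.comp Primrec.nat_le ?_ ?_
      | with_reducible_and_instances refine Primrec.codeSize ?_
      | with_reducible_and_instances refine Primrec.codeVars ?_
      | with_reducible_and_instances refine Primrec.genBound _ ?_ ?_
      | with_reducible_and_instances refine (Primrec.list_getD false).comp ?_ ?_
      | with_reducible_and_instances refine Primrec.nat_add.comp ?_ ?_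
      | with_reducible_and_instances refine Primrec.nat_mul.comp ?_ ?_
      | with_reducible_and_instances refine Primrec.nat_div.comp ?_ ?_
      | with_reducible_and_instances refine Primrec.nat_mod.comp ?_ ?_
      | with_reducible_and_instances refine Primrec.list_length.comp ?_
      | with_reducible_and_instances refine Primrec.unpair.comp ?_
      | with_reducible_and_instances refine Primrec.fst.comp ?_
      | with_reducible_and_instances refine Primrec.snd.comp ?_
  exact PrimrecPred.comp (f := fun a => (s a, c a, j a)) h (hs.pair (hc.pair hj))

/-- Displays the condition as a conjunction of bounded formulas, to which the closure properties
apply. -/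
theorem isStep_iff (d s t : ℕ) : IsStep d s t ↔ 
    (codeSize t ≤ genBound (d + 1) (codeSize s + 2) 0) ∧
    (codeVars t = codeVars s + 1) ∧
    (∀ i < codeSize t, codeRel t 0 i i) ∧
    (∀ i < codeSize t, ∀ j < codeSize t, ∀ k < codeSize t, codeRel t 0 i j → codeRel t 0 j k → codeRel t 0 i k) ∧
    (∀ i < codeSize t, ∀ j < codeSize t, codeRel t 0 i j → codeRel t 0 j i → i = j) ∧
    (∀ i < codeSize t, ∃ k < d + 1, codeRel t 1 i k ∧ ∀ l < d + 1, codeRel t 1 i l → l = k) ∧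
    (∀ i < codeSize t, ∀ j < codeSize t, ∀ k < d + 1, ∀ l < d + 1, codeRel t 0 i j → i ≠ j → codeRel t 1 i k → codeRel t 1 j l → k < l) ∧
    (∀ k < codeVars t, ∀ i < codeSize t, ∀ j < codeSize t, codeRel t 0 i j → codeRel t 2 k j → codeRel t 2 k i) ∧
    (∀ i < codeSize t, ∃ x < codeSize s, codeRel t 3 i x ∧ ∀ y < codeSize s, codeRel t 3 i y → y = x) ∧
    (∀ x < codeSize s, ∃ i < codeSize t, codeRel t 3 i x) ∧
    (∀ i < codeSize t, ∀ j < codeSize t, ∀ x < codeSize s, ∀ y < codeSize s, codeRel t 0 i j → codeRel t 3 i x → codeRel t 3 j y → codeRel s 0 x y) ∧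
    (∀ i < codeSize t, ∀ x < codeSize s, ∀ y < codeSize s, codeRel t 3 i x → codeRel s 0 x y → ∃ j < codeSize t, codeRel t 0 i j ∧ codeRel t 3 j y) ∧
    (∀ i < codeSize t, ∀ x < codeSize s, ∀ k < d + 1, codeRel t 3 i x → codeRel s 1 x k → ∃ j < codeSize t, codeRel t 0 i j ∧ codeRel t 3 j x ∧ codeRel t 1 j k) ∧
    (∀ k < codeVars s, ∀ i < codeSize t, ∀ x < codeSize s, codeRel t 3 i x → (codeRel t 2 k i ↔ codeRel s 2 k x)) :=
  ⟨fun h => ⟨h.size, h.vars, h.refl, h.trans, h.antisymm, h.dim, h.dim_lt, h.lower, h.map, h.map_surj, h.map_mono, h.map_lift, h.map_dim, h.map_mem⟩,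
    fun ⟨h0, h1, h2, h3, h4, h5, h6, h7, h8, h9, h10, h11, h12, h13⟩ => ⟨h0, h1, h2, h3, h4, h5, h6, h7, h8, h9, h10, h11, h12, h13⟩⟩

theorem PrimrecPred.isStep (d : ℕ) {s t : α → ℕ} (hs : Primrec s) (ht : Primrec t) :
    PrimrecPred fun a => IsStep d (s a) (t a) := by
  have h : PrimrecPred fun x : ℕ × ℕ => IsStep d x.1 x.2 := by
    simp only [isStep_iff, Ne]
    repeat' first
      | with_reducible_and_instances exact Primrec.const _
      | with_reducible_and_instances exact Primrec.id_fun
      | with_reducible_and_instances refine PrimrecPred.codeRel ?_ ?_ ?_ ?_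
      | with_reducible_and_instances refine PrimrecPred.and ?_ ?_
      | with_reducible_and_instances refine PrimrecPred.or ?_ ?_
      | with_reducible_and_instances refine PrimrecPred.not ?_
      | with_reducible_and_instances refine PrimrecPred.iff ?_ ?_
      | with_reducible_and_instances refine PrimrecPred.forall_bdd ?_ ?_
      | with_reducible_and_instances refine PrimrecPred.exists_bdd ?_ ?_
      | with_reducible_and_instances refine PrimrecPred.imp ?_ ?_
      | with_reducible_and_instances refine PrimrecRel.comp Primrec.eq ?_ ?_
      | with_reducible_and_instances refine PrimrecRel.comp Primrec.nat_lt ?_ ?_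
      | with_reducible_and_instances refine PrimrecRel.comp Primrec.nat_le ?_ ?_
      | with_reducible_and_instances refine Primrec.codeSize ?_
      | with_reducible_and_instances refine Primrec.codeVars ?_
      | with_reducible_and_instances refine Primrec.genBound _ ?_ ?_
      | with_reducible_and_instances refine (Primrec.list_getD false).comp ?_ ?_
      | with_reducible_and_instances refine Primrec.nat_add.comp ?_ ?_
      | with_reducible_and_instances refine Primrec.nat_mul.comp ?_ ?_
      | with_reducible_and_instances refine Primrec.nat_div.comp ?_ ?_
      | with_reducible_and_instances refine Primrec.nat_mod.comp ?_ ?_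
      | with_reducible_and_instances refine Primrec.list_length.comp ?_
      | with_reducible_and_instances refine Primrec.unpair.comp ?_
      | with_reducible_and_instances refine Primrec.fst.comp ?_
      | with_reducible_and_instances refine Primrec.snd.comp ?_
  exact PrimrecPred.comp (f := fun a => (s a, t a)) h (hs.pair ht)

theorem PrimrecPred.eval (d : ℕ) {M c s : α → ℕ} (hM : Primrec M) (hc : Primrec c)
    (hs : Primrec s) : PrimrecPred fun a => Eval d (M a) (c a) (s a) := by
  have h : PrimrecPred fun x : ℕ × ℕ × ℕ => Eval d x.1 x.2.1 x.2.2 := by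
    unfold Eval
    refine PrimrecPred.recPred (α := ℕ × ℕ × ℕ) (G := fun x => EvalStep d x.1)
      (M := fun x => x.1) (c := fun x => x.2.1) (b := fun x => x.2.2) Primrec.fst ?_ (Primrec.fst.comp Primrec.snd)
      (Primrec.snd.comp Primrec.snd)
    unfold EvalStep
    beta_reduce
    repeat' first
      | with_reducible_and_instances exact Primrec.const _
      | with_reducible_and_instances exact Primrec.id_fun
      | with_reducible_and_instances refine PrimrecPred.termMem d ?_ ?_ ?_
      | with_reducible_and_instances refine PrimrecPred.isStep d ?_ ?_
      | with_reducible_and_instances refine PrimrecPred.codeRel ?_ ?_ ?_ ?_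
      | with_reducible_and_instances refine PrimrecPred.and ?_ ?_
      | with_reducible_and_instances refine PrimrecPred.or ?_ ?_
      | with_reducible_and_instances refine PrimrecPred.not ?_
      | with_reducible_and_instances refine PrimrecPred.iff ?_ ?_
      | with_reducible_and_instances refine PrimrecPred.forall_bdd ?_ ?_
      | with_reducible_and_instances refine PrimrecPred.exists_bdd ?_ ?_
      | with_reducible_and_instances refine PrimrecPred.imp ?_ ?_
      | with_reducible_and_instances refine PrimrecRel.comp Primrec.eq ?_ ?_
      | with_reducible_and_instances refine PrimrecRel.comp Primrec.nat_lt ?_ ?_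
      | with_reducible_and_instances refine PrimrecRel.comp Primrec.nat_le ?_ ?_
      | with_reducible_and_instances refine Primrec.codeSize ?_
      | with_reducible_and_instances refine Primrec.codeVars ?_
      | with_reducible_and_instances refine Primrec.genBound _ ?_ ?_
      | with_reducible_and_instances refine (Primrec.list_getD false).comp ?_ ?_
      | with_reducible_and_instances refine Primrec.nat_add.comp ?_ ?_
      | with_reducible_and_instances refine Primrec.nat_mul.comp ?_ ?_
      | with_reducible_and_instances refine Primrec.nat_div.comp ?_ ?_
      | with_reducible_and_instances refine Primrec.nat_mod.comp ?_ ?_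
      | with_reducible_and_instances refine Primrec.list_length.comp ?_
      | with_reducible_and_instances refine Primrec.unpair.comp ?_
      | with_reducible_and_instances refine Primrec.fst.comp ?_
      | with_reducible_and_instances refine Primrec.snd.comp ?_
  exact PrimrecPred.comp (f := fun a => (M a, c a, s a)) h (hM.pair (hc.pair hs))

theorem PrimrecPred.wfTerm {n c : α → ℕ} (hn : Primrec n) (hc : Primrec c) :
    PrimrecPred fun a => WfTerm (n a) (c a) := by
  have h : PrimrecPred fun x : ℕ × ℕ => WfTerm x.1 x.2 := by
    unfold WfTerm
    refine PrimrecPred.recPred (α := ℕ × ℕ) (G := fun x c _ => WfTermStep x.1 c)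
      (M := fun _ => 1) (c := fun x => x.2) (b := fun _ => 0) (Primrec.const 1) ?_ Primrec.snd (Primrec.const 0)
    unfold WfTermStep
    beta_reduce
    repeat' first
      | with_reducible_and_instances exact Primrec.const _
      | with_reducible_and_instances exact Primrec.id_fun
      | with_reducible_and_instances refine PrimrecPred.codeRel ?_ ?_ ?_ ?_
      | with_reducible_and_instances refine PrimrecPred.and ?_ ?_
      | with_reducible_and_instances refine PrimrecPred.or ?_ ?_
      | with_reducible_and_instances refine PrimrecPred.not ?_
      | with_reducible_and_instances refine PrimrecPred.iff ?_ ?_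
      | with_reducible_and_instances refine PrimrecPred.forall_bdd ?_ ?_
      | with_reducible_and_instances refine PrimrecPred.exists_bdd ?_ ?_
      | with_reducible_and_instances refine PrimrecPred.imp ?_ ?_
      | with_reducible_and_instances refine PrimrecRel.comp Primrec.eq ?_ ?_
      | with_reducible_and_instances refine PrimrecRel.comp Primrec.nat_lt ?_ ?_
      | with_reducible_and_instances refine PrimrecRel.comp Primrec.nat_le ?_ ?_
      | with_reducible_and_instances refine Primrec.codeSize ?_
      | with_reducible_and_instances refine Primrec.codeVars ?_
      | with_reducible_and_instances refine Primrec.genBound _ ?_ ?_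
      | with_reducible_and_instances refine (Primrec.list_getD false).comp ?_ ?_
      | with_reducible_and_instances refine Primrec.nat_add.comp ?_ ?_
      | with_reducible_and_instances refine Primrec.nat_mul.comp ?_ ?_
      | with_reducible_and_instances refine Primrec.nat_div.comp ?_ ?_
      | with_reducible_and_instances refine Primrec.nat_mod.comp ?_ ?_
      | with_reducible_and_instances refine Primrec.list_length.comp ?_
      | with_reducible_and_instances refine Primrec.unpair.comp ?_
      | with_reducible_and_instances refine Primrec.fst.comp ?_
      | with_reducible_and_instances refine Primrec.snd.comp ?_
  exact PrimrecPred.comp (f := fun a => (n a, c a)) h (hn.pair hc)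

theorem PrimrecPred.wfFormula {M c n : α → ℕ} (hM : Primrec M) (hc : Primrec c)
    (hn : Primrec n) : PrimrecPred fun a => WfFormula (M a) (c a) (n a) := by
  have h : PrimrecPred fun x : ℕ × ℕ × ℕ => WfFormula x.1 x.2.1 x.2.2 := by
    unfold WfFormula
    refine PrimrecPred.recPred (α := ℕ × ℕ × ℕ) (G := fun _ => WfStep)
      (M := fun x => x.1) (c := fun x => x.2.1) (b := fun x => x.2.2) Primrec.fst ?_ (Primrec.fst.comp Primrec.snd)
      (Primrec.snd.comp Primrec.snd)
    unfold WfStep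
    beta_reduce
    repeat' first
      | with_reducible_and_instances exact Primrec.const _
      | with_reducible_and_instances exact Primrec.id_fun
      | with_reducible_and_instances refine PrimrecPred.wfTerm ?_ ?_
      | with_reducible_and_instances refine PrimrecPred.codeRel ?_ ?_ ?_ ?_
      | with_reducible_and_instances refine PrimrecPred.and ?_ ?_
      | with_reducible_and_instances refine PrimrecPred.or ?_ ?_
      | with_reducible_and_instances refine PrimrecPred.not ?_
      | with_reducible_and_instances refine PrimrecPred.iff ?_ ?_
      | with_reducible_and_instances refine PrimrecPred.forall_bdd ?_ ?_
      | with_reducible_and_instances refine PrimrecPred.exists_bdd ?_ ?_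
      | with_reducible_and_instances refine PrimrecPred.imp ?_ ?_
      | with_reducible_and_instances refine PrimrecRel.comp Primrec.eq ?_ ?_
      | with_reducible_and_instances refine PrimrecRel.comp Primrec.nat_lt ?_ ?_
      | with_reducible_and_instances refine PrimrecRel.comp Primrec.nat_le ?_ ?_
      | with_reducible_and_instances refine Primrec.codeSize ?_
      | with_reducible_and_instances refine Primrec.codeVars ?_
      | with_reducible_and_instances refine Primrec.genBound _ ?_ ?_
      | with_reducible_and_instances refine (Primrec.list_getD false).comp ?_ ?_
      | with_reducible_and_instances refine Primrec.nat_add.comp ?_ ?_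
      | with_reducible_and_instances refine Primrec.nat_mul.comp ?_ ?_
      | with_reducible_and_instances refine Primrec.nat_div.comp ?_ ?_
      | with_reducible_and_instances refine Primrec.nat_mod.comp ?_ ?_
      | with_reducible_and_instances refine Primrec.list_length.comp ?_
      | with_reducible_and_instances refine Primrec.unpair.comp ?_
      | with_reducible_and_instances refine Primrec.fst.comp ?_
      | with_reducible_and_instances refine Primrec.snd.comp ?_
  exact PrimrecPred.comp (f := fun a => (M a, c a, n a)) h (hM.pair (hc.pair hn))

theorem Primrec.sizeBound (d N : ℕ) : Primrec (_root_.sizeBound d N) := by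
  have h0 : Primrec₂ fun (_ x : ℕ) => _root_.genBound (d + 1) (x + 2) 0 :=
    Primrec.genBound (d + 1) (Primrec.nat_add.comp Primrec.snd (Primrec.const 2)) (Primrec.const 0)
  have h := Primrec.nat_rec₁ N h0
  refine h.of_eq fun k => ?_
  induction k with
  | zero => rfl
  | succ k ih => simp only [_root_.sizeBound, ← ih]

theorem Primrec.codeBound (d : ℕ) {N n : α → ℕ} (hN : Primrec N) (hn : Primrec n) :
    Primrec fun a => codeBound d (N a) (n a) := by
  have h := Primrec.nat_add.comp (Primrec.nat_add.comp hN hn) (Primrec.const d)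
  exact Primrec₂.natPair.comp hN (Primrec₂.natPair.comp hn (Primrec.nat_pow.comp (Primrec.const 2)
    (Primrec.nat_add.comp (Primrec₂.natPair.comp (Primrec.const 3) (Primrec₂.natPair.comp h h))
      (Primrec.const 1))))

end Primrec

/-! ## Decidability of the theories over prime lattices -/

/-- A bound on the codes needed to evaluate the sentence with code `c` at the coded poset `s`. -/
def evalBound (d s c : ℕ) : ℕ := codeBound d (sizeBound d (codeSize s) c) c + s + 1

/-- The number `s` codes a poset whose lattice of downsets is isomorphic to `P`. -/
def HasCode (d : ℕ) (P : Type) [LSC.Structure P] (s : ℕ) : Prop :=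
  ∃ (X : DimPoset d) (_ : Fintype X) (π : X → ℕ),
    IsCode s X (Fin.elim0 : Fin 0 → X.Low) π ∧ Nonempty (X.Low ≃[LSC] P)

theorem PrimeSubscaledLattice.exists_hasCode {d : ℕ} {P : Type} [LSC.Structure P]
    (hP : PrimeSubscaledLattice d P) :
    ∃ s < codeBound d (genBound (d + 1) 1 0) 0, HasCode d P s := by
  obtain ⟨X, _, hcard, e⟩ := hP.exists_equiv
  obtain ⟨s, hs, π, hπ, -⟩ := exists_isCode X (Fin.elim0 : Fin 0 → X.Low) fun _ => 0
  exact ⟨s, hs.trans_le (codeBound_mono d hcard le_rfl), X, inferInstance, π, hπ, e⟩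

/-- Equal codes give an isomorphism of the two posets that preserves dimensions. The induced
embedding of `P` into `Q` is onto because `Q` is prime. -/
theorem HasCode.nonempty_equiv {d s : ℕ} {P Q : Type} [LSC.Structure P] [LSC.Structure Q]
    (hQ : PrimeSubscaledLattice d Q) (h : HasCode d P s) (h' : HasCode d Q s) :
    Nonempty (P ≃[LSC] Q) := by
  obtain ⟨X, _, π, hπ, ⟨e⟩⟩ := h
  obtain ⟨Y, _, ρ, hρ, ⟨e'⟩⟩ := h'
  have hg : ∀ y, ∃ x, π x = ρ y := fun y => hπ.surj _ (hρ.lt y)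
  choose g hg using hg
  have hle : ∀ y z, g y ≤ g z ↔ y ≤ z := fun y z => by rw [← hπ.le, hg, hg, hρ.le]
  have hsurj : Function.Surjective g := fun x => by
    obtain ⟨y, hy⟩ := hρ.surj _ (hπ.lt x)
    exact ⟨y, hπ.injective ((hg y).trans hy)⟩
  have hgs : IsScMap Y.dim X.dim g := by
    refine ⟨hsurj, fun y z => (hle y z).2, fun y x hx => ?_, fun y => ⟨y, le_rfl, rfl, ?_⟩⟩
    · obtain ⟨z, rfl⟩ := hsurj x
      exact ⟨z, (hle y z).1 hx, rfl⟩
    · have hd : X.dim (g y) < d + 1 := Nat.lt_succ_of_le (X.dim_le _)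
      rw [← hρ.dim y _ hd, ← hg, hπ.dim _ _ hd]
  have f : P ↪[LSC] Q := (e'.toEmbedding.comp (DimPoset.comap g hgs)).comp e.symm.toEmbedding
  have h := hQ.range_eq_top f
  have e'' := f.equivRange
  rw [h] at e''
  exact ⟨Substructure.topEquiv.comp e''⟩

theorem HasCode.eval_iff {d s : ℕ} {P : Type} [LSC.Structure P] (h : HasCode d P s)
    (φ : LSC.Sentence) {M : Type} [LSC.Structure M] (hM : SuperScaledLattice d M)
    (f : P ↪[LSC] M) :
    Eval d (evalBound d s (formulaCode φ)) (formulaCode φ) s ↔ M ⊨ φ := by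
  obtain ⟨X, _, π, hπ, ⟨e⟩⟩ := h
  have h1 : codeBound d (sizeBound d (codeSize s) (formulaCode φ)) (formulaCode φ) ≤
      evalBound d s (formulaCode φ) := by unfold evalBound; omega
  -- A sentence has `n = 0`, so `K` is its code and the initial size bound is `codeSize s` itself.
  -- The summand `s + 1` in `evalBound` ensures that `s` is among the codes searched.
  refine (_root_.eval_iff h1 hM φ (Nat.zero_add _).le hπ (by unfold evalBound; omega) le_rfl
    (f.comp e.toEmbedding)).trans ?_
  unfold Sentence.Realize Formula.Realize
  rw [Subsingleton.elim (fun i => (f.comp e.toEmbedding) (Fin.elim0 i : X.Low)) default]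

/-- The evaluation does not mention the model, so all models over `P` agree with any one of them,
and one exists. Completeness follows in the same way. -/
theorem HasCode.models_iff {d s : ℕ} {P : Type} [LSC.Structure P] (hP : PrimeSubscaledLattice d P)
    (h : HasCode d P s) (φ : LSC.Sentence) :
    superTheoryOver d P ⊨ᵇ φ ↔ Eval d (evalBound d s (formulaCode φ)) (formulaCode φ) s := by
  rw [models_superTheoryOver_sentence_iff hP]
  constructor
  · intro hφ
    obtain ⟨M, _, hM, ⟨f⟩⟩ := hP.exists_model
    exact (h.eval_iff φ hM f).2 (hφ M hM ⟨f⟩)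
  · intro hφ M _ hM ⟨f⟩
    exact (h.eval_iff φ hM f).1 hφ

theorem isComplete_superTheoryOver {d : ℕ} {P : Type} [LSC.Structure P]
    (hP : PrimeSubscaledLattice d P) : (superTheoryOver d P).IsComplete := by
  obtain ⟨s, -, h⟩ := hP.exists_hasCode
  obtain ⟨M, _, hM, ⟨f⟩⟩ := hP.exists_model
  have : M ⊨ superTheoryOver d P := (models_superTheoryOver_iff hP M).2 ⟨hM, ⟨f⟩⟩
  have := nonempty_of_structure M
  refine ⟨Theory.Model.isSatisfiable M, fun φ => ?_⟩
  rw [h.models_iff hP, h.models_iff hP, h.eval_iff φ hM f, h.eval_iff φ.not hM f,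
    Sentence.realize_not]
  exact em _

theorem PrimrecPred.eval_evalBound (d s : ℕ) :
    PrimrecPred fun m => Eval d (evalBound d s m) m s := by
  refine PrimrecPred.eval d ?_ Primrec.id_fun (Primrec.const s)
  exact Primrec.nat_add.comp (Primrec.nat_add.comp (Primrec.codeBound d
    (Primrec.sizeBound d (codeSize s)) Primrec.id_fun) (Primrec.const s)) (Primrec.const 1)

theorem PrimrecPred.forall_fin {α : Type} [Primcodable α] {n : ℕ} {p : Fin n → α → Prop}
    (h : ∀ i, PrimrecPred (p i)) : PrimrecPred fun a => ∀ i, p i a := by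
  induction n with
  | zero => exact (Primrec.eq.comp (Primrec.const 0) (Primrec.const 0)).of_eq fun a =>
      iff_of_true rfl fun i => i.elim0
  | succ n ih =>
    exact ((h 0).and (ih fun i => h i.succ)).of_eq fun a => by rw [Fin.forall_fin_succ]

/-- The predicate `p` is meaningful only on codes of sentences, so it is intersected with
well-formedness. For no free variables and code `m`, the bound `m + 1` suffices. -/
theorem isRecursiveSet_of_primrecPred {A : Set LSC.Sentence} {p : ℕ → Prop} (hp : PrimrecPred p)
    (h : ∀ φ : LSC.Sentence, φ ∈ A ↔ p (formulaCode φ)) : IsRecursiveSet A := by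
  have hwf : PrimrecPred fun m => WfFormula (m + 1) m 0 :=
    PrimrecPred.wfFormula Primrec.succ Primrec.id_fun (Primrec.const 0)
  have : PrimrecPred fun m => ∃ φ ∈ A, formulaCode φ = m := by
    refine (hwf.and hp).of_eq fun m => ?_
    rw [wfFormula_iff _ _ _ (by omega)]
    constructor
    · rintro ⟨⟨φ, rfl⟩, hφ⟩
      exact ⟨φ, (h φ).2 hφ, rfl⟩
    · rintro ⟨φ, hφ, rfl⟩
      exact ⟨⟨φ, rfl⟩, (h φ).1 hφ⟩
  obtain ⟨_, this⟩ := this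
  exact ⟨_, this.to_comp⟩

theorem isDecidableTheory_superTheoryOver {d : ℕ} {P : Type} [LSC.Structure P]
    (hP : PrimeSubscaledLattice d P) : IsDecidableTheory (superTheoryOver d P) := by
  obtain ⟨s, -, h⟩ := hP.exists_hasCode
  exact isRecursiveSet_of_primrecPred (PrimrecPred.eval_evalBound d s) (h.models_iff hP)

/-- The consequences of a decidable theory form a recursive set with the same models; this is the
source of the recursive axiomatizations. -/
theorem models_consequences_iff (T : LSC.Theory) (M : Type) [LSC.Structure M] :
    M ⊨ ({φ | T ⊨ᵇ φ} : LSC.Theory) ↔ M ⊨ T := by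
  constructor
  · intro h
    exact h.mono fun φ hφ => Theory.models_sentence_of_mem hφ
  · intro h
    have := nonempty_of_structure M
    exact (Theory.model_iff _).2 fun φ hφ => hφ.realize_sentence M

/-- There are finitely many prime subscaled lattices up to isomorphism. -/
theorem exists_fin_primes (d : ℕ) :
    ∃ (n : ℕ) (Q : Fin n → Type) (_ : ∀ i, LSC.Structure (Q i)),
      (∀ i, PrimeSubscaledLattice d (Q i)) ∧
      ∀ (P : Type) [LSC.Structure P], PrimeSubscaledLattice d P →
        ∃ i, Nonempty (P ≃[LSC] Q i) := by
  let S := {s : Fin (codeBound d (genBound (d + 1) 1 0) 0) //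
    ∃ (P : Type) (_ : LSC.Structure P), PrimeSubscaledLattice d P ∧ HasCode d P s}
  choose Q hQ hQ₁ hQ₂ using fun s : S => s.2
  have e := Finite.equivFin S
  refine ⟨_, fun i => Q (e.symm i), fun i => hQ (e.symm i), fun i => hQ₁ _, fun P _ hP => ?_⟩
  obtain ⟨s, hs, h⟩ := hP.exists_hasCode
  refine ⟨e ⟨⟨s, hs⟩, P, _, hP, h⟩, ?_⟩
  have h1 := hQ₂ (e.symm (e ⟨⟨s, hs⟩, P, _, hP, h⟩))
  have h2 : ((e.symm (e ⟨⟨s, hs⟩, P, _, hP, h⟩)).1 : ℕ) = s := by rw [Equiv.symm_apply_apply]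
  rw [h2] at h1
  exact h.nonempty_equiv (hQ₁ _) h1

/-- Every super scaled lattice contains the prime lattice generated by its constants. So a sentence
holds in all of them exactly when its evaluation succeeds at the codes of the finitely many prime
lattices. -/
theorem isDecidableTheory_superTheory (d : ℕ) : IsDecidableTheory (superTheory d) := by
  obtain ⟨n, Q, _, hQ, hall⟩ := exists_fin_primes d
  choose s _ hs using fun i => (hQ i).exists_hasCode
  refine isRecursiveSet_of_primrecPred
    (PrimrecPred.forall_fin fun i => PrimrecPred.eval_evalBound d (s i)) fun φ => ?_
  rw [Set.mem_ofPred_eq, models_superTheory_sentence_iff]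
  constructor
  · intro h i
    rw [← (hs i).models_iff (hQ i), models_superTheoryOver_sentence_iff (hQ i)]
    exact fun M _ hM _ => h M hM
  · intro h M _ hM
    obtain ⟨i, ⟨e⟩⟩ := hall _ hM.subscaledLattice.prime_closure
    exact ((hs i).eval_iff φ hM ((Substructure.subtype _).comp e.symm.toEmbedding)).1 (h i)

/-- A model `M` of a completion contains the prime lattice generated by its constants, and the
theory over that lattice is complete and true in `M`. Two complete theories with a common model have
the same consequences. -/
theorem isCompletion_superTheory_iff (d : ℕ) (T : LSC.Theory) : IsCompletion (superTheory d) T ↔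
    ∃ (P : Type) (_ : LSC.Structure P),
      PrimeSubscaledLattice d P ∧ SameConsequences T (superTheoryOver d P) := by
  constructor
  · rintro ⟨hT, hd⟩
    obtain ⟨M⟩ := hT.1
    have hM : SuperScaledLattice d M := (models_superTheory_iff d M).1
      ((Theory.model_iff _).2 fun φ hφ => (hd φ hφ).realize_sentence M)
    have hP := hM.subscaledLattice.prime_closure
    have hMP : M ⊨ superTheoryOver d (Substructure.closure LSC (∅ : Set M)) :=
      (models_superTheoryOver_iff hP M).2 ⟨hM, ⟨Substructure.subtype _⟩⟩
    refine ⟨_, inferInstance, hP, fun φ => ?_⟩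
    rw [← hT.realize_sentence_iff φ M, ← (isComplete_superTheoryOver hP).realize_sentence_iff φ M]
  · rintro ⟨P, _, hP, h⟩
    have hc := isComplete_superTheoryOver hP
    refine ⟨⟨?_, fun φ => (hc.2 φ).imp (h φ).2 (h φ.not).2⟩, fun φ hφ => (h φ).2 ?_⟩
    -- An unsatisfiable `T` would entail falsum, and so would the theory over `P`, which has a
    -- model.
    · by_contra hT
      have h1 : T ⊨ᵇ (⊥ : LSC.Sentence) := Theory.models_sentence_iff.2 fun M => (hT ⟨M⟩).elim
      obtain ⟨M⟩ := hc.1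
      exact ((h _).1 h1).realize_sentence M
    · exact (models_superTheoryOver_sentence_iff hP φ).2 fun M _ hM _ => hφ M hM

theorem mainTheorem3 (d : ℕ) :
    -- the theory over a given prime lattice
    (∀ (P : Type) [LSC.Structure P], PrimeSubscaledLattice d P →
      Cardinal.Categorical Cardinal.aleph0.{0} (superTheoryOver d P) ∧
      (superTheoryOver d P).IsComplete ∧
      (∃ A : LSC.Theory, IsRecursiveSet A ∧
        ∀ (M : Type) [LSC.Structure M],
          M ⊨ A ↔ SuperScaledLattice d M ∧ Nonempty (P ↪[LSC] M)) ∧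
      IsDecidableTheory (superTheoryOver d P)) ∧
    -- there are finitely many prime lattices up to isomorphism
    (∃ (n : ℕ) (Q : Fin n → Type) (_ : ∀ i, LSC.Structure (Q i)),
      (∀ i, PrimeSubscaledLattice d (Q i)) ∧
      ∀ (P : Type) [LSC.Structure P], PrimeSubscaledLattice d P →
        ∃ i, Nonempty (P ≃[LSC] Q i)) ∧
    -- the completions
    (∀ T : LSC.Theory, IsCompletion (superTheory d) T ↔
      ∃ (P : Type) (_ : LSC.Structure P),
        PrimeSubscaledLattice d P ∧ SameConsequences T (superTheoryOver d P)) ∧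
    -- finite axiomatizability, up to the vanishing of the `C^i` with `i > d`
    (∃ F : LSC.Theory, F.Finite ∧
      ∀ (M : Type) [LSC.Structure M],
        SuperScaledLattice d M ↔
          M ⊨ F ∧ ∀ i : ℕ, d < i → ∀ a : M,
            pcMap M i a = Structure.funMap (L := LSC) ScFunc.bot ![]) ∧
    -- recursive axiomatizability and decidability
    (∃ A : LSC.Theory, IsRecursiveSet A ∧
      ∀ (M : Type) [LSC.Structure M], M ⊨ A ↔ SuperScaledLattice d M) ∧
    IsDecidableTheory (superTheory d) := by
  refine ⟨fun P _ hP => ⟨categorical_superTheoryOver hP, isComplete_superTheoryOver hP,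
    ⟨_, isDecidableTheory_superTheoryOver hP, fun M _ => ?_⟩,
    isDecidableTheory_superTheoryOver hP⟩, exists_fin_primes d, isCompletion_superTheory_iff d,
    exists_finite_axioms d, ⟨_, isDecidableTheory_superTheory d, fun M _ => ?_⟩,
    isDecidableTheory_superTheory d⟩
  · rw [models_consequences_iff, models_superTheoryOver_iff hP]
  · rw [models_consequences_iff, models_superTheory_iff]
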